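/- Let $A$ be a $C^*$-algebra (not necessarily unital), $G$ a finite group and $\sigma: G\to \mathrm{Aut}(A)$ a homomorphism. Let $A\rtimes_\sigma G$ be the crossed product $C^*$-algebra (the functions $G\to A$ with $(fg)(s)=\sum_t f(t)\sigma_t(g(t^{-1}s))$ and $f^*(s)=\sigma_s(f(s^{-1})^*)$, with its $C^*$-norm), and let $\widehat{A\rtimes_\sigma G}$ be its dual space, the set of unitary equivalence classes of irreducible representations on Hilbert spaces. A covariant representation $(\pi,U)$ of $(A,G,\sigma)$ is identified with the representation $f\mapsto\sum_s\pi(f(s))U(s)$ of $A\rtimes_\sigma G$. For an irreducible representation $\pi$ of $A$ put $G_\pi=\{s\in G: \pi\circ\sigma_s \text{ is unitarily equivalent to } \pi\}$. A family of unitaries $V=(V_s)_{s\in G_\pi}$ with $V_s\pi(a)V_s^*=\pi(\sigma_s a)$ exists, and every such family is a projective representation $V_sV_t=\omega(s,t)V_{st}$ of $G_\pi$ with a unique multiplier $\omega:G_\pi\times G_\pi\to\mathbb T$. Let $\Gamma$ be the set of pairs $(\pi,W_\omega)$, where $\pi$ is an irreducible representation of $A$ together with such a $V$, $\omega$ is the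 multiplier of $V$, and $W=W_\omega$ is an irreducible unitary $\omega$-representation of $G_\pi$ (so $W_sW_t=\omega(s,t)W_{st}$). Two pairs, formed with $V_1$ and $V_2$, are equivalent if there are unitaries $T,R$ and scalars $c(s)\in\mathbb T$ with $T\pi_1(\cdot)T^*=\pi_2$, $T V_1(s)T^*=c(s)V_2(s)$ and $R W_1(s)R^*=c(s)W_2(s)$ for all $s\in G_{\pi_1}=G_{\pi_2}$. Let $\widetilde\Gamma$ be the set of equivalence classes. For fixed $\pi$ and $V$, two pairs $(\pi,W)$ and $(\pi,W')$ are equivalent if and only if $W$ and $W'$ are unitarily equivalent, and every class in $\widetilde\Gamma$ whose first component is equivalent to $\pi$ is the class of such a pair $(\pi,W)$. The group $G$ acts (from the right) on $\widetilde\Gamma$ by $(\pi,W)\mapsto(\pi\circ\sigma_s,\,s\cdot W)$, formed with $s\cdot V$, where $(s\cdot W)(s^{-1}ts)=W(t)$ and $(s\cdot V)(s^{-1}ts)=V(t)$ for $t\in G_\pi$. For $(\pi,W)\in\Gamma$ let $\overline W$ be the conjugate of $W$, and let $\Phi(\pi,W)=\mathrm{Ind}(\pi\otimes1,\,V\otimes\overline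 W)$ be the covariant representation of $(A,G,\sigma)$ induced from the covariant representation $(\pi\otimes 1, V\otimes\overline W)$ of $(A,G_\pi,\sigma)$ on $H_0$: on the space of functions $\xi:G\to H_0$ with $\xi(ts)=(V\otimes\overline W)(t)\xi(s)$ for $t\in G_\pi$, $s\in G$, with inner product $\langle\xi,\eta\rangle=\sum_s\langle\xi(s),\eta(s)\rangle$, the group acts by $(t\xi)(s)=\xi(st)$ and $A$ acts by $(a\xi)(s)=(\pi\otimes1)(\sigma_s a)\xi(s)$. Then every $\Phi(\pi,W)$ is irreducible, and $(\pi,W)\mapsto[\Phi(\pi,W)]$ induces a well-defined bijection from the set of $G$-orbits in $\widetilde\Gamma$ onto $\widehat{A\rtimes_\sigma G}$. -/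

import Mathlib

set_option linter.unusedSectionVars false

universe u v w

open scoped TensorProduct

/-! ### The crossed product of a C⋆-algebra by a finite group -/

/-- The crossed product `A ⋊_σ G` for a finite group `G`: all functions `G → A`. -/
def CrossedProduct {G : Type v} [Group G] {A : Type u} [NonUnitalCStarAlgebra A]
    (_σ : G →* (A ≃⋆ₐ[ℂ] A)) : Type (max u v) := G → A

namespace CrossedProduct

variable {G : Type v} [Group G] {A : Type u} [NonUnitalCStarAlgebra A]
  {σ : G →* (A ≃⋆ₐ[ℂ] A)}

instance : AddCommGroup (CrossedProduct σ) := inferInstanceAs (AddCommGroup (G → A))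

instance : Module ℂ (CrossedProduct σ) := inferInstanceAs (Module ℂ (G → A))

/-- Twisted convolution `(f * g)(s) = ∑ t, f(t) σ_t(g(t⁻¹ s))`. -/
instance [Fintype G] : Mul (CrossedProduct σ) :=
  ⟨fun f g s => ∑ t : G, f t * σ t (g (t⁻¹ * s))⟩

/-- Twisted involution `f⋆(s) = σ_s(f(s⁻¹)⋆)`. -/
instance : Star (CrossedProduct σ) := ⟨fun f s => σ s (star (f s⁻¹))⟩

@[ext] theorem ext {f g : CrossedProduct σ} (h : ∀ s, f s = g s) : f = g := funext h

theorem add_apply (f g : CrossedProduct σ) (s : G) : (f + g) s = f s + g s := rfl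

theorem zero_apply (s : G) : (0 : CrossedProduct σ) s = 0 := rfl

theorem smul_apply (c : ℂ) (f : CrossedProduct σ) (s : G) : (c • f) s = c • f s := rfl

theorem mul_apply [Fintype G] (f g : CrossedProduct σ) (s : G) :
    (f * g) s = ∑ t : G, f t * σ t (g (t⁻¹ * s)) := rfl

theorem star_apply (f : CrossedProduct σ) (s : G) : (star f) s = σ s (star (f s⁻¹)) := rfl

theorem aut_mul (σ : G →* (A ≃⋆ₐ[ℂ] A)) (s t : G) (a : A) : σ (s * t) a = σ s (σ t a) := by
  rw [map_mul, StarAlgEquiv.mul_apply]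

theorem aut_one (σ : G →* (A ≃⋆ₐ[ℂ] A)) (a : A) : σ 1 a = a := by
  rw [map_one, StarAlgEquiv.one_apply]

theorem aut_inv_cancel (σ : G →* (A ≃⋆ₐ[ℂ] A)) (s : G) (a : A) : σ s⁻¹ (σ s a) = a := by
  rw [← aut_mul, inv_mul_cancel, aut_one]

theorem aut_cancel_inv (σ : G →* (A ≃⋆ₐ[ℂ] A)) (s : G) (a : A) : σ s (σ s⁻¹ a) = a := by
  rw [← aut_mul, mul_inv_cancel, aut_one]

/-- The regular representation of the crossed product by `G × G` matrices over `A`: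
`f ↦ (σ_{s⁻¹}(f(s t⁻¹)))_{s,t}`. -/
def toMatrix (f : CrossedProduct σ) : CStarMatrix G G A :=
  CStarMatrix.ofMatrix fun s t => σ s⁻¹ (f (s * t⁻¹))

theorem toMatrix_apply (f : CrossedProduct σ) (s t : G) :
    toMatrix f s t = σ s⁻¹ (f (s * t⁻¹)) := rfl

theorem toMatrix_injective : Function.Injective (toMatrix (σ := σ)) := by
  intro f g h
  ext s
  have h1 := congrFun (congrFun h s) 1
  change σ s⁻¹ (f (s * 1⁻¹)) = σ s⁻¹ (g (s * 1⁻¹)) at h1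
  simpa using h1

theorem toMatrix_zero : toMatrix (0 : CrossedProduct σ) = 0 := by
  ext s t
  exact map_zero (σ s⁻¹)

theorem toMatrix_add (f g : CrossedProduct σ) : toMatrix (f + g) = toMatrix f + toMatrix g := by
  ext s t
  exact map_add (σ s⁻¹) _ _

theorem toMatrix_smul (c : ℂ) (f : CrossedProduct σ) : toMatrix (c • f) = c • toMatrix f := by
  ext s t
  exact map_smul (σ s⁻¹) c _

theorem toMatrix_star (f : CrossedProduct σ) : toMatrix (star f) = star (toMatrix f) := by
  ext s t
  change σ s⁻¹ (σ (s * t⁻¹) (star (f (s * t⁻¹)⁻¹))) = star (σ t⁻¹ (f (t * s⁻¹)))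
  rw [← aut_mul, ← map_star]
  simp

theorem toMatrix_mul [Fintype G] (f g : CrossedProduct σ) :
    toMatrix (f * g) = toMatrix f * toMatrix g := by
  ext s t
  rw [CStarMatrix.mul_apply, toMatrix_apply, mul_apply, map_sum]
  refine Fintype.sum_equiv ((Equiv.inv G).trans (Equiv.mulRight s)) _ _ fun r => ?_
  simp only [toMatrix_apply, map_mul, Equiv.trans_apply, Equiv.inv_apply, Equiv.coe_mulRight]
  simp [mul_assoc]

theorem range_toMatrix : Set.range (toMatrix (σ := σ)) =
    {M | ∀ s t r : G, σ r (M (s * r) (t * r)) = M s t} := by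
  ext M
  constructor
  · rintro ⟨f, rfl⟩ s t r
    simp only [toMatrix_apply]
    rw [← aut_mul]
    simp [mul_assoc]
  · intro h
    refine ⟨fun s => σ s (M s 1), ?_⟩
    ext s t
    change σ s⁻¹ (σ (s * t⁻¹) (M (s * t⁻¹) 1)) = M s t
    rw [← aut_mul, inv_mul_cancel_left, ← h s t t⁻¹, mul_inv_cancel]

variable [Fintype G]

instance : NonUnitalRing (CrossedProduct σ) where
  left_distrib f g h := toMatrix_injective (by simp only [toMatrix_mul, toMatrix_add, mul_add])
  right_distrib f g h := toMatrix_injective (by simp only [toMatrix_mul, toMatrix_add, add_mul])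
  zero_mul f := toMatrix_injective (by simp only [toMatrix_mul, toMatrix_zero, zero_mul])
  mul_zero f := toMatrix_injective (by simp only [toMatrix_mul, toMatrix_zero, mul_zero])
  mul_assoc f g h := toMatrix_injective (by simp only [toMatrix_mul, mul_assoc])

/-- The regular representation as a homomorphism of rings. -/
def toMatrixHom : CrossedProduct σ →ₙ+* CStarMatrix G G A where
  toFun := toMatrix
  map_mul' := toMatrix_mul
  map_zero' := toMatrix_zero
  map_add' := toMatrix_add

section CStar

attribute [local instance] CStarAlgebra.spectralOrder CStarAlgebra.spectralOrderedRing

/-- The norm of the crossed product is the operator norm in the (faithful) regular representation;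
the crossed product by a finite group is complete for it, so it is the only C⋆-norm. -/
noncomputable instance : NonUnitalNormedRing (CrossedProduct σ) :=
  NonUnitalNormedRing.induced (CrossedProduct σ) (CStarMatrix G G A) toMatrixHom
    toMatrix_injective

theorem norm_def (f : CrossedProduct σ) : ‖f‖ = ‖toMatrix f‖ := rfl

theorem isometry_toMatrix : Isometry (toMatrix (σ := σ)) :=
  AddMonoidHomClass.isometry_of_norm (toMatrixHom (σ := σ)) fun _ => rfl

theorem isClosed_range_toMatrix : IsClosed (Set.range (toMatrix (σ := σ))) := by
  rw [range_toMatrix]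
  simp only [Set.ofPred_forall]
  refine isClosed_iInter fun s => isClosed_iInter fun t => isClosed_iInter fun r => ?_
  have hc : ∀ i j : G, Continuous fun M : CStarMatrix G G A => M i j := fun i j =>
    (continuous_apply j).comp (continuous_apply i)
  have hσ : Continuous (σ r) := (NonUnitalStarAlgHom.isometry (F := A ≃⋆ₐ[ℂ] A) (σ r)
    (EquivLike.injective _)).continuous
  exact isClosed_eq (hσ.comp (hc _ _)) (hc _ _)

theorem completeSpace : CompleteSpace (CrossedProduct σ) := by
  rw [completeSpace_iff_isComplete_range isometry_toMatrix.isUniformInducing]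
  exact isClosed_range_toMatrix.isComplete

noncomputable instance : NonUnitalCStarAlgebra (CrossedProduct σ) where
  star_involutive f := toMatrix_injective (by simp only [toMatrix_star, star_star])
  star_mul f g := toMatrix_injective (by simp only [toMatrix_star, toMatrix_mul, star_mul])
  star_add f g := toMatrix_injective (by simp only [toMatrix_star, toMatrix_add, star_add])
  toCompleteSpace := completeSpace
  norm_mul_self_le f := by
    simp only [norm_def, toMatrix_mul, toMatrix_star]
    exact CStarRing.norm_mul_self_le _
  norm_smul_le c f := by
    simp only [norm_def, toMatrix_smul]
    exact norm_smul_le _ _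
  smul_assoc c f g := toMatrix_injective (by
    simp only [smul_eq_mul, toMatrix_smul, toMatrix_mul, smul_mul_assoc])
  smul_comm c f g := toMatrix_injective (by
    simp only [smul_eq_mul, toMatrix_smul, toMatrix_mul, mul_smul_comm])
  star_smul c f := toMatrix_injective (by
    simp only [toMatrix_star, toMatrix_smul, star_smul])

end CStar

end CrossedProduct

/-! ### Representations of C⋆-algebras on Hilbert spaces -/

/-- A ⋆-representation `π : B → 𝓑(H)` is nondegenerate if the vectors `π(b)x` span a dense
subspace of `H`. -/
def IsNondegenerate {B : Type u} [NonUnitalCStarAlgebra B] {H : Type w} [NormedAddCommGroup H]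
    [InnerProductSpace ℂ H] [CompleteSpace H] (π : B →⋆ₙₐ[ℂ] (H →L[ℂ] H)) : Prop :=
  (Submodule.span ℂ {y : H | ∃ (b : B) (x : H), π b x = y}).topologicalClosure = ⊤

theorem isNondegenerate_iff {B : Type u} [NonUnitalCStarAlgebra B] {H : Type w}
    [NormedAddCommGroup H] [InnerProductSpace ℂ H] [CompleteSpace H]
    (π : B →⋆ₙₐ[ℂ] (H →L[ℂ] H)) :
    IsNondegenerate π ↔ ∀ x : H, (∀ b, π b x = 0) → x = 0 := by
  have key : ∀ x : H, x ∈ (Submodule.span ℂ {y : H | ∃ (b : B) (x : H), π b x = y})ᗮ ↔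
      ∀ b, π b x = 0 := by
    intro x
    rw [Submodule.mem_orthogonal]
    constructor
    · intro h b
      have h1 := h (π (star b) (π b x)) (Submodule.subset_span ⟨_, _, rfl⟩)
      rw [map_star, ContinuousLinearMap.star_eq_adjoint,
        ContinuousLinearMap.adjoint_inner_left] at h1
      exact inner_self_eq_zero.mp h1
    · intro h u hu
      induction hu using Submodule.span_induction with
      | mem y hy =>
        obtain ⟨b, z, rfl⟩ := hy
        rw [← ContinuousLinearMap.adjoint_inner_right, ← ContinuousLinearMap.star_eq_adjoint,
          ← map_star, h, inner_zero_right]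
      | zero => exact inner_zero_left _
      | add y z _ _ hy hz => rw [inner_add_left, hy, hz, add_zero]
      | smul c y _ hy => rw [inner_smul_left, hy, mul_zero]
  unfold IsNondegenerate
  rw [Submodule.topologicalClosure_eq_top_iff, Submodule.eq_bot_iff]
  exact forall_congr' fun x => by rw [key]

section Rep

variable {B : Type u} [NonUnitalCStarAlgebra B]
  {H : Type w} [NormedAddCommGroup H] [InnerProductSpace ℂ H] [CompleteSpace H]
  {H₁ : Type*} [NormedAddCommGroup H₁] [InnerProductSpace ℂ H₁] [CompleteSpace H₁]
  {H₂ : Type*} [NormedAddCommGroup H₂] [InnerProductSpace ℂ H₂] [CompleteSpace H₂]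
  {H₃ : Type*} [NormedAddCommGroup H₃] [InnerProductSpace ℂ H₃] [CompleteSpace H₃]

/-- A ⋆-representation on a Hilbert space is irreducible if it is nondegenerate, the space is
nonzero, and the only closed invariant subspaces are `0` and the whole space. -/
structure IsIrreducibleRep (π : B →⋆ₙₐ[ℂ] (H →L[ℂ] H)) : Prop where
  nondeg : IsNondegenerate π
  nontrivial : Nontrivial H
  eq_bot_or_top : ∀ L : Submodule ℂ H, IsClosed (L : Set H) →
    (∀ b, ∀ x ∈ L, π b x ∈ L) → L = ⊥ ∨ L = ⊤

/-- The unitary `T` intertwines `π₁` and `π₂`, i.e. `T π₁(b) T⋆ = π₂(b)`. -/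
def Intertwines (π₁ : B →⋆ₙₐ[ℂ] (H₁ →L[ℂ] H₁)) (π₂ : B →⋆ₙₐ[ℂ] (H₂ →L[ℂ] H₂))
    (T : H₁ ≃ₗᵢ[ℂ] H₂) : Prop :=
  ∀ b x, T (π₁ b x) = π₂ b (T x)

/-- Unitary equivalence of representations. -/
def UnitarilyEquivalent (π₁ : B →⋆ₙₐ[ℂ] (H₁ →L[ℂ] H₁)) (π₂ : B →⋆ₙₐ[ℂ] (H₂ →L[ℂ] H₂)) :
    Prop :=
  ∃ T : H₁ ≃ₗᵢ[ℂ] H₂, Intertwines π₁ π₂ T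

theorem Intertwines.symm {π₁ : B →⋆ₙₐ[ℂ] (H₁ →L[ℂ] H₁)} {π₂ : B →⋆ₙₐ[ℂ] (H₂ →L[ℂ] H₂)}
    {T : H₁ ≃ₗᵢ[ℂ] H₂} (h : Intertwines π₁ π₂ T) : Intertwines π₂ π₁ T.symm := fun b x => by
  rw [LinearIsometryEquiv.symm_apply_eq, h, LinearIsometryEquiv.apply_symm_apply]

theorem Intertwines.trans {π₁ : B →⋆ₙₐ[ℂ] (H₁ →L[ℂ] H₁)} {π₂ : B →⋆ₙₐ[ℂ] (H₂ →L[ℂ] H₂)}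
    {π₃ : B →⋆ₙₐ[ℂ] (H₃ →L[ℂ] H₃)} {T : H₁ ≃ₗᵢ[ℂ] H₂} {S : H₂ ≃ₗᵢ[ℂ] H₃}
    (hT : Intertwines π₁ π₂ T) (hS : Intertwines π₂ π₃ S) :
    Intertwines π₁ π₃ (T.trans S) := fun b x => by
  rw [LinearIsometryEquiv.trans_apply, hT, hS, LinearIsometryEquiv.trans_apply]

/-- The representation `π ∘ φ`, for an automorphism `φ`. -/
noncomputable def compAut (π : B →⋆ₙₐ[ℂ] (H →L[ℂ] H)) (φ : B ≃⋆ₐ[ℂ] B) :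
    B →⋆ₙₐ[ℂ] (H →L[ℂ] H) where
  toFun b := π (φ b)
  map_smul' c b := by simp
  map_zero' := by simp
  map_add' a b := by simp
  map_mul' a b := by simp
  map_star' b := by simp [map_star]

theorem compAut_apply (π : B →⋆ₙₐ[ℂ] (H →L[ℂ] H)) (φ : B ≃⋆ₐ[ℂ] B) (b : B) :
    compAut π φ b = π (φ b) := rfl

theorem IsIrreducibleRep.compAut {π : B →⋆ₙₐ[ℂ] (H →L[ℂ] H)} (h : IsIrreducibleRep π)
    (φ : B ≃⋆ₐ[ℂ] B) : IsIrreducibleRep (compAut π φ) where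
  nondeg := by
    rw [isNondegenerate_iff]
    intro x hx
    refine (isNondegenerate_iff π).mp h.nondeg x fun b => ?_
    have h := hx (φ.symm b)
    rwa [compAut_apply, StarAlgEquiv.apply_symm_apply] at h
  nontrivial := h.nontrivial
  eq_bot_or_top K hK hinv := h.eq_bot_or_top K hK fun b x hx => by
    have := hinv (φ.symm b) x hx
    rwa [compAut_apply, StarAlgEquiv.apply_symm_apply] at this

end Rep

/-- A bundled complex Hilbert space in universe `w`. -/
structure HilbSpace : Type (w + 1) where
  carrier : Type w
  [normed : NormedAddCommGroup carrier]
  [inner : InnerProductSpace ℂ carrier]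
  [complete : CompleteSpace carrier]

attribute [instance] HilbSpace.normed HilbSpace.inner HilbSpace.complete

instance : CoeSort HilbSpace.{w} (Type w) := ⟨HilbSpace.carrier⟩

/-- A bundled finite-dimensional complex Hilbert space in universe `w`. -/
structure FinHilbSpace : Type (w + 1) where
  carrier : Type w
  [normed : NormedAddCommGroup carrier]
  [inner : InnerProductSpace ℂ carrier]
  [finite : FiniteDimensional ℂ carrier]

attribute [instance] FinHilbSpace.normed FinHilbSpace.inner FinHilbSpace.finite

instance : CoeSort FinHilbSpace.{w} (Type w) := ⟨FinHilbSpace.carrier⟩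

/-- Irreducible representations of `B` on Hilbert spaces in universe `w`. -/
structure IrrRep (B : Type u) [NonUnitalCStarAlgebra B] : Type (max u (w + 1)) where
  H : HilbSpace.{w}
  π : B →⋆ₙₐ[ℂ] (H →L[ℂ] H)
  irred : IsIrreducibleRep π

instance IrrRep.setoid (B : Type u) [NonUnitalCStarAlgebra B] : Setoid (IrrRep.{u, w} B) where
  r ρ₁ ρ₂ := UnitarilyEquivalent ρ₁.π ρ₂.π
  iseqv :=
    { refl := fun _ => ⟨.refl ℂ _, fun _ _ => rfl⟩
      symm := fun ⟨T, hT⟩ => ⟨T.symm, hT.symm⟩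
      trans := fun ⟨T, hT⟩ ⟨S, hS⟩ => ⟨T.trans S, hT.trans hS⟩ }

/-- The dual space of `B`: unitary equivalence classes of irreducible representations. (Every
irreducible representation of `B : Type u` is cyclic, so it is equivalent to one on a Hilbert space
in universe `u`, and nothing is lost when `w ≥ u`.) -/
def DualSpace (B : Type u) [NonUnitalCStarAlgebra B] : Type (max u (w + 1)) :=
  Quotient (IrrRep.setoid.{u, w} B)

/-! ### Conjugate Hilbert spaces and tensor products -/

/-- The conjugate Hilbert space of `K`: scalars act through complex conjugation. -/
def ConjSpace (K : Type w) : Type w := K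

namespace ConjSpace

variable {K : Type w} [NormedAddCommGroup K] [InnerProductSpace ℂ K]

instance : NormedAddCommGroup (ConjSpace K) := inferInstanceAs (NormedAddCommGroup K)

/-- The identity map from `K` to its conjugate space. -/
def of : K ≃+ ConjSpace K := AddEquiv.refl K

noncomputable instance : Module ℂ (ConjSpace K) := Module.compHom K (starRingEnd ℂ)

theorem of_smul (c : ℂ) (x : K) : of (c • x) = star c • of x := by
  change c • x = (starRingEnd ℂ) (star c) • x
  simp

noncomputable instance : InnerProductSpace ℂ (ConjSpace K) where
  norm_smul_le c x := by
    have h : c • x = of (star c • of.symm x) := by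
      rw [of_smul, star_star, AddEquiv.apply_symm_apply]
    rw [h, ← norm_star c]
    exact norm_smul_le (star c) (of.symm x)
  inner x y := inner ℂ (of.symm y) (of.symm x)
  norm_sq_eq_re_inner x := norm_sq_eq_re_inner (𝕜 := ℂ) (E := K) x
  conj_inner_symm x y := inner_conj_symm (𝕜 := ℂ) (E := K) _ _
  add_left x y z := inner_add_right (𝕜 := ℂ) (E := K) _ _ _
  smul_left x y c := inner_smul_right (𝕜 := ℂ) (E := K) _ _ _

theorem inner_of (x y : K) : inner ℂ (of x) (of y) = inner ℂ y x := rfl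

instance [FiniteDimensional ℂ K] : FiniteDimensional ℂ (ConjSpace K) :=
  Module.Finite.of_surjective (σ := starRingEnd ℂ)
    { toFun := of, map_add' := fun _ _ => rfl, map_smul' := of_smul } of.surjective

/-- A unitary `W` of `K`, viewed as a unitary of the conjugate space. -/
def conj (W : K ≃ₗᵢ[ℂ] K) : ConjSpace K ≃ₗᵢ[ℂ] ConjSpace K where
  toFun x := of (W (of.symm x))
  invFun x := of (W.symm (of.symm x))
  left_inv _ := W.symm_apply_apply _
  right_inv _ := W.apply_symm_apply _
  map_add' _ _ := map_add W _ _
  map_smul' c x := W.map_smul ((starRingEnd ℂ) c) (of.symm x)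
  norm_map' _ := W.norm_map _

theorem conj_of (W : K ≃ₗᵢ[ℂ] K) (x : K) : conj W (of x) = of (W x) := rfl

end ConjSpace

section Tensor

variable {H : Type u} [NormedAddCommGroup H] [InnerProductSpace ℂ H]
  {K : Type v} [NormedAddCommGroup K] [InnerProductSpace ℂ K]

/-- The slice map `H ⊗ K → H`, `h ⊗ k ↦ ⟪y, k⟫ h`. -/
noncomputable def tensorSlice (H : Type u) [NormedAddCommGroup H] [InnerProductSpace ℂ H]
    (y : K) : H ⊗[ℂ] K →L[ℂ] H :=
  (TensorProduct.ridIsometry ℂ H).toContinuousLinearEquiv.toContinuousLinearMap ∘L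
    TensorProduct.mapL (.id ℂ H) (innerSL ℂ y)

theorem tensorSlice_tmul (y : K) (h : H) (k : K) :
    tensorSlice H y (h ⊗ₜ[ℂ] k) = inner ℂ y k • h := by
  simp [tensorSlice]

theorem sum_tensorSlice {ι : Type*} [Fintype ι] (b : OrthonormalBasis ι ℂ K)
    (x : H ⊗[ℂ] K) : ∑ i, tensorSlice H (b i) x ⊗ₜ[ℂ] b i = x := by
  induction x using TensorProduct.induction_on with
  | zero => simp
  | tmul h k =>
    simp only [tensorSlice_tmul, TensorProduct.smul_tmul, ← TensorProduct.tmul_sum, b.sum_repr']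
  | add x y hx hy => simp only [map_add, TensorProduct.add_tmul, Finset.sum_add_distrib, hx, hy]

/-- The Hilbert space tensor product with a finite-dimensional space is the algebraic one. -/
instance tensor_complete [CompleteSpace H] [FiniteDimensional ℂ K] :
    CompleteSpace (H ⊗[ℂ] K) := by
  let b := stdOrthonormalBasis ℂ K
  let e : (H ⊗[ℂ] K) ≃L[ℂ] (Fin (Module.finrank ℂ K) → H) :=
    { toFun := fun x i => tensorSlice H (b i) x
      invFun := fun f => ∑ i, f i ⊗ₜ[ℂ] b i
      map_add' := fun x y => by ext; simp
      map_smul' := fun c x => by ext; simp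
      left_inv := fun x => sum_tensorSlice b x
      right_inv := fun f => by
        ext j
        simp [tensorSlice_tmul, b.inner_eq_ite]
      continuous_toFun := by fun_prop
      continuous_invFun := by fun_prop }
  exact (completeSpace_congr (e := e.toLinearEquiv.toEquiv) e.isUniformEmbedding).mpr inferInstance

end Tensor

/-! ### Covariant representations -/

theorem unitary_mul_apply {E : Type*} [NormedAddCommGroup E] [NormedSpace ℂ E]
    (T R : E ≃ₗᵢ[ℂ] E) (x : E) : (T * R) x = T (R x) := rfl

/-- A covariant representation `(π, U)` of the system `(A, S, σ)` on a Hilbert space `H`: `π` is a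
nondegenerate representation of `A`, `U` a unitary representation of `S`, and
`U(s) π(a) U(s)⋆ = π(σ_s a)`. -/
structure CovariantRep {S : Type v} [Group S] {A : Type u} [NonUnitalCStarAlgebra A]
    (σ : S →* (A ≃⋆ₐ[ℂ] A)) (H : Type w) [NormedAddCommGroup H] [InnerProductSpace ℂ H]
    [CompleteSpace H] : Type (max u v w) where
  π : A →⋆ₙₐ[ℂ] (H →L[ℂ] H)
  nondeg : IsNondegenerate π
  U : S →* (H ≃ₗᵢ[ℂ] H)
  covariant : ∀ s a x, U s (π a x) = π (σ s a) (U s x)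

namespace CovariantRep

section Integrated

variable {G : Type v} [Group G] [Fintype G] {A : Type u} [NonUnitalCStarAlgebra A]
  {σ : G →* (A ≃⋆ₐ[ℂ] A)}
  {H : Type w} [NormedAddCommGroup H] [InnerProductSpace ℂ H] [CompleteSpace H]

theorem sum_apply' {ι E F : Type*} [NormedAddCommGroup E] [NormedSpace ℂ E]
    [NormedAddCommGroup F] [NormedSpace ℂ F] (s : Finset ι) (f : ι → (E →L[ℂ] F)) (x : E) :
    (∑ i ∈ s, f i) x = ∑ i ∈ s, f i x := by
  simp

/-- The integrated form `f ↦ ∑ s, π(f(s)) U(s)` of a covariant representation: the corresponding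
nondegenerate representation of the crossed product. -/
noncomputable def integrated (ρ : CovariantRep σ H) :
    CrossedProduct σ →⋆ₙₐ[ℂ] (H →L[ℂ] H) where
  toFun f := ∑ s : G, ρ.π (f s) ∘L (ρ.U s).toContinuousLinearEquiv.toContinuousLinearMap
  map_smul' c f := by
    simp [CrossedProduct.smul_apply, Finset.smul_sum]
  map_zero' := by simp [CrossedProduct.zero_apply]
  map_add' f g := by
    simp [CrossedProduct.add_apply, Finset.sum_add_distrib, ContinuousLinearMap.add_comp]
  map_mul' f g := by
    ext x
    have h1 : ∀ s : G, ρ.π ((f * g) s) (ρ.U s x) =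
        ∑ t : G, ρ.π (f t) (ρ.U t (ρ.π (g (t⁻¹ * s)) (ρ.U (t⁻¹ * s) x))) := fun s => by
      rw [CrossedProduct.mul_apply, map_sum, sum_apply']
      refine Finset.sum_congr rfl fun t _ => ?_
      rw [ρ.covariant, ← unitary_mul_apply, ← map_mul, mul_inv_cancel_left, map_mul,
        mul_apply_eq_comp]
    change (∑ s : G, ρ.π ((f * g) s) ∘L
        (ρ.U s).toContinuousLinearEquiv.toContinuousLinearMap) x =
      (∑ t : G, ρ.π (f t) ∘L (ρ.U t).toContinuousLinearEquiv.toContinuousLinearMap)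
        ((∑ r : G, ρ.π (g r) ∘L (ρ.U r).toContinuousLinearEquiv.toContinuousLinearMap) x)
    rw [sum_apply', sum_apply', sum_apply']
    refine (Finset.sum_congr rfl fun s _ => h1 s).trans ?_
    rw [Finset.sum_comm]
    refine Finset.sum_congr rfl fun t _ => ?_
    simp only [map_sum]
    exact Fintype.sum_equiv (Equiv.mulLeft t⁻¹) _ _ fun s => rfl
  map_star' f := by
    rw [ContinuousLinearMap.star_eq_adjoint, ContinuousLinearMap.eq_adjoint_iff]
    intro x y
    rw [sum_apply', sum_apply', sum_inner, inner_sum]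
    refine Fintype.sum_equiv (Equiv.inv G) _ _ fun s => ?_
    change inner ℂ (ρ.π (σ s (star (f s⁻¹))) (ρ.U s x)) y =
      inner ℂ x (ρ.π (f s⁻¹) (ρ.U s⁻¹ y))
    rw [← ρ.covariant, map_star, ContinuousLinearMap.star_eq_adjoint,
      ← ContinuousLinearMap.adjoint_inner_left, map_inv]
    exact (ρ.U s).inner_map_eq_flip _ _

theorem integrated_apply (ρ : CovariantRep σ H) (f : CrossedProduct σ) (x : H) :
    ρ.integrated f x = ∑ s : G, ρ.π (f s) (ρ.U s x) := by
  simp [integrated]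

theorem integrated_nondeg (ρ : CovariantRep σ H) : IsNondegenerate ρ.integrated := by
  classical
  rw [isNondegenerate_iff]
  intro x hx
  refine (isNondegenerate_iff ρ.π).mp ρ.nondeg x fun a => ?_
  let f : CrossedProduct σ := (Pi.single (1 : G) a : G → A)
  have hf : ∀ s, f s = (Pi.single (1 : G) a : G → A) s := fun _ => rfl
  have h := hx f
  rw [integrated_apply, Finset.sum_eq_single 1] at h
  · rw [hf] at h
    simpa using h
  · intro s _ hs
    rw [hf, Pi.single_eq_of_ne hs]
    simp
  · simp

end Integrated

section Induced

variable {G : Type v} [Group G] [Fintype G] {A : Type u} [NonUnitalCStarAlgebra A]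
  {σ : G →* (A ≃⋆ₐ[ℂ] A)} {S : Subgroup G}
  {H : Type w} [NormedAddCommGroup H] [InnerProductSpace ℂ H] [CompleteSpace H]

/-- The space of the induced representation: all `ξ : G → H` with `ξ(ts) = U(t) ξ(s)` for `t ∈ S`,
with the inner product `∑ s, ⟪ξ(s), η(s)⟫`. -/
def indSpace (ρ : CovariantRep (σ.comp S.subtype) H) :
    Submodule ℂ (PiLp 2 fun _ : G => H) where
  carrier := {ξ | ∀ (t : S) (s : G), ξ ((t : G) * s) = ρ.U t (ξ s)}
  add_mem' hξ hη t s := by simp [hξ t s, hη t s]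
  zero_mem' t s := by simp
  smul_mem' c ξ hξ t s := by simp [hξ t s]

variable (ρ : CovariantRep (σ.comp S.subtype) H)

theorem isClosed_indSpace : IsClosed (ρ.indSpace : Set (PiLp 2 fun _ : G => H)) := by
  change IsClosed {ξ : PiLp 2 fun _ : G => H |
    ∀ (t : S) (s : G), ξ ((t : G) * s) = ρ.U t (ξ s)}
  simp only [Set.ofPred_forall]
  refine isClosed_iInter fun t => isClosed_iInter fun s => isClosed_eq (by fun_prop) ?_
  exact (ρ.U t).continuous.comp (by fun_prop)

instance : CompleteSpace ρ.indSpace := ρ.isClosed_indSpace.completeSpace_coe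

/-- `(Ū(t) ξ)(s) = ξ(st)`. -/
noncomputable def indU : G →* (ρ.indSpace ≃ₗᵢ[ℂ] ρ.indSpace) :=
  MonoidHom.mk' (fun t =>
    { toFun := fun ξ => ⟨WithLp.toLp 2 fun s => ξ.1 (s * t), fun r s => by
        simpa [mul_assoc] using ξ.2 r (s * t)⟩
      invFun := fun ξ => ⟨WithLp.toLp 2 fun s => ξ.1 (s * t⁻¹), fun r s => by
        simpa [mul_assoc] using ξ.2 r (s * t⁻¹)⟩
      left_inv := fun ξ => by ext s; simp
      right_inv := fun ξ => by ext s; simp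
      map_add' := fun ξ η => rfl
      map_smul' := fun c ξ => rfl
      norm_map' := fun ξ => by
        change ‖WithLp.toLp 2 fun s => ξ.1 (s * t)‖ = ‖ξ.1‖
        rw [PiLp.norm_eq_of_L2, PiLp.norm_eq_of_L2]
        congr 1
        exact Fintype.sum_equiv (Equiv.mulRight t) _ _ fun s => rfl })
    fun t r => by
      ext ξ s
      change ξ.1 (s * (t * r)) = ξ.1 (s * t * r)
      rw [mul_assoc]

theorem indU_apply (t : G) (ξ : ρ.indSpace) (s : G) : (ρ.indU t ξ).1 s = ξ.1 (s * t) := rfl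

/-- `(π̄(a) ξ)(s) = π(σ_s a) ξ(s)`. -/
noncomputable def indOp (a : A) : ρ.indSpace →L[ℂ] ρ.indSpace where
  toFun ξ := ⟨WithLp.toLp 2 fun s => ρ.π (σ s a) (ξ.1 s), fun t s => by
    have h := ρ.covariant t (σ s a) (ξ.1 s)
    rw [← ξ.2 t s] at h
    simpa [CrossedProduct.aut_mul] using h.symm⟩
  map_add' ξ η := by ext s; simp
  map_smul' c ξ := by ext s; simp
  cont := by
    refine Continuous.subtype_mk ?_ _
    refine (PiLp.continuous_toLp 2 _).comp (continuous_pi fun s => ?_)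
    exact (ρ.π (σ s a)).continuous.comp (by fun_prop)

theorem indOp_apply (a : A) (ξ : ρ.indSpace) (s : G) :
    (ρ.indOp a ξ).1 s = ρ.π (σ s a) (ξ.1 s) := rfl

theorem ind_op_ext {P Q : ρ.indSpace →L[ℂ] ρ.indSpace}
    (h : ∀ (ξ : ρ.indSpace) (s : G), (P ξ).1 s = (Q ξ).1 s) : P = Q :=
  ContinuousLinearMap.ext fun ξ => Subtype.ext (PiLp.ext fun s => h ξ s)

theorem indOp_smul (c : ℂ) (a : A) : ρ.indOp (c • a) = c • ρ.indOp a := by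
  refine ρ.ind_op_ext fun ξ s => ?_
  change ρ.π (σ s (c • a)) (ξ.1 s) = c • ρ.π (σ s a) (ξ.1 s)
  rw [map_smul, map_smul]
  rfl

theorem indOp_zero : ρ.indOp 0 = 0 := by
  refine ρ.ind_op_ext fun ξ s => ?_
  change ρ.π (σ s 0) (ξ.1 s) = 0
  rw [map_zero, map_zero]
  rfl

theorem indOp_add (a b : A) : ρ.indOp (a + b) = ρ.indOp a + ρ.indOp b := by
  refine ρ.ind_op_ext fun ξ s => ?_
  change ρ.π (σ s (a + b)) (ξ.1 s) = ρ.π (σ s a) (ξ.1 s) + ρ.π (σ s b) (ξ.1 s)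
  rw [map_add, map_add]
  rfl

theorem indOp_mul (a b : A) : ρ.indOp (a * b) = ρ.indOp a * ρ.indOp b := by
  refine ρ.ind_op_ext fun ξ s => ?_
  change ρ.π (σ s (a * b)) (ξ.1 s) = ρ.π (σ s a) (ρ.π (σ s b) (ξ.1 s))
  rw [map_mul, map_mul]
  rfl

theorem inner_indOp (a : A) (ξ η : ρ.indSpace) :
    inner ℂ (ρ.indOp (star a) ξ) η = inner ℂ ξ (ρ.indOp a η) := by
  have h : ∀ s : G, inner ℂ (ρ.π (σ s (star a)) (ξ.1 s)) (η.1 s) =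
      inner ℂ (ξ.1 s) (ρ.π (σ s a) (η.1 s)) := fun s => by
    rw [map_star, map_star, ContinuousLinearMap.star_eq_adjoint,
      ContinuousLinearMap.adjoint_inner_left]
  exact Finset.sum_congr rfl fun s _ => h s

theorem indOp_star (a : A) : ρ.indOp (star a) = star (ρ.indOp a) := by
  rw [ContinuousLinearMap.star_eq_adjoint, ContinuousLinearMap.eq_adjoint_iff]
  exact ρ.inner_indOp a

/-- The representation `π̄` of the induced covariant representation. -/
noncomputable def indπ : A →⋆ₙₐ[ℂ] (ρ.indSpace →L[ℂ] ρ.indSpace) where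
  toFun := ρ.indOp
  map_smul' := ρ.indOp_smul
  map_zero' := ρ.indOp_zero
  map_add' := ρ.indOp_add
  map_mul' := ρ.indOp_mul
  map_star' := ρ.indOp_star

theorem indπ_nondeg : IsNondegenerate ρ.indπ := by
  rw [isNondegenerate_iff]
  intro ξ hξ
  refine Subtype.ext (PiLp.ext fun s => ?_)
  refine (isNondegenerate_iff ρ.π).mp ρ.nondeg (ξ.1 s) fun a => ?_
  have h : (ρ.indOp (σ s⁻¹ a) ξ).1 s = 0 :=
    congrArg (fun η : ρ.indSpace => η.1 s) (hξ (σ s⁻¹ a))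
  rw [indOp_apply, CrossedProduct.aut_cancel_inv] at h
  exact h

theorem indU_indOp (t : G) (a : A) (ξ : ρ.indSpace) :
    ρ.indU t (ρ.indOp a ξ) = ρ.indOp (σ t a) (ρ.indU t ξ) := by
  refine Subtype.ext (PiLp.ext fun s => ?_)
  rw [indU_apply, indOp_apply, indOp_apply, indU_apply, CrossedProduct.aut_mul]

/-- The induced representation on the subspace `indSpace`. -/
noncomputable def indAux : CovariantRep σ ρ.indSpace where
  π := ρ.indπ
  nondeg := ρ.indπ_nondeg
  U := ρ.indU
  covariant := ρ.indU_indOp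

/-- The space `indSpace` as a Hilbert space in its own right. -/
def IndSpace : Type (max v w) := ρ.indSpace

noncomputable instance : NormedAddCommGroup ρ.IndSpace :=
  inferInstanceAs (NormedAddCommGroup ρ.indSpace)

noncomputable instance : InnerProductSpace ℂ ρ.IndSpace :=
  inferInstanceAs (InnerProductSpace ℂ ρ.indSpace)

instance : CompleteSpace ρ.IndSpace := inferInstanceAs (CompleteSpace ρ.indSpace)

/-- The covariant representation `(π̄, Ū)` of `(A, G, σ)` induced by a covariant representation of
`(A, S, σ)`, for a subgroup `S` of `G`. -/
noncomputable def ind : CovariantRep σ ρ.IndSpace :=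
  ρ.indAux

end Induced

end CovariantRep

/-! ### Projective representations and the space of pairs -/

section Projective

variable {S : Type v} [Group S] {H : Type w} [NormedAddCommGroup H] [InnerProductSpace ℂ H]

/-- `V` is a projective representation of `S` with multiplier `ω` (an `ω`-representation):
`V_s V_t = ω(s,t) V_{st}`. -/
def HasMultiplier (V : S → (H ≃ₗᵢ[ℂ] H)) (ω : S → S → Circle) : Prop :=
  ∀ s t x, V s (V t x) = (ω s t : ℂ) • V (s * t) x

/-- Irreducibility of a projective representation: the space is nonzero and there are only the
trivial closed invariant subspaces. -/
structure IsIrreducibleProj (W : S → (H ≃ₗᵢ[ℂ] H)) : Prop where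
  nontrivial : Nontrivial H
  eq_bot_or_top : ∀ L : Submodule ℂ H, IsClosed (L : Set H) →
    (∀ s, ∀ x ∈ L, W s x ∈ L) → L = ⊥ ∨ L = ⊤

theorem IsIrreducibleProj.comp {S' : Type*} {W : S → (H ≃ₗᵢ[ℂ] H)} (h : IsIrreducibleProj W)
    {f : S' → S} (hf : Function.Surjective f) :
    IsIrreducibleProj fun s => W (f s) where
  nontrivial := h.nontrivial
  eq_bot_or_top L hc hL := h.eq_bot_or_top L hc fun t x hx => by
    obtain ⟨t, rfl⟩ := hf t
    exact hL t x hx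

end Projective

section Gamma

variable {G : Type v} [Group G] {A : Type u} [NonUnitalCStarAlgebra A]
  {H : Type w} [NormedAddCommGroup H] [InnerProductSpace ℂ H] [CompleteSpace H]
  {K : Type w} [NormedAddCommGroup K] [InnerProductSpace ℂ K] [FiniteDimensional ℂ K]
  {H₁ : Type w} [NormedAddCommGroup H₁] [InnerProductSpace ℂ H₁] [CompleteSpace H₁]
  {K₁ : Type w} [NormedAddCommGroup K₁] [InnerProductSpace ℂ K₁] [FiniteDimensional ℂ K₁]
  {H₂ : Type w} [NormedAddCommGroup H₂] [InnerProductSpace ℂ H₂] [CompleteSpace H₂]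
  {K₂ : Type w} [NormedAddCommGroup K₂] [InnerProductSpace ℂ K₂] [FiniteDimensional ℂ K₂]

/-- The stability group `G_π = {s | [π] = [π ∘ σ_s]}`. -/
def stabGroup (σ : G →* (A ≃⋆ₐ[ℂ] A)) (π : A →⋆ₙₐ[ℂ] (H →L[ℂ] H)) : Subgroup G where
  carrier := {s | UnitarilyEquivalent π (compAut π (σ s))}
  mul_mem' := by
    rintro s t ⟨T, hT⟩ ⟨R, hR⟩
    refine ⟨R.trans T, fun a x => ?_⟩
    rw [LinearIsometryEquiv.trans_apply, hR, compAut_apply, hT, compAut_apply, compAut_apply,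
      CrossedProduct.aut_mul, LinearIsometryEquiv.trans_apply]
  one_mem' := ⟨.refl ℂ _, fun a x => by
    rw [compAut_apply, CrossedProduct.aut_one]
    rfl⟩
  inv_mem' := by
    rintro s ⟨T, hT⟩
    refine ⟨T.symm, fun a x => ?_⟩
    have h := hT (σ s⁻¹ a) (T.symm x)
    rw [compAut_apply, CrossedProduct.aut_cancel_inv, LinearIsometryEquiv.apply_symm_apply] at h
    rw [compAut_apply, ← h, LinearIsometryEquiv.symm_apply_apply]

theorem mem_stabGroup_iff (σ : G →* (A ≃⋆ₐ[ℂ] A)) (π : A →⋆ₙₐ[ℂ] (H →L[ℂ] H)) (s : G) :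
    s ∈ stabGroup σ π ↔ ∃ T : H ≃ₗᵢ[ℂ] H, ∀ a x, T (π a x) = π (σ s a) (T x) := Iff.rfl

theorem mem_stabGroup_congr (σ : G →* (A ≃⋆ₐ[ℂ] A)) {π₁ : A →⋆ₙₐ[ℂ] (H₁ →L[ℂ] H₁)}
    {π₂ : A →⋆ₙₐ[ℂ] (H₂ →L[ℂ] H₂)} {T : H₁ ≃ₗᵢ[ℂ] H₂} (hT : Intertwines π₁ π₂ T) {s : G}
    (hs : s ∈ stabGroup σ π₁) : s ∈ stabGroup σ π₂ := by
  rw [mem_stabGroup_iff] at hs ⊢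
  obtain ⟨R, hR⟩ := hs
  refine ⟨(T.symm.trans R).trans T, fun a x => ?_⟩
  simp only [LinearIsometryEquiv.trans_apply]
  rw [hT.symm, hR, hT]

theorem conj_mem_stabGroup (σ : G →* (A ≃⋆ₐ[ℂ] A)) {π : A →⋆ₙₐ[ℂ] (H →L[ℂ] H)} {s t : G}
    (h : t ∈ stabGroup σ (compAut π (σ s))) : s * t * s⁻¹ ∈ stabGroup σ π := by
  rw [mem_stabGroup_iff] at h ⊢
  obtain ⟨T, hT⟩ := h
  refine ⟨T, fun a x => ?_⟩
  have h := hT (σ s⁻¹ a) x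
  rw [compAut_apply, compAut_apply, CrossedProduct.aut_cancel_inv] at h
  rw [h, CrossedProduct.aut_mul, CrossedProduct.aut_mul]

/-- The isomorphism `t ↦ s t s⁻¹` from `G_{π ∘ σ_s} = s⁻¹ G_π s` to `G_π`. -/
def stabConj (σ : G →* (A ≃⋆ₐ[ℂ] A)) (π : A →⋆ₙₐ[ℂ] (H →L[ℂ] H)) (s : G)
    (t : stabGroup σ (compAut π (σ s))) : stabGroup σ π :=
  ⟨s * t * s⁻¹, conj_mem_stabGroup σ t.2⟩

theorem stabConj_mul (σ : G →* (A ≃⋆ₐ[ℂ] A)) (π : A →⋆ₙₐ[ℂ] (H →L[ℂ] H)) (s : G)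
    (t r : stabGroup σ (compAut π (σ s))) :
    stabConj σ π s (t * r) = stabConj σ π s t * stabConj σ π s r := by
  apply Subtype.ext
  simp [stabConj, mul_assoc]

theorem stabConj_surjective (σ : G →* (A ≃⋆ₐ[ℂ] A)) (π : A →⋆ₙₐ[ℂ] (H →L[ℂ] H)) (s : G) :
    Function.Surjective (stabConj σ π s) := by
  rintro ⟨t, ht⟩
  refine ⟨⟨s⁻¹ * t * s, ?_⟩, ?_⟩
  · rw [mem_stabGroup_iff] at ht ⊢
    obtain ⟨T, hT⟩ := ht
    refine ⟨T, fun a x => ?_⟩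
    rw [compAut_apply, compAut_apply, hT, ← CrossedProduct.aut_mul, ← CrossedProduct.aut_mul]
    simp [mul_assoc]
  · apply Subtype.ext
    simp [stabConj, mul_assoc]

/-- The unitaries `V_s`, `s ∈ G_π`, satisfy `V_s π(a) V_s⋆ = π(σ_s a)`. -/
def Implements (σ : G →* (A ≃⋆ₐ[ℂ] A)) (π : A →⋆ₙₐ[ℂ] (H →L[ℂ] H))
    (V : stabGroup σ π → (H ≃ₗᵢ[ℂ] H)) : Prop :=
  ∀ s a x, V s (π a x) = π (σ (s : G) a) (V s x)

/-- A pair `(π, W)` on given Hilbert spaces, together with the data it is formed with: `π` is an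
irreducible representation of `A`, `V` a projective representation of `G_π` implementing the action
on `π`, `ω` its multiplier, and `W` an irreducible `ω`-representation of `G_π` (irreducible
projective representations of a finite group are finite-dimensional). -/
structure GammaData (σ : G →* (A ≃⋆ₐ[ℂ] A)) (H : Type w) [NormedAddCommGroup H]
    [InnerProductSpace ℂ H] [CompleteSpace H] (K : Type w) [NormedAddCommGroup K]
    [InnerProductSpace ℂ K] : Type (max u v w) where
  π : A →⋆ₙₐ[ℂ] (H →L[ℂ] H)
  irred : IsIrreducibleRep π
  V : stabGroup σ π → (H ≃ₗᵢ[ℂ] H)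
  implements : Implements σ π V
  ω : stabGroup σ π → stabGroup σ π → Circle
  multV : HasMultiplier V ω
  W : stabGroup σ π → (K ≃ₗᵢ[ℂ] K)
  multW : HasMultiplier W ω
  irredW : IsIrreducibleProj W

namespace GammaData

variable {σ : G →* (A ≃⋆ₐ[ℂ] A)}

/-- `(π₁, V₁, W₁)` and `(π₂, V₂, W₂)` are equivalent if there are unitaries `T`, `R` and scalars
`c(s)` of modulus one with `T π₁ T⋆ = π₂`, `T V₁(s) T⋆ = c(s) V₂(s)` and `R W₁(s) R⋆ = c(s) W₂(s)`.
(If `V₂` is the transport of `V₁` by `T`, then `c = 1` and this says that `π₁` and `π₂`, and `W₁`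
and `W₂`, are unitarily equivalent; the scalars account for the freedom in the choice of `V`.) -/
def Equivalent (x : GammaData σ H₁ K₁) (y : GammaData σ H₂ K₂) : Prop :=
  ∃ (T : H₁ ≃ₗᵢ[ℂ] H₂) (R : K₁ ≃ₗᵢ[ℂ] K₂) (c : G → Circle),
    Intertwines x.π y.π T ∧
    (∀ s (h₁ : s ∈ stabGroup σ x.π) (h₂ : s ∈ stabGroup σ y.π) ξ,
      T (x.V ⟨s, h₁⟩ ξ) = (c s : ℂ) • y.V ⟨s, h₂⟩ (T ξ)) ∧
    (∀ s (h₁ : s ∈ stabGroup σ x.π) (h₂ : s ∈ stabGroup σ y.π) η,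
      R (x.W ⟨s, h₁⟩ η) = (c s : ℂ) • y.W ⟨s, h₂⟩ (R η))

theorem Equivalent.refl (x : GammaData σ H K) : x.Equivalent x :=
  ⟨.refl ℂ _, .refl ℂ _, fun _ => 1, fun _ _ => rfl, fun s _ _ ξ => by simp,
    fun s _ _ ξ => by simp⟩

theorem Equivalent.symm {x : GammaData σ H₁ K₁} {y : GammaData σ H₂ K₂} (h : x.Equivalent y) :
    y.Equivalent x := by
  obtain ⟨T, R, c, hT, hV, hW⟩ := h
  refine ⟨T.symm, R.symm, fun s => (c s)⁻¹, hT.symm, fun s h₁ h₂ ξ => ?_, fun s h₁ h₂ ξ => ?_⟩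
  · rw [LinearIsometryEquiv.symm_apply_eq, map_smul, hV s h₂ h₁,
      LinearIsometryEquiv.apply_symm_apply, smul_smul, ← Circle.coe_mul]
    simp
  · rw [LinearIsometryEquiv.symm_apply_eq, map_smul, hW s h₂ h₁,
      LinearIsometryEquiv.apply_symm_apply, smul_smul, ← Circle.coe_mul]
    simp

theorem Equivalent.trans {x : GammaData σ H K} {y : GammaData σ H₁ K₁} {z : GammaData σ H₂ K₂}
    (h : x.Equivalent y) (h' : y.Equivalent z) : x.Equivalent z := by
  obtain ⟨T, R, c, hT, hV, hW⟩ := h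
  obtain ⟨T', R', c', hT', hV', hW'⟩ := h'
  refine ⟨T.trans T', R.trans R', fun s => c s * c' s, hT.trans hT',
    fun s h₁ h₂ ξ => ?_, fun s h₁ h₂ ξ => ?_⟩
  · have h := mem_stabGroup_congr σ hT h₁
    rw [LinearIsometryEquiv.trans_apply, hV s h₁ h, map_smul, hV' s h h₂, smul_smul,
      ← Circle.coe_mul, LinearIsometryEquiv.trans_apply]
  · have h := mem_stabGroup_congr σ hT h₁
    rw [LinearIsometryEquiv.trans_apply, hW s h₁ h, map_smul, hW' s h h₂, smul_smul,
      ← Circle.coe_mul, LinearIsometryEquiv.trans_apply]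

/-- `(π, V, W) ↦ (π ∘ σ_s, s·V, s·W)`, where `(s·V)(s⁻¹ts) = V(t)` and `(s·W)(s⁻¹ts) = W(t)`. -/
noncomputable def act (x : GammaData σ H K) (s : G) : GammaData σ H K where
  π := compAut x.π (σ s)
  irred := x.irred.compAut (σ s)
  V t := x.V (stabConj σ x.π s t)
  implements t a ξ := by
    have h : σ ((stabConj σ x.π s t : stabGroup σ x.π) : G) (σ s a) = σ s (σ t a) := by
      rw [← CrossedProduct.aut_mul, ← CrossedProduct.aut_mul]
      simp [stabConj]
    rw [compAut_apply, compAut_apply, x.implements, h]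
  ω t r := x.ω (stabConj σ x.π s t) (stabConj σ x.π s r)
  multV t r ξ := by
    beta_reduce
    rw [stabConj_mul]
    exact x.multV _ _ _
  W t := x.W (stabConj σ x.π s t)
  multW t r ξ := by
    beta_reduce
    rw [stabConj_mul]
    exact x.multW _ _ _
  irredW := x.irredW.comp (stabConj_surjective σ x.π s)

theorem Equivalent.act {x : GammaData σ H₁ K₁} {y : GammaData σ H₂ K₂} (h : x.Equivalent y)
    (s : G) : (x.act s).Equivalent (y.act s) := by
  obtain ⟨T, R, c, hT, hV, hW⟩ := h
  exact ⟨T, R, fun t => c (s * t * s⁻¹), fun a ξ => hT (σ s a) ξ,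
    fun _ _ _ ξ => hV _ _ _ ξ, fun _ _ _ η => hW _ _ _ η⟩

/-- Rewriting a group element does not change the operators. -/
theorem apply_congr (x : GammaData σ H K) {t r : G} (h : t = r) (ht : t ∈ stabGroup σ x.π)
    (hr : r ∈ stabGroup σ x.π) :
    (∀ ξ, x.V ⟨t, ht⟩ ξ = ((1 : Circle) : ℂ) • x.V ⟨r, hr⟩ ξ) ∧
      ∀ η, x.W ⟨t, ht⟩ η = ((1 : Circle) : ℂ) • x.W ⟨r, hr⟩ η := by
  subst h
  simp

theorem act_one (x : GammaData σ H K) : (x.act 1).Equivalent x :=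
  ⟨.refl ℂ H, .refl ℂ K, fun _ => 1,
    fun a ξ => congrArg (fun b => x.π b ξ) (CrossedProduct.aut_one σ a),
    fun _ h₁ h₂ ξ => (x.apply_congr (by simp) (conj_mem_stabGroup σ h₁) h₂).1 ξ,
    fun _ h₁ h₂ η => (x.apply_congr (by simp) (conj_mem_stabGroup σ h₁) h₂).2 η⟩

theorem act_mul (x : GammaData σ H K) (s r : G) :
    (x.act (s * r)).Equivalent ((x.act s).act r) :=
  ⟨.refl ℂ H, .refl ℂ K, fun _ => 1,
    fun a ξ => congrArg (fun b => x.π b ξ) (CrossedProduct.aut_mul σ s r a),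
    fun _ h₁ h₂ ξ => (x.apply_congr (by simp [mul_assoc]) (conj_mem_stabGroup σ h₁)
      (conj_mem_stabGroup σ (conj_mem_stabGroup σ h₂))).1 ξ,
    fun _ h₁ h₂ η => (x.apply_congr (by simp [mul_assoc]) (conj_mem_stabGroup σ h₁)
      (conj_mem_stabGroup σ (conj_mem_stabGroup σ h₂))).2 η⟩

section Induction

variable (x : GammaData σ H K)

/-- The representation `π ⊗ 1` of `A` on `H ⊗ K̄`. -/
noncomputable def ampl : A →⋆ₙₐ[ℂ] (H ⊗[ℂ] ConjSpace K →L[ℂ] H ⊗[ℂ] ConjSpace K) where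
  toFun a := TensorProduct.mapL (x.π a) (.id ℂ (ConjSpace K))
  map_smul' c a := by
    rw [map_smul, TensorProduct.mapL_smul_left]
    rfl
  map_zero' := by rw [map_zero, TensorProduct.mapL_zero_left]
  map_add' a b := by rw [map_add, TensorProduct.mapL_add_left]
  map_mul' a b := by
    rw [map_mul, ← TensorProduct.mapL_mul]
    rfl
  map_star' a := by
    rw [map_star, ContinuousLinearMap.star_eq_adjoint, ContinuousLinearMap.star_eq_adjoint,
      TensorProduct.adjoint_mapL, ContinuousLinearMap.adjoint_id]

theorem ampl_tmul (a : A) (h : H) (k : ConjSpace K) :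
    x.ampl a (h ⊗ₜ[ℂ] k) = x.π a h ⊗ₜ[ℂ] k := rfl

theorem tensorSlice_ampl (a : A) (k : ConjSpace K) (ξ : H ⊗[ℂ] ConjSpace K) :
    tensorSlice H k (x.ampl a ξ) = x.π a (tensorSlice H k ξ) := by
  induction ξ using TensorProduct.induction_on with
  | zero => simp only [map_zero]
  | tmul h k => rw [ampl_tmul, tensorSlice_tmul, tensorSlice_tmul, map_smul]
  | add y z hy hz => simp only [map_add, hy, hz]

theorem ampl_nondeg : IsNondegenerate x.ampl := by
  rw [isNondegenerate_iff]
  intro ξ hξ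
  rw [← sum_tensorSlice (stdOrthonormalBasis ℂ (ConjSpace K)) ξ]
  refine Finset.sum_eq_zero fun i _ => ?_
  rw [(isNondegenerate_iff x.π).mp x.irred.nondeg
    (tensorSlice H (stdOrthonormalBasis ℂ (ConjSpace K) i) ξ) fun a => by
      rw [← tensorSlice_ampl, hξ, map_zero], TensorProduct.zero_tmul]

/-- The unitary representation `V ⊗ W̄` of `G_π` on `H ⊗ K̄`. -/
noncomputable def tensorU :
    stabGroup σ x.π →* (H ⊗[ℂ] ConjSpace K ≃ₗᵢ[ℂ] H ⊗[ℂ] ConjSpace K) :=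
  MonoidHom.mk' (fun s => TensorProduct.congrIsometry (x.V s) (ConjSpace.conj (x.W s)))
    fun s t => by
      refine LinearIsometryEquiv.ext fun ξ => ?_
      rw [unitary_mul_apply]
      induction ξ using TensorProduct.induction_on with
      | zero => simp only [map_zero]
      | add y z hy hz => simp only [map_add, hy, hz]
      | tmul h k =>
        have hV := x.multV s t h
        have hW : ConjSpace.conj (x.W s) (ConjSpace.conj (x.W t) k) =
            star (x.ω s t : ℂ) • ConjSpace.conj (x.W (s * t)) k :=
          congrArg ConjSpace.of (x.multW s t k) |>.trans (ConjSpace.of_smul _ _)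
        have hc : (x.ω s t : ℂ) * star (x.ω s t : ℂ) = 1 := by
          rw [Complex.star_def, Complex.mul_conj, Circle.normSq_coe, Complex.ofReal_one]
        change x.V (s * t) h ⊗ₜ[ℂ] ConjSpace.conj (x.W (s * t)) k =
          x.V s (x.V t h) ⊗ₜ[ℂ] ConjSpace.conj (x.W s) (ConjSpace.conj (x.W t) k)
        rw [hV, hW, TensorProduct.smul_tmul, smul_smul, hc, one_smul]

theorem tensorU_tmul (s : stabGroup σ x.π) (h : H) (k : ConjSpace K) :
    x.tensorU s (h ⊗ₜ[ℂ] k) = x.V s h ⊗ₜ[ℂ] ConjSpace.conj (x.W s) k := rfl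

/-- The covariant representation `(π ⊗ 1, V ⊗ W̄)` of `(A, G_π, σ)`. -/
noncomputable def toCovariantRep :
    CovariantRep (σ.comp (stabGroup σ x.π).subtype) (H ⊗[ℂ] ConjSpace K) where
  π := x.ampl
  nondeg := x.ampl_nondeg
  U := x.tensorU
  covariant s a ξ := by
    induction ξ using TensorProduct.induction_on with
    | zero => simp only [map_zero]
    | add y z hy hz => simp only [map_add, hy, hz]
    | tmul h k =>
      rw [ampl_tmul, tensorU_tmul, tensorU_tmul, ampl_tmul, x.implements]
      rfl

/-- The covariant representation `Ind(π ⊗ 1, V ⊗ W̄)` of `(A, G, σ)`, as a representation of the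
crossed product. -/
noncomputable def indRep [Fintype G] :
    CrossedProduct σ →⋆ₙₐ[ℂ] (x.toCovariantRep.IndSpace →L[ℂ] x.toCovariantRep.IndSpace) :=
  x.toCovariantRep.ind.integrated

end Induction

end GammaData

/-- The set `Γ` of all pairs `(π, W)` (with the data in `GammaData`), on Hilbert spaces in
universe `w`. -/
structure GammaSet (σ : G →* (A ≃⋆ₐ[ℂ] A)) : Type (max u v (w + 1)) where
  H : HilbSpace.{w}
  K : FinHilbSpace.{w}
  data : GammaData σ H K

instance GammaSet.setoid (σ : G →* (A ≃⋆ₐ[ℂ] A)) : Setoid (GammaSet.{u, v, w} σ) where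
  r x y := x.data.Equivalent y.data
  iseqv :=
    { refl := fun x => .refl x.data
      symm := fun h => h.symm
      trans := fun h h' => h.trans h' }

/-- The set `Γ̃` of equivalence classes in `Γ`. -/
def GammaTilde (σ : G →* (A ≃⋆ₐ[ℂ] A)) : Type (max u v (w + 1)) :=
  Quotient (GammaSet.setoid.{u, v, w} σ)

/-- The class in `Γ̃` of an element of `Γ`. -/
def GammaData.toTilde {σ : G →* (A ≃⋆ₐ[ℂ] A)} {H : HilbSpace.{w}} {K : FinHilbSpace.{w}}
    (x : GammaData σ H K) : GammaTilde.{u, v, w} σ :=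
  Quotient.mk (GammaSet.setoid σ) ⟨H, K, x⟩

/-- The action of `G` on `Γ̃`, `(π, W) ↦ (π ∘ σ_s, s·W)`; it is an action from the right. -/
noncomputable instance (σ : G →* (A ≃⋆ₐ[ℂ] A)) :
    MulAction Gᵐᵒᵖ (GammaTilde.{u, v, w} σ) where
  smul s := Quotient.map (fun x => ⟨x.H, x.K, x.data.act s.unop⟩) fun _ _ h => h.act s.unop
  one_smul q := by
    induction q using Quotient.inductionOn with
    | h x => exact Quotient.sound x.data.act_one
  mul_smul s r q := by
    induction q using Quotient.inductionOn with
    | h x => exact Quotient.sound (x.data.act_mul r.unop s.unop)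

theorem GammaTilde.op_smul {σ : G →* (A ≃⋆ₐ[ℂ] A)} {H : HilbSpace.{w}}
    {K : FinHilbSpace.{w}} (x : GammaData σ H K) (s : G) :
    MulOpposite.op s • x.toTilde = (x.act s).toTilde := rfl

/-- The Hilbert space of `Ind(π ⊗ 1, V ⊗ W̄)`. -/
noncomputable def GammaData.indHilbert [Fintype G] {σ : G →* (A ≃⋆ₐ[ℂ] A)}
    (x : GammaData σ H K) : HilbSpace.{max v w} where
  carrier := x.toCovariantRep.IndSpace

/-- The class `Φ(π, W) = [Ind(π ⊗ 1, V ⊗ W̄)]` in the dual space of the crossed product, given that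
the induced representation is irreducible. -/
noncomputable def GammaData.Phi [Fintype G] {σ : G →* (A ≃⋆ₐ[ℂ] A)} (x : GammaData σ H K)
    (h : IsIrreducibleRep x.indRep) : DualSpace.{max u v, max v w} (CrossedProduct σ) :=
  Quotient.mk (IrrRep.setoid (CrossedProduct σ)) ⟨x.indHilbert, x.indRep, h⟩

end Gamma

/-!
This is the Mackey machine for a finite group `G` acting on a C⋆-algebra `A`. Everything rests on
Schur's lemma (`IsIrreducibleRep.eq_smul`): an operator commuting with an irreducible representation
is a scalar, and therefore unitaries intertwining two irreducible representations are unique up to a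
scalar of modulus one. This gives the multiplier of `V` and the description of the fibres of `Γ̃`
over the dual of `A`.

An intertwiner between `π₁ ⊗ 1` and `π₂ ⊗ 1` vanishes unless `π₁` and `π₂` are equivalent, and then
it has the form `T ⊗ Y` with `T` a unitary intertwiner. If it also intertwines `V₁ ⊗ W̄₁` and
`V₂ ⊗ W̄₂` and is nonzero, then `Y` is a multiple of a unitary by Schur's lemma for projective
representations, and the pairs `(π₁, W₁)` and `(π₂, W₂)` are equivalent
(`GammaData.equivalent_of_intertwiner`).

An intertwiner `Q` from `Φ(π₁, W₁)` to `Φ(π₂, W₂)` commutes with right translations, so it is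
determined by its entries `h ↦ (Q ξ_{s,h})(1)`, where `ξ_{s,h}` is the function supported on the
coset `G_{π₁} s` with value `h` at `s`. The entry at `s` intertwines the covariant representations
of `(π₁ ∘ σ_s, s·W₁)` and `(π₂, W₂)`. Hence equivalent representations come from pairs in the same
orbit (`GammaData.exists_act_equivalent`). When the two pairs coincide, only the entries with `s ∈
G_π` survive; they are all given by the entry at `s = 1`, which is a scalar, so `Q` is a scalar and
`Φ(π, W)` is irreducible (`GammaData.indRep_irreducible`).

In the other direction, Frobenius reciprocity turns a nonzero `(A, G_π, σ)`-intertwiner `J` from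
`(π ⊗ 1, V ⊗ W̄)` to a covariant representation `(τ, U)` of `(A, G, σ)` into the nonzero intertwiner
`ξ ↦ ∑ s, U(s)⁻¹ J ξ(s)` on the induced space, which is a multiple of a unitary if `(τ, U)` is
irreducible (`GammaData.indRep_unitarilyEquivalent`). Suitable `J` show that `Φ` is constant on
equivalence classes and on orbits.

The same device gives surjectivity. An irreducible representation of the crossed product is the
integrated form of a covariant representation `(τ, U)` (`CovariantRep.exists_integrated_eq`). The
restriction of `τ` to `A` contains an irreducible subrepresentation `π`, because at most `|G|`
nonzero invariant subspaces can be mutually orthogonal: for the projection `P` onto one of them,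
`∑ s, U(s)⁻¹ P U(s)` is a scalar `≥ 1`, and these scalars add up to at most `|G|`
(`CovariantRep.exists_minimal_invariant`). The group `G_π` acts projectively on the space of
intertwiners from `π` to `τ` by `T ↦ U(s) T V(s)⁻¹`; a minimal invariant subspace is the conjugate
`W̄` of an irreducible `ω`-representation, and `J` is the evaluation `h ⊗ T ↦ T h`
(`CovariantRep.exists_equiv_of_intertwiner`).
-/

/-! ### Schur's lemma for irreducible representations -/

section Schur

variable {B : Type u} [NonUnitalCStarAlgebra B]
  {H : Type*} [NormedAddCommGroup H] [InnerProductSpace ℂ H] [CompleteSpace H]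
  {H₁ : Type*} [NormedAddCommGroup H₁] [InnerProductSpace ℂ H₁] [CompleteSpace H₁]
  {H₂ : Type*} [NormedAddCommGroup H₂] [InnerProductSpace ℂ H₂] [CompleteSpace H₂]

/-- The kernel of an intertwiner is a closed invariant subspace. -/
theorem IsIrreducibleRep.eq_zero_or_injective {π : B →⋆ₙₐ[ℂ] (H →L[ℂ] H)}
    (h : IsIrreducibleRep π) {π₂ : B →⋆ₙₐ[ℂ] (H₂ →L[ℂ] H₂)} (Q : H →L[ℂ] H₂)
    (hQ : ∀ b x, Q (π b x) = π₂ b (Q x)) : Q = 0 ∨ Function.Injective Q := by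
  rcases h.eq_bot_or_top (LinearMap.ker (Q : H →ₗ[ℂ] H₂)) Q.isClosed_ker (fun b x hx => by
    rw [LinearMap.mem_ker] at hx ⊢
    change Q (π b x) = 0
    change Q x = 0 at hx
    rw [hQ, hx, map_zero]) with h0 | h1
  · right
    exact LinearMap.ker_eq_bot.mp h0
  · left
    ext x
    have : x ∈ LinearMap.ker (Q : H →ₗ[ℂ] H₂) := h1 ▸ Submodule.mem_top
    exact this

/-- A self-adjoint operator `S` commuting with an irreducible representation has a sign: its
positive part also commutes with the representation, so it is zero or injective, and in the second
case `S⁺ S⁻ = 0` gives `S⁻ = 0`. -/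
theorem IsIrreducibleRep.nonneg_or_nonpos {π : B →⋆ₙₐ[ℂ] (H →L[ℂ] H)} (h : IsIrreducibleRep π)
    {S : H →L[ℂ] H} (hS : IsSelfAdjoint S) (hc : ∀ b, Commute S (π b)) :
    0 ≤ S ∨ S ≤ 0 := by
  have hcomm : ∀ b, Commute (S⁺) (π b) := fun b => by
    rw [CFC.posPart_def]
    exact hS.commute_cfcₙ (hc b) _
  rcases h.eq_zero_or_injective (π₂ := π) (S⁺) (fun b x =>
    congrArg (fun T : H →L[ℂ] H => T x) (hcomm b).eq) with h0 | h1
  · right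
    rw [← CFC.posPart_sub_negPart S hS, h0, zero_sub]
    exact neg_nonpos.mpr (CFC.negPart_nonneg S)
  · left
    have hneg : S⁻ = 0 := by
      ext x
      apply h1
      change (S⁺ * S⁻) x = S⁺ 0
      rw [CFC.posPart_mul_negPart, map_zero]
      rfl
    rw [← CFC.posPart_sub_negPart S hS, hneg, sub_zero]
    exact CFC.posPart_nonneg S

/-- Schur's lemma for self-adjoint operators. By `IsIrreducibleRep.nonneg_or_nonpos`, for every real
`m` the quadratic form of `S` is either at most or at least that of `m`; comparing with the value
`l` at a unit vector, it is that of `l`. -/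
theorem IsIrreducibleRep.selfAdjoint_eq_smul {π : B →⋆ₙₐ[ℂ] (H →L[ℂ] H)}
    (h : IsIrreducibleRep π) {S : H →L[ℂ] H} (hS : IsSelfAdjoint S)
    (hc : ∀ b, Commute S (π b)) : ∃ c : ℂ, S = c • 1 := by
  have := h.nontrivial
  obtain ⟨x₀, hx₀⟩ := exists_norm_eq H (zero_le_one)
  set l : ℝ := S.reApplyInnerSelf x₀ with hl
  have key : ∀ m : ℝ, IsSelfAdjoint (S - (m : ℂ) • 1) ∧ ∀ x : H,
      (S - (m : ℂ) • (1 : H →L[ℂ] H)).reApplyInnerSelf x =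
        S.reApplyInnerSelf x - m * ‖x‖ ^ 2 := by
    intro m
    refine ⟨hS.sub ?_, fun x => ?_⟩
    · rw [isSelfAdjoint_iff, star_smul, star_one, Complex.star_def, Complex.conj_ofReal]
    · rw [ContinuousLinearMap.reApplyInnerSelf_apply, ContinuousLinearMap.reApplyInnerSelf_apply]
      change RCLike.re (inner ℂ (S x - (m : ℂ) • x) x) = _
      rw [inner_sub_left, inner_smul_left, inner_self_eq_norm_sq_to_K, map_sub, Complex.conj_ofReal]
      congr 1
      norm_cast
      change ((m : ℂ) * ((‖x‖ ^ 2 : ℝ) : ℂ)).re = _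
      rw [Complex.re_mul_ofReal, Complex.ofReal_re]
  have hcase : ∀ m : ℝ, (∀ x, m * ‖x‖ ^ 2 ≤ S.reApplyInnerSelf x) ∨
      ∀ x, S.reApplyInnerSelf x ≤ m * ‖x‖ ^ 2 := by
    intro m
    rcases h.nonneg_or_nonpos (key m).1 (fun b => (hc b).sub_left
      ((Commute.one_left _).smul_left _)) with h0 | h0
    · left
      intro x
      have := (ContinuousLinearMap.nonneg_iff_isPositive _).mp h0 |>.re_inner_nonneg_left x
      have h2 := (key m).2 x
      rw [ContinuousLinearMap.reApplyInnerSelf_apply] at h2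
      linarith
    · right
      intro x
      have := (ContinuousLinearMap.nonneg_iff_isPositive _).mp (neg_nonneg.mpr h0)
        |>.re_inner_nonneg_left x
      have h2 := (key m).2 x
      rw [ContinuousLinearMap.reApplyInnerSelf_apply] at h2
      rw [neg_apply, inner_neg_left, map_neg] at this
      linarith
  have hval : ∀ x, S.reApplyInnerSelf x = l * ‖x‖ ^ 2 := by
    intro x
    have hcont : Continuous fun m : ℝ => m * ‖x‖ ^ 2 := by fun_prop
    apply le_antisymm
    · refine ge_of_tendsto (hcont.continuousWithinAt (s := Set.Ioi l) (x := l)) ?_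
      filter_upwards [self_mem_nhdsWithin] with m hm
      rcases hcase m with h0 | h0
      · have := h0 x₀
        rw [hx₀, ← hl] at this
        exact absurd hm (by simpa using this)
      · exact h0 x
    · refine le_of_tendsto (hcont.continuousWithinAt (s := Set.Iio l) (x := l)) ?_
      filter_upwards [self_mem_nhdsWithin] with m hm
      rcases hcase m with h0 | h0
      · exact h0 x
      · have := h0 x₀
        rw [hx₀, ← hl] at this
        exact absurd hm (by simpa using this)
  refine ⟨l, ?_⟩
  have hsa := (key l).1
  rw [← sub_eq_zero]
  apply le_antisymm
  · rw [← neg_nonneg, ContinuousLinearMap.nonneg_iff_isPositive,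
      ContinuousLinearMap.isPositive_def']
    refine ⟨hsa.neg, fun x => ?_⟩
    have := (key l).2 x
    rw [hval, sub_self, ContinuousLinearMap.reApplyInnerSelf_apply] at this
    rw [ContinuousLinearMap.reApplyInnerSelf_apply, neg_apply,
      inner_neg_left, map_neg, this, neg_zero]
  · rw [ContinuousLinearMap.nonneg_iff_isPositive, ContinuousLinearMap.isPositive_def']
    refine ⟨hsa, fun x => ?_⟩
    rw [(key l).2 x, hval, sub_self]

/-- **Schur's lemma**: an operator commuting with an irreducible representation is a scalar. -/
theorem IsIrreducibleRep.eq_smul {π : B →⋆ₙₐ[ℂ] (H →L[ℂ] H)}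
    (h : IsIrreducibleRep π) (C : H →L[ℂ] H) (hc : ∀ b x, C (π b x) = π b (C x)) :
    ∃ c : ℂ, ∀ x, C x = c • x := by
  have hcomm : ∀ b, Commute C (π b) := fun b => ContinuousLinearMap.ext fun x => hc b x
  have hstar : ∀ b, Commute (star C) (π b) := fun b => by
    have := (hcomm (star b)).star_star
    rwa [map_star, star_star] at this
  obtain ⟨p, hp⟩ := h.selfAdjoint_eq_smul (realPart C).2 fun b => by
    rw [realPart_apply_coe]
    exact ((hcomm b).add_left (hstar b)).smul_left _
  obtain ⟨q, hq⟩ := h.selfAdjoint_eq_smul (imaginaryPart C).2 fun b => by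
    rw [imaginaryPart_apply_coe]
    exact (((hcomm b).sub_left (hstar b)).smul_left _).smul_left _
  refine ⟨p + Complex.I * q, fun x => ?_⟩
  have := congrArg (fun T : H →L[ℂ] H => T x) (realPart_add_I_smul_imaginaryPart C)
  beta_reduce at this
  rw [hp, hq] at this
  rw [← this]
  simp [add_smul, smul_smul]

/-- Intertwiners out of an irreducible representation are multiples of isometries, and their inner
products are scalars. -/
theorem IsIrreducibleRep.inner_intertwiners {π₁ : B →⋆ₙₐ[ℂ] (H₁ →L[ℂ] H₁)}
    (h : IsIrreducibleRep π₁) {π₂ : B →⋆ₙₐ[ℂ] (H₂ →L[ℂ] H₂)} (P Q : H₁ →L[ℂ] H₂)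
    (hP : ∀ b x, P (π₁ b x) = π₂ b (P x)) (hQ : ∀ b x, Q (π₁ b x) = π₂ b (Q x)) :
    ∃ c : ℂ, ∀ x y, inner ℂ (P x) (Q y) = c * inner ℂ x y := by
  obtain ⟨c, hc⟩ := h.eq_smul (P.adjoint ∘L Q) fun b x => by
    refine ext_inner_left ℂ fun y => ?_
    rw [ContinuousLinearMap.comp_apply, ContinuousLinearMap.adjoint_inner_right, hQ,
      ContinuousLinearMap.comp_apply, ← ContinuousLinearMap.adjoint_inner_left (π₁ b),
      ContinuousLinearMap.adjoint_inner_right, ← ContinuousLinearMap.star_eq_adjoint, ← map_star,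
      hP, map_star, ContinuousLinearMap.star_eq_adjoint, ContinuousLinearMap.adjoint_inner_left]
  refine ⟨c, fun x y => ?_⟩
  rw [← ContinuousLinearMap.adjoint_inner_right, ← ContinuousLinearMap.comp_apply, hc,
    inner_smul_right]

theorem norm_sq_of_inner {E F : Type*} [NormedAddCommGroup E] [InnerProductSpace ℂ E]
    [NormedAddCommGroup F] [InnerProductSpace ℂ F] (Q : E →ₗ[ℂ] F) {c : ℂ}
    (hc : ∀ x y, inner ℂ (Q x) (Q y) = c * inner ℂ x y) (x : E) :
    ‖Q x‖ ^ 2 = c.re * ‖x‖ ^ 2 := by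
  have h := congrArg Complex.re (hc x x)
  rw [inner_self_eq_norm_sq_to_K, inner_self_eq_norm_sq_to_K] at h
  norm_cast at h
  change ((‖Q x‖ ^ 2 : ℝ) : ℂ).re = (c * ((‖x‖ ^ 2 : ℝ) : ℂ)).re at h
  rwa [Complex.ofReal_re, Complex.re_mul_ofReal] at h

/-- A nonzero operator multiplying inner products by a constant is a multiple of a unitary, if its
range is everything as soon as it is closed. -/
theorem exists_unitary_of_inner {E F : Type*} [NormedAddCommGroup E] [InnerProductSpace ℂ E]
    [CompleteSpace E] [NormedAddCommGroup F] [InnerProductSpace ℂ F] (Q : E →ₗ[ℂ] F) (hne : Q ≠ 0)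
    {c : ℂ} (hc : ∀ x y, inner ℂ (Q x) (Q y) = c * inner ℂ x y)
    (hr : IsClosed (LinearMap.range Q : Set F) → LinearMap.range Q = ⊤) :
    ∃ (T : E ≃ₗᵢ[ℂ] F) (r : ℂ), r ≠ 0 ∧ ∀ x, Q x = r • T x := by
  obtain ⟨x₀, hx₀⟩ : ∃ x, Q x ≠ 0 := by
    by_contra! h
    exact hne (LinearMap.ext h)
  have hx₀' : x₀ ≠ 0 := fun h => hx₀ (by rw [h, map_zero])
  have hn := norm_sq_of_inner Q hc
  have hpos : 0 < c.re := by
    have h1 := hn x₀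
    have h2 : 0 < ‖Q x₀‖ ^ 2 := by positivity
    have h3 : 0 < ‖x₀‖ ^ 2 := by positivity
    rw [h1] at h2
    exact (pos_iff_pos_of_mul_pos h2).mpr h3
  set r : ℝ := Real.sqrt c.re with hrdef
  have hrpos : 0 < r := Real.sqrt_pos.mpr hpos
  have hnorm : ∀ x, ‖Q x‖ = r * ‖x‖ := fun x => by
    rw [← Real.sqrt_sq (norm_nonneg (Q x)), hn, Real.sqrt_mul hpos.le, Real.sqrt_sq (norm_nonneg x)]
  have hrC : (r : ℂ) ≠ 0 := by exact_mod_cast hrpos.ne'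
  let T₀ : E →ₗᵢ[ℂ] F :=
    { toLinearMap := (r : ℂ)⁻¹ • Q
      norm_map' := fun x => by
        rw [LinearMap.smul_apply, norm_smul, hnorm, norm_inv, Complex.norm_real,
          Real.norm_of_nonneg hrpos.le, inv_mul_cancel_left₀ hrpos.ne'] }
  have hT₀ : ∀ x, Q x = (r : ℂ) • T₀ x := fun x => by
    change Q x = (r : ℂ) • (r : ℂ)⁻¹ • Q x
    rw [smul_inv_smul₀ hrC]
  have hrange : Set.range T₀ = (LinearMap.range Q : Set F) := by
    ext y
    constructor
    · rintro ⟨x, rfl⟩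
      exact ⟨(r : ℂ)⁻¹ • x, map_smul _ _ _⟩
    · rintro ⟨x, rfl⟩
      exact ⟨(r : ℂ) • x, by rw [map_smul, hT₀]⟩
  have hsurj : Function.Surjective T₀ := by
    have hcl : IsClosed (LinearMap.range Q : Set F) := by
      rw [← hrange]
      exact T₀.isometry.isClosedEmbedding.isClosed_range
    rw [← Set.range_eq_univ, hrange, hr hcl, Submodule.top_coe]
  exact ⟨LinearIsometryEquiv.ofSurjective T₀ hsurj, r, hrC, hT₀⟩

/-- A nonzero intertwiner of irreducible representations is a multiple of a unitary one. -/
theorem IsIrreducibleRep.exists_unitary {π₁ : B →⋆ₙₐ[ℂ] (H₁ →L[ℂ] H₁)}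
    (h₁ : IsIrreducibleRep π₁) {π₂ : B →⋆ₙₐ[ℂ] (H₂ →L[ℂ] H₂)} (h₂ : IsIrreducibleRep π₂)
    (Q : H₁ →L[ℂ] H₂) (hQ : ∀ b x, Q (π₁ b x) = π₂ b (Q x)) (hne : Q ≠ 0) :
    UnitarilyEquivalent π₁ π₂ := by
  obtain ⟨c, hc⟩ := h₁.inner_intertwiners Q Q hQ hQ
  have hne' : (Q : H₁ →ₗ[ℂ] H₂) ≠ 0 := fun h => hne (ContinuousLinearMap.coe_injective h)
  obtain ⟨T, r, hr, hT⟩ := exists_unitary_of_inner (Q : H₁ →ₗ[ℂ] H₂) hne' hc fun hcl => by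
    refine (h₂.eq_bot_or_top _ hcl ?_).resolve_left fun h => hne' (LinearMap.range_eq_bot.mp h)
    rintro b _ ⟨x, rfl⟩
    exact ⟨π₁ b x, hQ b x⟩
  refine ⟨T, fun b x => ?_⟩
  have h := hQ b x
  change (Q : H₁ →ₗ[ℂ] H₂) _ = π₂ b ((Q : H₁ →ₗ[ℂ] H₂) _) at h
  rw [hT, hT, map_smul] at h
  exact smul_right_injective _ hr h

/-- Intertwiners between equivalent irreducible representations are unique up to a scalar. -/
theorem IsIrreducibleRep.exists_eq_smul {π₁ : B →⋆ₙₐ[ℂ] (H₁ →L[ℂ] H₁)}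
    (h₁ : IsIrreducibleRep π₁) {π₂ : B →⋆ₙₐ[ℂ] (H₂ →L[ℂ] H₂)} {T : H₁ ≃ₗᵢ[ℂ] H₂}
    (hT : Intertwines π₁ π₂ T) (Q : H₁ →L[ℂ] H₂) (hQ : ∀ b x, Q (π₁ b x) = π₂ b (Q x)) :
    ∃ c : ℂ, ∀ x, Q x = c • T x := by
  obtain ⟨c, hc⟩ := h₁.eq_smul (T.symm.toContinuousLinearEquiv.toContinuousLinearMap ∘L Q)
    fun b x => by
      change T.symm (Q _) = π₁ b (T.symm (Q x))
      rw [hQ, hT.symm]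
  refine ⟨c, fun x => ?_⟩
  have h : T.symm (Q x) = c • x := hc x
  rw [← map_smul, ← h, LinearIsometryEquiv.apply_symm_apply]

/-- Unitary intertwiners between irreducible representations are unique up to a scalar of modulus
one. -/
theorem IsIrreducibleRep.exists_eq_circle_smul {π₁ : B →⋆ₙₐ[ℂ] (H₁ →L[ℂ] H₁)}
    (h₁ : IsIrreducibleRep π₁) {π₂ : B →⋆ₙₐ[ℂ] (H₂ →L[ℂ] H₂)} {T R : H₁ ≃ₗᵢ[ℂ] H₂}
    (hT : Intertwines π₁ π₂ T) (hR : Intertwines π₁ π₂ R) :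
    ∃ c : Circle, ∀ x, R x = (c : ℂ) • T x := by
  obtain ⟨c, hc⟩ := h₁.exists_eq_smul hT R.toContinuousLinearEquiv.toContinuousLinearMap hR
  have := h₁.nontrivial
  obtain ⟨x, hx⟩ := exists_norm_eq H₁ (zero_le_one)
  have h : ‖R x‖ = ‖c • T x‖ := congrArg norm (hc x)
  rw [norm_smul, R.norm_map, T.norm_map, hx, mul_one] at h
  exact ⟨⟨c, mem_sphere_zero_iff_norm.mpr h.symm⟩, hc⟩

end Schur

/-! ### Schur's lemma for projective representations -/

theorem circle_mul_star (c : Circle) : (c : ℂ) * star (c : ℂ) = 1 := by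
  rw [Complex.star_def, Complex.mul_conj, Circle.normSq_coe, Complex.ofReal_one]

section ProjectiveSchur

variable {S : Type*}
  {K₁ : Type*} [NormedAddCommGroup K₁] [InnerProductSpace ℂ K₁] [FiniteDimensional ℂ K₁]
  {K₂ : Type*} [NormedAddCommGroup K₂] [InnerProductSpace ℂ K₂]

/-- **Schur's lemma** for finite-dimensional projective representations whose multipliers differ
by the coboundary of `c`. -/
theorem IsIrreducibleProj.exists_unitary [Group S] {W₁ : S → (K₁ ≃ₗᵢ[ℂ] K₁)}
    (h₁ : IsIrreducibleProj W₁)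
    {W₂ : S → (K₂ ≃ₗᵢ[ℂ] K₂)} (h₂ : IsIrreducibleProj W₂) {c : S → Circle} (Y : K₁ →ₗ[ℂ] K₂)
    (hne : Y ≠ 0) (hY : ∀ s k, Y (W₁ s k) = (c s : ℂ) • W₂ s (Y k)) :
    ∃ (R : K₁ ≃ₗᵢ[ℂ] K₂) (r : ℂ), r ≠ 0 ∧ ∀ k, Y k = r • R k := by
  have := h₁.nontrivial
  have hcircle : ∀ s, star (c s : ℂ) * (c s : ℂ) = 1 := fun s => by
    rw [mul_comm, circle_mul_star]
  have hYW : ∀ s k l, inner ℂ (Y (W₁ s k)) (Y (W₁ s l)) = inner ℂ (Y k) (Y l) := fun s k l => by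
    rw [hY, hY, inner_smul_left, inner_smul_right, LinearIsometryEquiv.inner_map_map, ← mul_assoc]
    have := hcircle s
    rw [Complex.star_def] at this
    rw [this, one_mul]
  -- `K₂` is not assumed complete, so the adjoint is formed for `Y` as an operator into its range
  let Y' : K₁ →ₗ[ℂ] LinearMap.range Y := Y.rangeRestrict
  let D : K₁ →ₗ[ℂ] K₁ := LinearMap.adjoint Y' ∘ₗ Y'
  have hD : ∀ k l, inner ℂ k (D l) = inner ℂ (Y k) (Y l) := fun k l => by
    change inner ℂ k (LinearMap.adjoint Y' (Y' l)) = _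
    rw [LinearMap.adjoint_inner_right]
    rfl
  obtain ⟨μ, hμ⟩ := Module.End.exists_eigenvalue D
  have hscal : ∀ k, D k = μ • k := by
    rcases h₁.eq_bot_or_top (Module.End.eigenspace D μ)
      (Submodule.closed_of_finiteDimensional _) (fun s k hk => by
        rw [Module.End.mem_eigenspace_iff] at hk ⊢
        refine ext_inner_left ℂ fun l => ?_
        obtain ⟨l, rfl⟩ := (W₁ s).surjective l
        rw [hD, hYW, ← hD, hk, inner_smul_right, inner_smul_right,
          LinearIsometryEquiv.inner_map_map]) with h | h
    · exact absurd h hμ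
    · intro k
      rw [← Module.End.mem_eigenspace_iff, h]
      exact Submodule.mem_top
  have : CompleteSpace K₁ := FiniteDimensional.complete ℂ K₁
  refine exists_unitary_of_inner Y hne (c := μ) (fun k l => by
    rw [← hD, hscal, inner_smul_right]) fun hcl => ?_
  refine (h₂.eq_bot_or_top _ hcl ?_).resolve_left fun h => hne (LinearMap.range_eq_bot.mp h)
  rintro s _ ⟨k, rfl⟩
  refine ⟨star (c s : ℂ) • W₁ s k, ?_⟩
  rw [map_smul, hY, smul_smul, hcircle, one_smul]

end ProjectiveSchur

/-! ### Intertwiners between amplified representations -/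

section TensorIntertwiners

variable {H : Type u} [NormedAddCommGroup H] [InnerProductSpace ℂ H]
  {K : Type v} [NormedAddCommGroup K] [InnerProductSpace ℂ K]

theorem tmul_eq_zero_of_ne_zero {h : H} (hh : h ≠ 0) {k : K} (hk : h ⊗ₜ[ℂ] k = 0) : k = 0 := by
  have := congrArg norm hk
  rw [TensorProduct.norm_tmul, norm_zero, mul_eq_zero, norm_eq_zero, norm_eq_zero] at this
  exact this.resolve_left hh

theorem tmul_left_cancel {h : H} (hh : h ≠ 0) {k l : K} (hk : h ⊗ₜ[ℂ] k = h ⊗ₜ[ℂ] l) : k = l := by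
  rw [← sub_eq_zero]
  refine tmul_eq_zero_of_ne_zero hh ?_
  rw [TensorProduct.tmul_sub, hk, sub_self]

theorem tensor_clm_ext {E : Type*} [NormedAddCommGroup E] [NormedSpace ℂ E]
    {X Y : H ⊗[ℂ] K →L[ℂ] E} (h : ∀ a b, X (a ⊗ₜ b) = Y (a ⊗ₜ b)) : X = Y := by
  ext ξ
  induction ξ using TensorProduct.induction_on with
  | zero => simp only [map_zero]
  | tmul a b => exact h a b
  | add y z hy hz => simp only [map_add, hy, hz]

end TensorIntertwiners

namespace ConjSpace

variable {K₁ K₂ : Type*}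
  [NormedAddCommGroup K₁] [InnerProductSpace ℂ K₁] [NormedAddCommGroup K₂] [InnerProductSpace ℂ K₂]

/-- A unitary `R : K₁ → K₂`, viewed as a unitary of the conjugate spaces. -/
def congr (R : K₁ ≃ₗᵢ[ℂ] K₂) : ConjSpace K₁ ≃ₗᵢ[ℂ] ConjSpace K₂ where
  toFun x := of (R (of.symm x))
  invFun x := of (R.symm (of.symm x))
  left_inv _ := R.symm_apply_apply _
  right_inv _ := R.apply_symm_apply _
  map_add' _ _ := map_add R _ _
  map_smul' c x := R.map_smul ((starRingEnd ℂ) c) (of.symm x)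
  norm_map' _ := R.norm_map _

theorem symm_smul (c : ℂ) (x : ConjSpace K₁) : of.symm (c • x) = star c • of.symm x := rfl

end ConjSpace

namespace GammaData

variable {G : Type v} [Group G] {A : Type u} [NonUnitalCStarAlgebra A]
  {H₁ : Type w} [NormedAddCommGroup H₁] [InnerProductSpace ℂ H₁] [CompleteSpace H₁]
  {K₁ : Type w} [NormedAddCommGroup K₁] [InnerProductSpace ℂ K₁] [FiniteDimensional ℂ K₁]
  {H₂ : Type w} [NormedAddCommGroup H₂] [InnerProductSpace ℂ H₂] [CompleteSpace H₂]
  {K₂ : Type w} [NormedAddCommGroup K₂] [InnerProductSpace ℂ K₂] [FiniteDimensional ℂ K₂]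
  {σ : G →* (A ≃⋆ₐ[ℂ] A)} {x : GammaData σ H₁ K₁} {y : GammaData σ H₂ K₂}
  {X : H₁ ⊗[ℂ] ConjSpace K₁ →L[ℂ] H₂ ⊗[ℂ] ConjSpace K₂}

/-- The matrix coefficient `h ↦ (1 ⊗ ⟪l, ·⟫) X (h ⊗ k)` of an operator between tensor products. -/
noncomputable def coeffOp (X : H₁ ⊗[ℂ] ConjSpace K₁ →L[ℂ] H₂ ⊗[ℂ] ConjSpace K₂)
    (k : ConjSpace K₁) (l : ConjSpace K₂) : H₁ →L[ℂ] H₂ :=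
  tensorSlice H₂ l ∘L X ∘L (TensorProduct.mkL ℂ H₁ (ConjSpace K₁)).flip k

theorem coeffOp_apply (k : ConjSpace K₁) (l : ConjSpace K₂) (h : H₁) :
    coeffOp X k l h = tensorSlice H₂ l (X (h ⊗ₜ k)) := rfl

theorem coeffOp_intertwines (hX : ∀ a ξ, X (x.ampl a ξ) = y.ampl a (X ξ)) (k : ConjSpace K₁)
    (l : ConjSpace K₂) (a : A) (h : H₁) :
    coeffOp X k l (x.π a h) = y.π a (coeffOp X k l h) := by
  rw [coeffOp_apply, coeffOp_apply, ← tensorSlice_ampl, ← hX, ampl_tmul]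

theorem exists_coeffOp_ne_zero (hne : X ≠ 0) : ∃ k l, coeffOp X k l ≠ 0 := by
  by_contra! h
  refine hne (tensor_clm_ext fun a k => ?_)
  rw [← sum_tensorSlice (stdOrthonormalBasis ℂ (ConjSpace K₂)) (X _)]
  refine Finset.sum_eq_zero fun i _ => ?_
  rw [← coeffOp_apply, h, zero_apply, TensorProduct.zero_tmul]

/-- If there is a nonzero intertwiner between `π₁ ⊗ 1` and `π₂ ⊗ 1`, then `π₁` and `π₂` are
equivalent. -/
theorem unitarilyEquivalent_of_ampl (hne : X ≠ 0)
    (hX : ∀ a ξ, X (x.ampl a ξ) = y.ampl a (X ξ)) : UnitarilyEquivalent x.π y.π := by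
  obtain ⟨k, l, h⟩ := exists_coeffOp_ne_zero hne
  exact x.irred.exists_unitary y.irred _ (coeffOp_intertwines hX k l) h

/-- An intertwiner between `π₁ ⊗ 1` and `π₂ ⊗ 1` has the form `T ⊗ Y`, where `T` is a unitary
intertwiner between `π₁` and `π₂`. -/
theorem exists_eq_tmul {T : H₁ ≃ₗᵢ[ℂ] H₂} (hT : Intertwines x.π y.π T)
    (hX : ∀ a ξ, X (x.ampl a ξ) = y.ampl a (X ξ)) :
    ∃ Y : ConjSpace K₁ →ₗ[ℂ] ConjSpace K₂, ∀ h k, X (h ⊗ₜ k) = T h ⊗ₜ Y k := by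
  have key : ∀ k, ∃ l, ∀ h, X (h ⊗ₜ k) = T h ⊗ₜ l := fun k => by
    let b := stdOrthonormalBasis ℂ (ConjSpace K₂)
    choose c hc using fun i => x.irred.exists_eq_smul hT _ (coeffOp_intertwines hX k (b i))
    refine ⟨∑ i, c i • b i, fun h => ?_⟩
    rw [← sum_tensorSlice b (X _), TensorProduct.tmul_sum]
    refine Finset.sum_congr rfl fun i _ => ?_
    rw [← coeffOp_apply, hc, TensorProduct.smul_tmul]
  choose Y hY using key
  have := x.irred.nontrivial
  obtain ⟨h₀, hh₀⟩ := exists_ne (0 : H₁)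
  have hTh₀ : T h₀ ≠ 0 := by rwa [ne_eq, LinearIsometryEquiv.map_eq_zero_iff]
  refine ⟨{ toFun := Y, map_add' := fun k l => ?_, map_smul' := fun c k => ?_ }, fun h k => hY k h⟩
  · apply tmul_left_cancel hTh₀
    rw [← hY, TensorProduct.tmul_add, TensorProduct.tmul_add, map_add, hY, hY]
  · apply tmul_left_cancel hTh₀
    rw [← hY, TensorProduct.tmul_smul, TensorProduct.tmul_smul, map_smul, hY, RingHom.id_apply]

/-- A nonzero intertwiner between the covariant representations `(π₁ ⊗ 1, V₁ ⊗ W̄₁)` and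
`(π₂ ⊗ 1, V₂ ⊗ W̄₂)` is a multiple of `T ⊗ R̄`, where `T` and `R` implement an equivalence of the
pairs `(π₁, W₁)` and `(π₂, W₂)`; in particular it is injective. -/
theorem equivalent_of_intertwiner (hne : X ≠ 0) (hX : ∀ a ξ, X (x.ampl a ξ) = y.ampl a (X ξ))
    (hU : ∀ s (h₁ : s ∈ stabGroup σ x.π) (h₂ : s ∈ stabGroup σ y.π) ξ,
      X (x.tensorU ⟨s, h₁⟩ ξ) = y.tensorU ⟨s, h₂⟩ (X ξ)) :
    x.Equivalent y ∧ Function.Injective X := by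
  obtain ⟨T, hT⟩ := unitarilyEquivalent_of_ampl hne hX
  obtain ⟨Y, hY⟩ := exists_eq_tmul hT hX
  have := x.irred.nontrivial
  obtain ⟨h₀, hh₀⟩ := exists_ne (0 : H₁)
  have hcV : ∀ s, ∃ c : Circle, ∀ (h₁ : s ∈ stabGroup σ x.π) (h₂ : s ∈ stabGroup σ y.π) ξ,
      T (x.V ⟨s, h₁⟩ ξ) = (c : ℂ) • y.V ⟨s, h₂⟩ (T ξ) := fun s => by
    by_cases h : s ∈ stabGroup σ x.π ∧ s ∈ stabGroup σ y.π
    · have hi₁ : Intertwines x.π (compAut y.π (σ s)) (T.trans (y.V ⟨s, h.2⟩)) := fun a ξ => by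
        rw [LinearIsometryEquiv.trans_apply, hT, y.implements]
        rfl
      have hi₂ : Intertwines x.π (compAut y.π (σ s)) ((x.V ⟨s, h.1⟩).trans T) := fun a ξ => by
        rw [LinearIsometryEquiv.trans_apply, x.implements, hT]
        rfl
      obtain ⟨c, hc⟩ := x.irred.exists_eq_circle_smul hi₁ hi₂
      exact ⟨c, fun _ _ ξ => hc ξ⟩
    · exact ⟨1, fun h₁ h₂ => absurd ⟨h₁, h₂⟩ h⟩
  choose c hc using hcV
  -- cancel `T V₁(s) h₀` in the intertwining relation for `X = T ⊗ Y`
  have hYW : ∀ s (h₁ : s ∈ stabGroup σ x.π) (h₂ : s ∈ stabGroup σ y.π) k,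
      (c s : ℂ) • Y (ConjSpace.conj (x.W ⟨s, h₁⟩) k) = ConjSpace.conj (y.W ⟨s, h₂⟩) (Y k) :=
    fun s h₁ h₂ k => by
      have h := hU s h₁ h₂ (h₀ ⊗ₜ k)
      rw [tensorU_tmul, hY, hY, tensorU_tmul, hc s h₁ h₂, TensorProduct.smul_tmul] at h
      refine tmul_left_cancel ?_ h
      rwa [ne_eq, LinearIsometryEquiv.map_eq_zero_iff, LinearIsometryEquiv.map_eq_zero_iff]
  -- the operator `Y`, seen as a linear map between the original spaces
  let Y' : K₁ →ₗ[ℂ] K₂ :=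
    { toFun := fun k => ConjSpace.of.symm (Y (ConjSpace.of k))
      map_add' := fun k l => by rw [map_add, map_add, map_add]
      map_smul' := fun z k => by
        rw [ConjSpace.of_smul, map_smul, ConjSpace.symm_smul, star_star, RingHom.id_apply] }
  have hY'Y : ∀ k, Y k = ConjSpace.of (Y' (ConjSpace.of.symm k)) := fun k => rfl
  have hY'ne : Y' ≠ 0 := fun h => hne (tensor_clm_ext fun a k => by
    rw [hY, hY'Y, h, LinearMap.zero_apply, map_zero, TensorProduct.tmul_zero, zero_apply])
  have hstab : ∀ s : stabGroup σ x.π, (s : G) ∈ stabGroup σ y.π :=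
    fun s => mem_stabGroup_congr σ hT s.2
  let f : stabGroup σ x.π → stabGroup σ y.π := fun s => ⟨s, hstab s⟩
  have hf : Function.Surjective f := fun s => ⟨⟨s, mem_stabGroup_congr σ hT.symm s.2⟩, rfl⟩
  obtain ⟨R, r, hr, hR⟩ := x.irredW.exists_unitary (y.irredW.comp hf) (c := fun s => c s) Y' hY'ne
    fun s k => by
      have h : ConjSpace.of.symm ((c s : ℂ) • Y (ConjSpace.conj (x.W s) (ConjSpace.of k))) =
        y.W (f s) (Y' k) := congrArg ConjSpace.of.symm (hYW s s.2 (hstab s) (ConjSpace.of k))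
      rw [ConjSpace.symm_smul] at h
      rw [← h, smul_smul, circle_mul_star, one_smul]
      rfl
  refine ⟨⟨T, R, c, hT, hc, fun s h₁ h₂ k => ?_⟩, ?_⟩
  · have h : ConjSpace.of.symm ((c s : ℂ) • Y (ConjSpace.conj (x.W ⟨s, h₁⟩) (ConjSpace.of k))) =
        y.W ⟨s, h₂⟩ (Y' k) := congrArg ConjSpace.of.symm (hYW s h₁ h₂ (ConjSpace.of k))
    have h' : star (c s : ℂ) • Y' (x.W ⟨s, h₁⟩ k) = y.W ⟨s, h₂⟩ (Y' k) := h
    rw [hR, hR, map_smul, smul_comm] at h'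
    rw [← smul_right_injective _ hr h', smul_smul, circle_mul_star, one_smul]
  · have hX' : X = star r •
        (TensorProduct.congrIsometry T (ConjSpace.congr R)).toContinuousLinearEquiv := by
      refine tensor_clm_ext fun a k => ?_
      rw [hY, hY'Y, hR, ConjSpace.of_smul, TensorProduct.tmul_smul]
      rfl
    rw [hX']
    exact (smul_right_injective _ (star_ne_zero.mpr hr)).comp
      (TensorProduct.congrIsometry T (ConjSpace.congr R)).injective

/-- The commutant of the covariant representation `(π ⊗ 1, V ⊗ W̄)` consists of the scalars. -/
theorem eq_smul_of_commutes {X : H₁ ⊗[ℂ] ConjSpace K₁ →L[ℂ] H₁ ⊗[ℂ] ConjSpace K₁}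
    (hX : ∀ a ξ, X (x.ampl a ξ) = x.ampl a (X ξ))
    (hU : ∀ s ξ, X (x.tensorU s ξ) = x.tensorU s (X ξ)) : ∃ c : ℂ, X = c • 1 := by
  have hH := x.irred.nontrivial
  have hK : Nontrivial (ConjSpace K₁) := x.irredW.nontrivial
  obtain ⟨h₀, hh₀⟩ := exists_ne (0 : H₁)
  obtain ⟨Y, hY⟩ := exists_eq_tmul (x := x) (y := x) (T := .refl ℂ _) (fun _ _ => rfl) hX
  -- `X = 1 ⊗ Y`, and for an eigenvalue `c` of `Y` the operator `X - c` is not injective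
  obtain ⟨c, hc⟩ := Module.End.exists_eigenvalue Y
  obtain ⟨k, hk⟩ := hc.exists_hasEigenvector
  refine ⟨c, ?_⟩
  by_contra hne
  have hinj := (equivalent_of_intertwiner (x := x) (y := x) (sub_ne_zero.mpr hne)
    (fun a ξ => by
      change X (x.ampl a ξ) - c • x.ampl a ξ = x.ampl a (X ξ - c • ξ)
      rw [hX, map_sub, map_smul])
    (fun s h₁ h₂ ξ => by
      change X (x.tensorU ⟨s, h₁⟩ ξ) - c • x.tensorU ⟨s, h₁⟩ ξ = x.tensorU ⟨s, h₁⟩ (X ξ - c • ξ)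
      rw [hU, map_sub, map_smul])).2
  have h0 : (X - c • (1 : H₁ ⊗[ℂ] ConjSpace K₁ →L[ℂ] H₁ ⊗[ℂ] ConjSpace K₁)) (h₀ ⊗ₜ k) = 0 := by
    change X (h₀ ⊗ₜ k) - c • (h₀ ⊗ₜ k) = 0
    rw [hY, hk.apply_eq_smul, TensorProduct.tmul_smul, LinearIsometryEquiv.coe_refl, id, sub_self]
  have h1 : h₀ ⊗ₜ[ℂ] k = 0 := hinj (h0.trans (map_zero _).symm)
  exact hk.2 (tmul_eq_zero_of_ne_zero hh₀ h1)

end GammaData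

/-! ### Intertwiners of integrated forms -/

namespace CrossedProduct

variable {G : Type v} [Group G] {A : Type u} [NonUnitalCStarAlgebra A] {σ : G →* (A ≃⋆ₐ[ℂ] A)}

open scoped Classical in
/-- The element `a δ_s` of the crossed product. -/
noncomputable def single (s : G) (a : A) : CrossedProduct σ :=
  (Pi.single s a : G → A)

open scoped Classical in
theorem single_apply (s : G) (a : A) (t : G) :
    (single s a : CrossedProduct σ) t = if t = s then a else 0 :=
  Pi.single_apply s a t

theorem single_eq_same (s : G) (a : A) :
    (single s a : CrossedProduct σ) s = a := by
  classical
  rw [single_apply, if_pos rfl]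

end CrossedProduct

namespace CovariantRep

section Integrated

variable {G : Type v} [Group G] [Fintype G] {A : Type u} [NonUnitalCStarAlgebra A]
  {σ : G →* (A ≃⋆ₐ[ℂ] A)}
  {H₁ : Type*} [NormedAddCommGroup H₁] [InnerProductSpace ℂ H₁] [CompleteSpace H₁]
  {H₂ : Type*} [NormedAddCommGroup H₂] [InnerProductSpace ℂ H₂] [CompleteSpace H₂]

theorem integrated_single (ρ : CovariantRep σ H₁) (s : G) (a : A) (x : H₁) :
    ρ.integrated (CrossedProduct.single s a) x = ρ.π a (ρ.U s x) := by
  classical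
  rw [integrated_apply, Finset.sum_eq_single s]
  · rw [CrossedProduct.single_eq_same]
  · intro t _ ht
    rw [CrossedProduct.single_apply, if_neg ht, map_zero]
    rfl
  · simp

/-- An operator intertwines the integrated forms if and only if it intertwines both the
representations of the algebra and those of the group. For the group, the difference
`Q U₁(s) - U₂(s) Q` is killed by all `π₂(a)`, hence zero by nondegeneracy. -/
theorem integrated_intertwiner_iff (ρ₁ : CovariantRep σ H₁) (ρ₂ : CovariantRep σ H₂)
    (Q : H₁ →L[ℂ] H₂) :
    (∀ f x, Q (ρ₁.integrated f x) = ρ₂.integrated f (Q x)) ↔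
      (∀ a x, Q (ρ₁.π a x) = ρ₂.π a (Q x)) ∧ ∀ s x, Q (ρ₁.U s x) = ρ₂.U s (Q x) := by
  constructor
  · intro h
    have hs : ∀ s a x, Q (ρ₁.π a (ρ₁.U s x)) = ρ₂.π a (ρ₂.U s (Q x)) := fun s a x => by
      rw [← integrated_single, h, integrated_single]
    have hπ : ∀ a x, Q (ρ₁.π a x) = ρ₂.π a (Q x) := fun a x => by
      have := hs 1 a x
      rwa [map_one, map_one] at this
    refine ⟨hπ, fun s x => ?_⟩
    rw [← sub_eq_zero]
    refine (isNondegenerate_iff ρ₂.π).mp ρ₂.nondeg _ fun a => ?_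
    rw [map_sub, ← hs, ← hπ, sub_self]
  · rintro ⟨hπ, hU⟩ f x
    simp only [integrated_apply, map_sum, hπ, hU]

end Integrated

/-! ### Induced covariant representations and Frobenius reciprocity -/

section Induced

variable {G : Type v} [Group G] [Fintype G] {A : Type u} [NonUnitalCStarAlgebra A]
  {σ : G →* (A ≃⋆ₐ[ℂ] A)} {S : Subgroup G}
  {H : Type w} [NormedAddCommGroup H] [InnerProductSpace ℂ H] [CompleteSpace H]
  (ρ : CovariantRep (σ.comp S.subtype) H)

/-- Evaluation of the functions in the induced space at a point of the group. -/
noncomputable def indEval (s : G) : ρ.IndSpace →L[ℂ] H where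
  toFun ξ := ξ.1 s
  map_add' _ _ := rfl
  map_smul' _ _ := rfl
  cont := by
    change Continuous fun ξ : ρ.indSpace => ξ.1 s
    fun_prop

theorem indSpace_ext {ξ η : ρ.IndSpace} (h : ∀ s, ρ.indEval s ξ = ρ.indEval s η) : ξ = η :=
  Subtype.ext (PiLp.ext h)

theorem indEval_mul (t : S) (s : G) (ξ : ρ.IndSpace) :
    ρ.indEval (t * s) ξ = ρ.U t (ρ.indEval s ξ) := ξ.2 t s

theorem indEval_U (s t : G) (ξ : ρ.IndSpace) :
    ρ.indEval s (ρ.ind.U t ξ) = ρ.indEval (s * t) ξ := rfl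

theorem indEval_π (s : G) (a : A) (ξ : ρ.IndSpace) :
    ρ.indEval s (ρ.ind.π a ξ) = ρ.π (σ s a) (ρ.indEval s ξ) := rfl

open scoped Classical in
/-- The function supported on the coset `S s` with `t s ↦ U(t) h` for `t ∈ S`. -/
noncomputable def cosetFun (s : G) (h : H) (r : G) : H :=
  if hr : r * s⁻¹ ∈ S then ρ.U ⟨r * s⁻¹, hr⟩ h else 0

theorem cosetFun_of_mem {r s : G} (hr : r * s⁻¹ ∈ S) (h : H) :
    ρ.cosetFun s h r = ρ.U ⟨r * s⁻¹, hr⟩ h :=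
  dif_pos hr

theorem cosetFun_of_not_mem {r s : G} (hr : r * s⁻¹ ∉ S) (h : H) : ρ.cosetFun s h r = 0 :=
  dif_neg hr

/-- The embedding of `H` into the induced space as the functions supported on the coset `S s`,
with `h` as the value at `s`. -/
noncomputable def indIncl (s : G) : H →L[ℂ] ρ.IndSpace where
  toFun h := (⟨WithLp.toLp 2 (ρ.cosetFun s h), by
    intro t r
    change ρ.cosetFun s h (t * r) = ρ.U t (ρ.cosetFun s h r)
    by_cases hr : r * s⁻¹ ∈ S
    · have htr : (t : G) * r * s⁻¹ ∈ S := by rw [mul_assoc]; exact S.mul_mem t.2 hr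
      rw [ρ.cosetFun_of_mem hr, ρ.cosetFun_of_mem htr, ← unitary_mul_apply, ← map_mul]
      congr 2
      exact Subtype.ext (mul_assoc _ _ _)
    · have htr : ¬ (t : G) * r * s⁻¹ ∈ S := by rwa [mul_assoc, S.mul_mem_cancel_left t.2]
      rw [ρ.cosetFun_of_not_mem hr, ρ.cosetFun_of_not_mem htr, map_zero]⟩ : ρ.indSpace)
  map_add' h k := by
    refine Subtype.ext (PiLp.ext fun r => ?_)
    change ρ.cosetFun s (h + k) r = ρ.cosetFun s h r + ρ.cosetFun s k r
    unfold cosetFun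
    split_ifs
    · rw [map_add]
    · rw [add_zero]
  map_smul' c h := by
    refine Subtype.ext (PiLp.ext fun r => ?_)
    change ρ.cosetFun s (c • h) r = c • ρ.cosetFun s h r
    unfold cosetFun
    split_ifs
    · rw [map_smul]
    · rw [smul_zero]
  cont := by
    refine Continuous.subtype_mk ?_ _
    refine (PiLp.continuous_toLp 2 _).comp (continuous_pi fun r => ?_)
    unfold cosetFun
    split_ifs with hr
    · exact (ρ.U ⟨r * s⁻¹, hr⟩).continuous
    · exact continuous_const

theorem indEval_indIncl_of_mem {r s : G} (hr : r * s⁻¹ ∈ S) (h : H) :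
    ρ.indEval r (ρ.indIncl s h) = ρ.U ⟨r * s⁻¹, hr⟩ h :=
  ρ.cosetFun_of_mem hr h

theorem indEval_indIncl_of_not_mem {r s : G} (hr : r * s⁻¹ ∉ S) (h : H) :
    ρ.indEval r (ρ.indIncl s h) = 0 :=
  ρ.cosetFun_of_not_mem hr h

theorem indEval_indIncl_self (s : G) (h : H) : ρ.indEval s (ρ.indIncl s h) = h := by
  have hs : s * s⁻¹ ∈ S := by rw [mul_inv_cancel]; exact S.one_mem
  have h1 : (⟨s * s⁻¹, hs⟩ : S) = 1 := Subtype.ext (mul_inv_cancel s)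
  rw [indEval_indIncl_of_mem ρ hs, h1, map_one]
  rfl

theorem ind_π_indIncl (s : G) (a : A) (h : H) :
    ρ.ind.π a (ρ.indIncl s h) = ρ.indIncl s (ρ.π (σ s a) h) := by
  refine ρ.indSpace_ext fun r => ?_
  rw [indEval_π]
  by_cases hr : r * s⁻¹ ∈ S
  · rw [indEval_indIncl_of_mem ρ hr, indEval_indIncl_of_mem ρ hr, ρ.covariant]
    change _ = ρ.π (σ (r * s⁻¹) (σ s a)) _
    rw [← CrossedProduct.aut_mul, inv_mul_cancel_right]
  · rw [indEval_indIncl_of_not_mem ρ hr, indEval_indIncl_of_not_mem ρ hr, map_zero]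

theorem ind_U_indIncl (s t : G) (h : H) :
    ρ.ind.U t (ρ.indIncl s h) = ρ.indIncl (s * t⁻¹) h := by
  refine ρ.indSpace_ext fun r => ?_
  rw [indEval_U]
  have h1 : r * t * s⁻¹ = r * (s * t⁻¹)⁻¹ := by group
  by_cases hr : r * t * s⁻¹ ∈ S
  · have hr' : r * (s * t⁻¹)⁻¹ ∈ S := h1 ▸ hr
    rw [indEval_indIncl_of_mem ρ hr, indEval_indIncl_of_mem ρ hr']
    congr 2
    exact Subtype.ext h1
  · have hr' : r * (s * t⁻¹)⁻¹ ∉ S := h1 ▸ hr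
    rw [indEval_indIncl_of_not_mem ρ hr, indEval_indIncl_of_not_mem ρ hr']

theorem indIncl_mul (t : S) (s : G) (h : H) :
    ρ.indIncl (t * s) (ρ.U t h) = ρ.indIncl s h := by
  refine ρ.indSpace_ext fun r => ?_
  have h1 : r * ((t : G) * s)⁻¹ * t = r * s⁻¹ := by group
  by_cases hr : r * s⁻¹ ∈ S
  · have hr' : r * ((t : G) * s)⁻¹ ∈ S := by
      rw [← S.mul_mem_cancel_right t.2, h1]
      exact hr
    rw [indEval_indIncl_of_mem ρ hr, indEval_indIncl_of_mem ρ hr', ← unitary_mul_apply, ← map_mul]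
    congr 2
    exact Subtype.ext h1
  · have hr' : r * ((t : G) * s)⁻¹ ∉ S := by
      rw [← S.mul_mem_cancel_right t.2, h1]
      exact hr
    rw [indEval_indIncl_of_not_mem ρ hr, indEval_indIncl_of_not_mem ρ hr']

/-- Every function in the induced space is the sum of its restrictions to the cosets `S s`; in the
sum over all `s ∈ G` each coset occurs `|S|` times. -/
theorem sum_indIncl_indEval (ξ : ρ.IndSpace) :
    ∑ s, ρ.indIncl s (ρ.indEval s ξ) = (Nat.card S : ℂ) • ξ := by
  classical
  refine ρ.indSpace_ext fun r => ?_
  rw [map_sum, map_smul]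
  have h1 : ∀ s, ρ.indEval r (ρ.indIncl s (ρ.indEval s ξ)) =
      if r * s⁻¹ ∈ S then ρ.indEval r ξ else 0 := fun s => by
    split_ifs with hr
    · rw [indEval_indIncl_of_mem ρ hr, ← indEval_mul]
      change ρ.indEval (r * s⁻¹ * s) ξ = _
      rw [inv_mul_cancel_right]
    · exact indEval_indIncl_of_not_mem ρ hr _
  rw [Finset.sum_congr rfl fun s _ => h1 s, ← Finset.sum_filter, Finset.sum_const,
    Nat.cast_smul_eq_nsmul]
  congr 1
  rw [Nat.card_eq_fintype_card, Fintype.card_subtype]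
  refine Finset.card_bij' (fun s _ => r * s⁻¹) (fun t _ => t⁻¹ * r) ?_ ?_ ?_ ?_
  · simp
  · simp
  · simp
  · simp

variable {E : Type*} [NormedAddCommGroup E] [InnerProductSpace ℂ E] [CompleteSpace E]

/-- Frobenius reciprocity: an operator `J` from `H` to the space of a covariant representation
`τ` of `(A, G, σ)` gives the operator `ξ ↦ ∑ s, U(s)⁻¹ J ξ(s)` on the induced space. -/
noncomputable def indLift (τ : CovariantRep σ E) (J : H →L[ℂ] E) : ρ.IndSpace →L[ℂ] E :=
  ∑ s : G, (τ.U s⁻¹).toContinuousLinearEquiv.toContinuousLinearMap ∘L J ∘L ρ.indEval s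

theorem indLift_apply (τ : CovariantRep σ E) (J : H →L[ℂ] E) (ξ : ρ.IndSpace) :
    ρ.indLift τ J ξ = ∑ s, τ.U s⁻¹ (J (ρ.indEval s ξ)) := by
  exact sum_apply' _ _ _

theorem indLift_intertwines (τ : CovariantRep σ E) (J : H →L[ℂ] E)
    (hJ : ∀ a h, J (ρ.π a h) = τ.π a (J h)) (f : CrossedProduct σ) (ξ : ρ.IndSpace) :
    ρ.indLift τ J (ρ.ind.integrated f ξ) = τ.integrated f (ρ.indLift τ J ξ) := by
  refine (integrated_intertwiner_iff ρ.ind τ (ρ.indLift τ J)).mpr ⟨fun a ξ => ?_, fun t ξ => ?_⟩ f ξ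
  · rw [indLift_apply, indLift_apply, map_sum]
    refine Finset.sum_congr rfl fun s _ => ?_
    rw [indEval_π, hJ, τ.covariant, CrossedProduct.aut_inv_cancel]
  · rw [indLift_apply, indLift_apply, map_sum]
    refine Fintype.sum_equiv (Equiv.mulRight t) _ _ fun s => ?_
    rw [indEval_U, Equiv.coe_mulRight, ← unitary_mul_apply, ← map_mul, mul_inv_rev,
      mul_inv_cancel_left]

theorem indLift_ne_zero (τ : CovariantRep σ E) (J : H →L[ℂ] E)
    (hU : ∀ (s : S) h, J (ρ.U s h) = τ.U s (J h)) (hJ : J ≠ 0) : ρ.indLift τ J ≠ 0 := by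
  classical
  obtain ⟨h, hh⟩ : ∃ h, J h ≠ 0 := by
    by_contra! h
    exact hJ (ContinuousLinearMap.ext h)
  intro h0
  have h1 : ρ.indLift τ J (ρ.indIncl 1 h) = (Nat.card S : ℂ) • J h := by
    rw [indLift_apply]
    have h2 : ∀ s, τ.U s⁻¹ (J (ρ.indEval s (ρ.indIncl 1 h))) = if s ∈ S then J h else 0 :=
      fun s => by
        split_ifs with hs
        · have hs' : s * 1⁻¹ ∈ S := by rwa [inv_one, mul_one]
          rw [indEval_indIncl_of_mem ρ hs', hU, ← unitary_mul_apply, ← map_mul]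
          simp
        · rw [indEval_indIncl_of_not_mem ρ (by rwa [inv_one, mul_one]), map_zero, map_zero]
    rw [Finset.sum_congr rfl fun s _ => h2 s, ← Finset.sum_filter, Finset.sum_const,
      Nat.cast_smul_eq_nsmul, Nat.card_eq_fintype_card, Fintype.card_subtype]
  rw [h0] at h1
  exact smul_ne_zero (Nat.cast_ne_zero.mpr Nat.card_pos.ne') hh h1.symm

/-- Frobenius reciprocity for irreducible representations: an irreducible induced representation is
equivalent to every irreducible covariant representation of `(A, G, σ)` that receives a nonzero
`(A, S, σ)`-intertwiner from the inducing representation. -/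
theorem ind_unitarilyEquivalent (hρ : IsIrreducibleRep ρ.ind.integrated) (τ : CovariantRep σ E)
    (hτ : IsIrreducibleRep τ.integrated) (J : H →L[ℂ] E) (hne : J ≠ 0)
    (hJ : ∀ a h, J (ρ.π a h) = τ.π a (J h)) (hU : ∀ (s : S) h, J (ρ.U s h) = τ.U s (J h)) :
    UnitarilyEquivalent ρ.ind.integrated τ.integrated :=
  hρ.exists_unitary hτ (ρ.indLift τ J) (ρ.indLift_intertwines τ J hJ) (ρ.indLift_ne_zero τ J hU hne)

end Induced

end CovariantRep

/-! ### Invariant subspaces and the commutant -/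

section InvariantSubspace

variable {B : Type u} [NonUnitalCStarAlgebra B]
  {H : Type*} [NormedAddCommGroup H] [InnerProductSpace ℂ H] [CompleteSpace H]

/-- The orthogonal complement of an invariant subspace is invariant. -/
theorem orthogonal_invariant (π : B →⋆ₙₐ[ℂ] (H →L[ℂ] H)) {L : Submodule ℂ H}
    (hL : ∀ b, ∀ x ∈ L, π b x ∈ L) (b : B) {x : H} (hx : x ∈ Lᗮ) : π b x ∈ Lᗮ := by
  rw [Submodule.mem_orthogonal] at hx ⊢
  intro u hu
  rw [← ContinuousLinearMap.adjoint_inner_left, ← ContinuousLinearMap.star_eq_adjoint, ← map_star]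
  exact hx _ (hL _ _ hu)

/-- The orthogonal projection onto an invariant subspace commutes with the representation. -/
theorem starProjection_commutes (π : B →⋆ₙₐ[ℂ] (H →L[ℂ] H)) (L : Submodule ℂ H)
    [L.HasOrthogonalProjection] (hL : ∀ b, ∀ x ∈ L, π b x ∈ L) (b : B) (x : H) :
    L.starProjection (π b x) = π b (L.starProjection x) := by
  refine (Submodule.eq_starProjection_of_mem_orthogonal (hL b _ (L.starProjection_apply_mem x))
    ?_)
  rw [← map_sub]
  exact orthogonal_invariant π hL b (L.sub_starProjection_mem_orthogonal x)

/-- A nondegenerate representation on a nonzero space is irreducible if its commutant consists of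
the scalars. -/
theorem isIrreducibleRep_of_commutant {π : B →⋆ₙₐ[ℂ] (H →L[ℂ] H)} (hn : IsNondegenerate π)
    (ht : Nontrivial H)
    (h : ∀ Q : H →L[ℂ] H, (∀ b x, Q (π b x) = π b (Q x)) → ∃ c : ℂ, Q = c • 1) :
    IsIrreducibleRep π where
  nondeg := hn
  nontrivial := ht
  eq_bot_or_top L hcl hL := by
    have : CompleteSpace L := hcl.completeSpace_coe
    obtain ⟨c, hc⟩ := h L.starProjection (starProjection_commutes π L hL)
    have hcx : ∀ x, L.starProjection x = c • x := fun x => by rw [hc]; rfl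
    by_cases h0 : c = 0
    · left
      rw [Submodule.eq_bot_iff]
      intro x hx
      rw [← Submodule.starProjection_eq_self_iff.mpr hx, hcx, h0, zero_smul]
    · right
      rw [Submodule.eq_top_iff']
      intro x
      rw [← inv_smul_smul₀ h0 x, ← hcx]
      exact L.smul_mem _ (L.starProjection_apply_mem x)

end InvariantSubspace

/-! ### Irreducibility and equivalence of the representations `Φ(π, W)` -/

namespace GammaData

variable {G : Type v} [Group G] [Fintype G] {A : Type u} [NonUnitalCStarAlgebra A]
  {H₁ : Type w} [NormedAddCommGroup H₁] [InnerProductSpace ℂ H₁] [CompleteSpace H₁]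
  {K₁ : Type w} [NormedAddCommGroup K₁] [InnerProductSpace ℂ K₁] [FiniteDimensional ℂ K₁]
  {H₂ : Type w} [NormedAddCommGroup H₂] [InnerProductSpace ℂ H₂] [CompleteSpace H₂]
  {K₂ : Type w} [NormedAddCommGroup K₂] [InnerProductSpace ℂ K₂] [FiniteDimensional ℂ K₂]
  {σ : G →* (A ≃⋆ₐ[ℂ] A)}

/-- The matrix entry at `(1, s)` of an operator between induced spaces. -/
noncomputable def indBlock (x : GammaData σ H₁ K₁) (y : GammaData σ H₂ K₂)
    (Q : x.toCovariantRep.IndSpace →L[ℂ] y.toCovariantRep.IndSpace) (s : G) :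
    H₁ ⊗[ℂ] ConjSpace K₁ →L[ℂ] H₂ ⊗[ℂ] ConjSpace K₂ :=
  y.toCovariantRep.indEval 1 ∘L Q ∘L x.toCovariantRep.indIncl s

variable {x : GammaData σ H₁ K₁} {y : GammaData σ H₂ K₂}
  {Q : x.toCovariantRep.IndSpace →L[ℂ] y.toCovariantRep.IndSpace}

theorem indBlock_apply (s : G) (ξ : H₁ ⊗[ℂ] ConjSpace K₁) :
    indBlock x y Q s ξ = y.toCovariantRep.indEval 1 (Q (x.toCovariantRep.indIncl s ξ)) := rfl

/-- The embedding at the coset `G_π s` intertwines `s·(V ⊗ W̄)` with the restriction of the induced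
representation to `G_{π ∘ σ_s} = s⁻¹ G_π s`. -/
theorem indIncl_act_tensorU (s : G) (t : stabGroup σ (x.act s).π) (ξ : H₁ ⊗[ℂ] ConjSpace K₁) :
    x.toCovariantRep.indIncl s ((x.act s).tensorU t ξ) =
      x.toCovariantRep.ind.U t (x.toCovariantRep.indIncl s ξ) := by
  have h : (stabConj σ x.π s t : G) * (s * (t : G)⁻¹) = s := by simp [stabConj]
  have h1 := x.toCovariantRep.indIncl_mul (stabConj σ x.π s t) (s * (t : G)⁻¹) ξ
  rw [h] at h1
  rw [CovariantRep.ind_U_indIncl]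
  exact h1

theorem indIncl_act_ampl (s : G) (a : A) (ξ : H₁ ⊗[ℂ] ConjSpace K₁) :
    x.toCovariantRep.indIncl s ((x.act s).ampl a ξ) =
      x.toCovariantRep.ind.π a (x.toCovariantRep.indIncl s ξ) := by
  rw [CovariantRep.ind_π_indIncl]
  rfl

/-- If the entry at `(1, s)` of an intertwiner from `Φ(π₁, W₁)` to `Φ(π₂, W₂)` is nonzero, then
`(π₁ ∘ σ_s, s·W₁)` and `(π₂, W₂)` are equivalent. -/
theorem act_equivalent_of_indBlock_ne_zero
    (hQ : ∀ f ξ, Q (x.indRep f ξ) = y.indRep f (Q ξ)) {s : G} (hs : indBlock x y Q s ≠ 0) :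
    (x.act s).Equivalent y := by
  obtain ⟨hπ, hU⟩ := (CovariantRep.integrated_intertwiner_iff _ _ Q).mp hQ
  refine (equivalent_of_intertwiner hs (fun a ξ => ?_) fun t h₁ h₂ ξ => ?_).1
  · rw [indBlock_apply, indIncl_act_ampl, hπ, CovariantRep.indEval_π, CrossedProduct.aut_one]
    rfl
  · rw [indBlock_apply, indIncl_act_tensorU, hU, CovariantRep.indEval_U, one_mul]
    have h := y.toCovariantRep.indEval_mul ⟨t, h₂⟩ 1 (Q (x.toCovariantRep.indIncl s ξ))
    rw [mul_one] at h
    exact h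

/-- An intertwiner commutes with right translations, so it is determined by its entries at
`(1, s)`. -/
theorem exists_indBlock_ne_zero (hQ : ∀ f ξ, Q (x.indRep f ξ) = y.indRep f (Q ξ)) (hne : Q ≠ 0) :
    ∃ s, indBlock x y Q s ≠ 0 := by
  obtain ⟨-, hU⟩ := (CovariantRep.integrated_intertwiner_iff _ _ Q).mp hQ
  by_contra! h
  have h1 : ∀ ξ, y.toCovariantRep.indEval 1 (Q ξ) = 0 := fun ξ => by
    have h2 := congrArg (fun η => y.toCovariantRep.indEval 1 (Q η))
      (x.toCovariantRep.sum_indIncl_indEval ξ)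
    simp only [map_sum, map_smul, ← indBlock_apply, h, zero_apply, Finset.sum_const_zero] at h2
    exact (smul_eq_zero.mp h2.symm).resolve_left (Nat.cast_ne_zero.mpr Nat.card_pos.ne')
  refine hne (ContinuousLinearMap.ext fun ξ => y.toCovariantRep.indSpace_ext fun r => ?_)
  rw [zero_apply, map_zero, ← h1 (x.toCovariantRep.ind.U r ξ), hU, CovariantRep.indEval_U, one_mul]

/-- The representation `Φ(π, W)` is irreducible: an operator `Q` in its commutant is determined by
its entry at `(1, 1)`, which is a scalar. -/
theorem indRep_irreducible (x : GammaData σ H₁ K₁) : IsIrreducibleRep x.indRep := by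
  have hH := x.irred.nontrivial
  have hK : Nontrivial (ConjSpace K₁) := x.irredW.nontrivial
  obtain ⟨h₀, hh₀⟩ := exists_ne (0 : H₁)
  obtain ⟨k₀, hk₀⟩ := exists_ne (0 : ConjSpace K₁)
  -- the entry at `(1, s)` vanishes for `s ∉ G_π`, and is given by that at `(1, 1)` otherwise
  have key : ∀ Q : x.toCovariantRep.IndSpace →L[ℂ] x.toCovariantRep.IndSpace,
      (∀ f ξ, Q (x.indRep f ξ) = x.indRep f (Q ξ)) → indBlock x x Q 1 = 0 → Q = 0 := by
    intro Q hQ h1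
    by_contra hne
    obtain ⟨s, hs⟩ := exists_indBlock_ne_zero hQ hne
    obtain ⟨T, -, -, hT, -⟩ := act_equivalent_of_indBlock_ne_zero hQ hs
    have hsm : s ∈ stabGroup σ x.π := ⟨T.symm, hT.symm⟩
    refine hs (ContinuousLinearMap.ext fun ξ => ?_)
    obtain ⟨η, rfl⟩ := (x.tensorU ⟨s, hsm⟩).surjective ξ
    have h2 : x.toCovariantRep.indIncl s (x.tensorU ⟨s, hsm⟩ η) =
        x.toCovariantRep.indIncl 1 η := by
      have h3 := x.toCovariantRep.indIncl_mul ⟨s, hsm⟩ 1 η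
      rwa [mul_one] at h3
    rw [indBlock_apply, h2, ← indBlock_apply, h1, zero_apply, zero_apply]
  refine isIrreducibleRep_of_commutant x.toCovariantRep.ind.integrated_nondeg ?_ fun Q hQ => ?_
  · refine ⟨x.toCovariantRep.indIncl 1 (h₀ ⊗ₜ k₀), 0, fun h => ?_⟩
    have h1 := congrArg (x.toCovariantRep.indEval 1) h
    rw [CovariantRep.indEval_indIncl_self, map_zero] at h1
    exact hk₀ (tmul_eq_zero_of_ne_zero hh₀ h1)
  · obtain ⟨hπ, hU⟩ := (CovariantRep.integrated_intertwiner_iff _ _ Q).mp hQ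
    have hπ1 : ∀ a ξ, x.toCovariantRep.ind.π a (x.toCovariantRep.indIncl 1 ξ) =
        x.toCovariantRep.indIncl 1 (x.ampl a ξ) := fun a ξ => by
      rw [CovariantRep.ind_π_indIncl, CrossedProduct.aut_one]
      rfl
    have hU1 : ∀ (s : stabGroup σ x.π) ξ, x.toCovariantRep.ind.U s (x.toCovariantRep.indIncl 1 ξ) =
        x.toCovariantRep.indIncl 1 (x.tensorU s ξ) := fun s ξ => by
      rw [CovariantRep.ind_U_indIncl, one_mul, ← x.toCovariantRep.indIncl_mul s (s : G)⁻¹,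
        mul_inv_cancel]
      rfl
    obtain ⟨c, hc⟩ := eq_smul_of_commutes (x := x) (X := indBlock x x Q 1)
      (fun a ξ => by
        rw [indBlock_apply, ← hπ1, hπ, CovariantRep.indEval_π, CrossedProduct.aut_one]
        rfl)
      (fun s ξ => by
        rw [indBlock_apply, ← hU1, hU, CovariantRep.indEval_U, one_mul]
        have h := x.toCovariantRep.indEval_mul s 1 (Q (x.toCovariantRep.indIncl 1 ξ))
        rw [mul_one] at h
        exact h)
    refine ⟨c, sub_eq_zero.mp (key _ (fun f ξ => ?_) ?_)⟩
    · change Q (x.indRep f ξ) - c • x.indRep f ξ = x.indRep f (Q ξ - c • ξ)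
      rw [hQ, map_sub, map_smul]
    · refine ContinuousLinearMap.ext fun ξ => ?_
      have h := congrArg (fun X : H₁ ⊗[ℂ] ConjSpace K₁ →L[ℂ] H₁ ⊗[ℂ] ConjSpace K₁ => X ξ) hc
      beta_reduce at h
      rw [indBlock_apply] at h ⊢
      change x.toCovariantRep.indEval 1 (Q (x.toCovariantRep.indIncl 1 ξ) -
        c • x.toCovariantRep.indIncl 1 ξ) = 0
      rw [map_sub, h, map_smul, CovariantRep.indEval_indIncl_self]
      exact sub_self _

/-- Frobenius reciprocity for `Φ(π, W)`. -/
theorem indRep_unitarilyEquivalent {E : Type*} [NormedAddCommGroup E] [InnerProductSpace ℂ E]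
    [CompleteSpace E] (x : GammaData σ H₁ K₁) (τ : CovariantRep σ E)
    (hτ : IsIrreducibleRep τ.integrated) (J : H₁ ⊗[ℂ] ConjSpace K₁ →L[ℂ] E) (hne : J ≠ 0)
    (hJ : ∀ a ξ, J (x.ampl a ξ) = τ.π a (J ξ))
    (hU : ∀ (s : stabGroup σ x.π) ξ, J (x.tensorU s ξ) = τ.U s (J ξ)) :
    UnitarilyEquivalent x.indRep τ.integrated :=
  x.toCovariantRep.ind_unitarilyEquivalent x.indRep_irreducible τ hτ J hne hJ hU

/-- Frobenius reciprocity, applied to the embedding of `H ⊗ K̄` at the coset `G_π s`. -/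
theorem act_indRep_unitarilyEquivalent (x : GammaData σ H₁ K₁) (s : G) :
    UnitarilyEquivalent (x.act s).indRep x.indRep := by
  have hH := x.irred.nontrivial
  have hK : Nontrivial (ConjSpace K₁) := x.irredW.nontrivial
  obtain ⟨h₀, hh₀⟩ := exists_ne (0 : H₁)
  obtain ⟨k₀, hk₀⟩ := exists_ne (0 : ConjSpace K₁)
  refine (x.act s).indRep_unitarilyEquivalent x.toCovariantRep.ind x.indRep_irreducible
    (x.toCovariantRep.indIncl s) (fun h => ?_) (x.indIncl_act_ampl s) (x.indIncl_act_tensorU s)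
  have h1 := x.toCovariantRep.indEval_indIncl_self s (h₀ ⊗ₜ k₀)
  rw [h, zero_apply, map_zero] at h1
  exact hk₀ (tmul_eq_zero_of_ne_zero hh₀ h1.symm)

/-- Frobenius reciprocity, applied to `T ⊗ R̄` followed by the embedding at the coset of `1`. -/
theorem Equivalent.indRep_unitarilyEquivalent {x : GammaData σ H₁ K₁} {y : GammaData σ H₂ K₂}
    (h : x.Equivalent y) : UnitarilyEquivalent x.indRep y.indRep := by
  obtain ⟨T, R, c, hT, hV, hW⟩ := h
  have hH := x.irred.nontrivial
  have hK : Nontrivial (ConjSpace K₁) := x.irredW.nontrivial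
  obtain ⟨h₀, hh₀⟩ := exists_ne (0 : H₁)
  obtain ⟨k₀, hk₀⟩ := exists_ne (0 : ConjSpace K₁)
  let X := TensorProduct.congrIsometry T (ConjSpace.congr R)
  have hXt : ∀ h k, X (h ⊗ₜ k) = T h ⊗ₜ ConjSpace.congr R k := fun _ _ => rfl
  have hXπ : ∀ a ξ, X (x.ampl a ξ) = y.ampl a (X ξ) := fun a ξ => by
    induction ξ using TensorProduct.induction_on with
    | zero => simp only [map_zero]
    | tmul h k => rw [ampl_tmul, hXt, hXt, ampl_tmul, hT]
    | add y z hy hz => simp only [map_add, hy, hz]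
  have hXU : ∀ s (h₁ : s ∈ stabGroup σ x.π) (h₂ : s ∈ stabGroup σ y.π) ξ,
      X (x.tensorU ⟨s, h₁⟩ ξ) = y.tensorU ⟨s, h₂⟩ (X ξ) := fun s h₁ h₂ ξ => by
    induction ξ using TensorProduct.induction_on with
    | zero => simp only [map_zero]
    | tmul h k =>
      have hW' : ConjSpace.congr R (ConjSpace.conj (x.W ⟨s, h₁⟩) k) =
          star (c s : ℂ) • ConjSpace.conj (y.W ⟨s, h₂⟩) (ConjSpace.congr R k) :=
        (congrArg ConjSpace.of (hW s h₁ h₂ (ConjSpace.of.symm k))).trans (ConjSpace.of_smul _ _)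
      rw [tensorU_tmul, hXt, hXt, tensorU_tmul, hV s h₁ h₂, hW', TensorProduct.smul_tmul,
        smul_smul, circle_mul_star, one_smul]
    | add y z hy hz => simp only [map_add, hy, hz]
  refine x.indRep_unitarilyEquivalent y.toCovariantRep.ind y.indRep_irreducible
    (y.toCovariantRep.indIncl 1 ∘L X.toContinuousLinearEquiv.toContinuousLinearMap)
    (fun h => ?_) (fun a ξ => ?_) fun s ξ => ?_
  · have h1 := y.toCovariantRep.indEval_indIncl_self 1 (X (h₀ ⊗ₜ k₀))
    have h2 : y.toCovariantRep.indIncl 1 (X (h₀ ⊗ₜ k₀)) = 0 :=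
      congrArg (fun J : H₁ ⊗[ℂ] ConjSpace K₁ →L[ℂ] y.toCovariantRep.IndSpace => J (h₀ ⊗ₜ k₀)) h
    rw [h2, map_zero] at h1
    exact hk₀ (tmul_eq_zero_of_ne_zero hh₀ ((X.map_eq_zero_iff).mp h1.symm))
  · change y.toCovariantRep.indIncl 1 (X (x.ampl a ξ)) =
      y.toCovariantRep.ind.π a (y.toCovariantRep.indIncl 1 (X ξ))
    rw [hXπ, CovariantRep.ind_π_indIncl, CrossedProduct.aut_one]
    rfl
  · change y.toCovariantRep.indIncl 1 (X (x.tensorU s ξ)) =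
      y.toCovariantRep.ind.U s (y.toCovariantRep.indIncl 1 (X ξ))
    have hs := mem_stabGroup_congr σ hT s.2
    rw [hXU s s.2 hs, CovariantRep.ind_U_indIncl, one_mul,
      ← y.toCovariantRep.indIncl_mul ⟨s, hs⟩ (s : G)⁻¹, mul_inv_cancel]
    rfl

/-- Two of the induced representations are equivalent only if the pairs lie in the same orbit. -/
theorem exists_act_equivalent (h : UnitarilyEquivalent x.indRep y.indRep) :
    ∃ s, (x.act s).Equivalent y := by
  obtain ⟨T, hT⟩ := h
  have := x.indRep_irreducible.nontrivial
  obtain ⟨ξ, hξ⟩ := exists_ne (0 : x.toCovariantRep.IndSpace)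
  obtain ⟨s, hs⟩ := exists_indBlock_ne_zero (x := x) (y := y)
    (Q := T.toContinuousLinearEquiv.toContinuousLinearMap) hT fun h0 => hξ <| by
      rw [← T.map_eq_zero_iff]
      exact congrArg (fun J : x.toCovariantRep.IndSpace →L[ℂ] y.toCovariantRep.IndSpace => J ξ) h0
  exact ⟨s, act_equivalent_of_indBlock_ne_zero
    (Q := T.toContinuousLinearEquiv.toContinuousLinearMap) hT hs⟩

end GammaData

/-! ### Irreducible representations of the crossed product are covariant representations -/

namespace CrossedProduct

variable {G : Type v} [Group G] {A : Type u} [NonUnitalCStarAlgebra A]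
  {σ : G →* (A ≃⋆ₐ[ℂ] A)}

theorem sum_apply {ι : Type*} (I : Finset ι) (f : ι → CrossedProduct σ) (s : G) :
    (∑ i ∈ I, f i) s = ∑ i ∈ I, f i s := by
  classical
  induction I using Finset.induction_on with
  | empty => rfl
  | insert i I hi h => rw [Finset.sum_insert hi, Finset.sum_insert hi, ← h, add_apply]

/-- Left multiplication by the unitary multiplier `δ_s` of the crossed product:
`(δ_s f)(t) = σ_s(f(s⁻¹ t))`. -/
def translate (s : G) : CrossedProduct σ ≃ₗ[ℂ] CrossedProduct σ where
  toFun f := fun t => σ s (f (s⁻¹ * t))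
  invFun f := fun t => σ s⁻¹ (f (s * t))
  left_inv f := by
    ext t
    change σ s⁻¹ (σ s (f (s⁻¹ * (s * t)))) = f t
    rw [aut_inv_cancel, inv_mul_cancel_left]
  right_inv f := by
    ext t
    change σ s (σ s⁻¹ (f (s * (s⁻¹ * t)))) = f t
    rw [aut_cancel_inv, mul_inv_cancel_left]
  map_add' f g := by
    ext t
    exact map_add (σ s) _ _
  map_smul' c f := by
    ext t
    exact map_smul (σ s) c _

theorem translate_apply (s : G) (f : CrossedProduct σ) (t : G) :
    translate s f t = σ s (f (s⁻¹ * t)) := rfl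

theorem translate_translate (s t : G) (f : CrossedProduct σ) :
    translate s (translate t f) = translate (s * t) f := by
  ext r
  rw [translate_apply, translate_apply, translate_apply, aut_mul, mul_inv_rev, mul_assoc]

variable [Fintype G]

theorem star_translate_mul_translate (s : G) (f g : CrossedProduct σ) :
    star (translate s f) * translate s g = star f * g := by
  ext r
  rw [mul_apply, mul_apply]
  refine Fintype.sum_equiv (Equiv.mulRight s) _ _ fun t => ?_
  rw [star_apply, star_apply, translate_apply, translate_apply, Equiv.coe_mulRight, ← map_star,
    ← aut_mul, ← aut_mul, mul_inv_rev]
  simp only [mul_assoc]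

theorem single_one_mul (a : A) (f : CrossedProduct σ) (s : G) :
    ((single 1 a : CrossedProduct σ) * f) s = a * f s := by
  classical
  rw [mul_apply, Finset.sum_eq_single 1]
  · rw [single_eq_same, aut_one, inv_one, one_mul]
  · intro t _ ht
    rw [single_apply, if_neg ht, zero_mul]
  · simp

theorem single_mul_translate (s : G) (a : A) (f : CrossedProduct σ) :
    single 1 (σ s a) * translate s f = translate s (single 1 a * f) := by
  ext r
  rw [single_one_mul, translate_apply, translate_apply, single_one_mul, map_mul]

theorem sum_single_mul_translate (f g : CrossedProduct σ) :
    ∑ s, single 1 (f s) * translate s g = f * g := by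
  ext r
  rw [sum_apply, mul_apply]
  refine Finset.sum_congr rfl fun s _ => ?_
  rw [single_one_mul, translate_apply]

/-- The embedding `a ↦ a δ_1` of `A` into the crossed product. -/
noncomputable def incl (σ : G →* (A ≃⋆ₐ[ℂ] A)) : A →⋆ₙₐ[ℂ] CrossedProduct σ where
  toFun a := single 1 a
  map_smul' c a := by
    classical
    ext s
    rw [smul_apply, single_apply, MonoidHom.id_apply, single_apply, smul_ite, smul_zero]
  map_zero' := by
    classical
    ext s
    rw [single_apply, zero_apply, ite_self]
  map_add' a b := by
    classical
    ext s
    rw [add_apply, single_apply, single_apply, single_apply]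
    split_ifs <;> simp
  map_mul' a b := by
    classical
    ext s
    rw [single_one_mul, single_apply, single_apply, mul_ite, mul_zero]
  map_star' a := by
    classical
    ext s
    rw [star_apply, single_apply, single_apply]
    by_cases hs : s = 1
    · rw [if_pos hs, hs, inv_one, if_pos rfl, aut_one]
    · rw [if_neg hs, if_neg (by simpa using hs), star_zero, map_zero]

end CrossedProduct

/-- Every nonzero vector is cyclic for an irreducible representation. -/
theorem IsIrreducibleRep.denseRange {B : Type u} [NonUnitalCStarAlgebra B]
    {H : Type*} [NormedAddCommGroup H] [InnerProductSpace ℂ H] [CompleteSpace H]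
    {π : B →⋆ₙₐ[ℂ] (H →L[ℂ] H)} (h : IsIrreducibleRep π) {x : H} (hx : x ≠ 0) :
    DenseRange fun b => π b x := by
  let e : B →ₗ[ℂ] H :=
    { toFun := fun b => π b x
      map_add' := fun a b => by rw [map_add]; rfl
      map_smul' := fun c b => by rw [map_smul]; rfl }
  have hinv : ∀ b, ∀ y ∈ (LinearMap.range e).topologicalClosure,
      π b y ∈ (LinearMap.range e).topologicalClosure := fun b y hy => by
    refine map_mem_closure (π b).continuous hy ?_
    rintro _ ⟨a, rfl⟩
    refine ⟨b * a, ?_⟩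
    change π (b * a) x = π b (π a x)
    rw [map_mul]
    rfl
  rcases h.eq_bot_or_top _ (Submodule.isClosed_topologicalClosure _) hinv with h0 | h1
  · refine absurd ((isNondegenerate_iff π).mp h.nondeg x fun b => ?_) hx
    rw [← Submodule.mem_bot ℂ, ← h0]
    exact Submodule.le_topologicalClosure _ ⟨b, rfl⟩
  · rw [← Submodule.dense_iff_topologicalClosure_eq_top] at h1
    exact h1

namespace CovariantRep

variable {G : Type v} [Group G] [Fintype G] {A : Type u} [NonUnitalCStarAlgebra A]
  {σ : G →* (A ≃⋆ₐ[ℂ] A)}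
  {E : Type w} [NormedAddCommGroup E] [InnerProductSpace ℂ E] [CompleteSpace E]

/-- An irreducible representation `ρ` of the crossed product is the integrated form of a covariant
representation; the unitaries are given by `U(s) ρ(f) x = ρ(δ_s f) x` for a cyclic vector `x`. -/
theorem exists_integrated_eq (ρ : CrossedProduct σ →⋆ₙₐ[ℂ] (E →L[ℂ] E)) (hρ : IsIrreducibleRep ρ) :
    ∃ τ : CovariantRep σ E, τ.integrated = ρ := by
  have := hρ.nontrivial
  obtain ⟨x, hx⟩ := exists_ne (0 : E)
  let e : CrossedProduct σ →ₗ[ℂ] E :=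
    { toFun := fun f => ρ f x
      map_add' := fun a b => by rw [map_add]; rfl
      map_smul' := fun c b => by rw [map_smul]; rfl }
  have he : DenseRange e := hρ.denseRange hx
  have hemul : ∀ f g, ρ f (e g) = e (f * g) := fun f g => by
    change ρ f (ρ g x) = ρ (f * g) x
    rw [map_mul]
    rfl
  have hnorm : ∀ s f, ‖e (CrossedProduct.translate s f)‖ = ‖e f‖ := fun s f => by
    have h1 : ∀ g, inner ℂ (e g) (e g) = inner ℂ x (ρ (star g * g) x) := fun g => by
      change inner ℂ (ρ g x) (ρ g x) = _
      rw [map_mul, map_star, ContinuousLinearMap.star_eq_adjoint,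
        ← ContinuousLinearMap.adjoint_inner_right]
      rfl
    rw [norm_eq_sqrt_re_inner (𝕜 := ℂ), norm_eq_sqrt_re_inner (𝕜 := ℂ), h1, h1,
      CrossedProduct.star_translate_mul_translate]
  let U : G → (E ≃ₗᵢ[ℂ] E) := fun s =>
    (CrossedProduct.translate (σ := σ) s).extendOfIsometry e e he he (hnorm s)
  have hU : ∀ s f, U s (e f) = e (CrossedProduct.translate s f) := fun s f =>
    LinearEquiv.extendOfIsometry_eq (CrossedProduct.translate s) e e he he (hnorm s) f
  have hcov : ∀ s a y, U s (ρ (CrossedProduct.single 1 a) y) =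
      ρ (CrossedProduct.single 1 (σ s a)) (U s y) := fun s a y => by
    refine congrFun (he.equalizer (g := fun y => U s (ρ (CrossedProduct.single 1 a) y))
      (h := fun y => ρ (CrossedProduct.single 1 (σ s a)) (U s y))
      ((U s).continuous.comp (ρ _).continuous) ((ρ _).continuous.comp (U s).continuous)
      (funext fun f => ?_)) y
    change U s (ρ (CrossedProduct.single 1 a) (e f)) =
      ρ (CrossedProduct.single 1 (σ s a)) (U s (e f))
    rw [hemul, hU, hU, hemul, CrossedProduct.single_mul_translate]
  have hsum : ∀ f y, ∑ s, ρ (CrossedProduct.single 1 (f s)) (U s y) = ρ f y := fun f y => by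
    refine congrFun (he.equalizer (g := fun y => ∑ s, ρ (CrossedProduct.single 1 (f s)) (U s y))
      (continuous_finsetSum _ fun s _ => (ρ _).continuous.comp (U s).continuous)
      (ρ f).continuous (funext fun g => ?_)) y
    change ∑ s, ρ (CrossedProduct.single 1 (f s)) (U s (e g)) = ρ f (e g)
    rw [hemul, ← CrossedProduct.sum_single_mul_translate, map_sum]
    exact Finset.sum_congr rfl fun s _ => by rw [hU, hemul]
  let τ : CovariantRep σ E :=
    { π := ρ.comp (CrossedProduct.incl σ)
      nondeg := by
        rw [isNondegenerate_iff]
        intro y hy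
        refine (isNondegenerate_iff ρ).mp hρ.nondeg y fun f => ?_
        rw [← hsum]
        refine Finset.sum_eq_zero fun s _ => ?_
        rw [← CrossedProduct.aut_cancel_inv σ s (f s), ← hcov]
        exact (congrArg (U s) (hy (σ s⁻¹ (f s)))).trans (map_zero _)
      U := MonoidHom.mk' U fun s t => LinearIsometryEquiv.ext fun y => by
        refine congrFun (he.equalizer (U (s * t)).continuous (U s * U t).continuous
          (funext fun f => ?_)) y
        change U (s * t) (e f) = U s (U t (e f))
        rw [hU, hU, hU, CrossedProduct.translate_translate]
      covariant := hcov }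
  refine ⟨τ, NonUnitalStarAlgHom.ext fun f => ContinuousLinearMap.ext fun y => ?_⟩
  rw [integrated_apply]
  exact hsum f y

/-! ### Irreducible subrepresentations of the restriction to the algebra -/

/-- For an irreducible covariant representation and the projection `P` onto an `A`-invariant
subspace, the operator `∑ s, U(s)⁻¹ P U(s)` commutes with everything, so it is a scalar; its
quadratic form is `x ↦ ∑ s, ‖P U(s) x‖²`. -/
theorem exists_weight (τ : CovariantRep σ E) (hτ : IsIrreducibleRep τ.integrated)
    (L : Submodule ℂ E) [L.HasOrthogonalProjection] (hL : ∀ a, ∀ x ∈ L, τ.π a x ∈ L) :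
    ∃ r : ℝ, ∀ x, ∑ s, ‖L.starProjection (τ.U s x)‖ ^ 2 = r * ‖x‖ ^ 2 := by
  let D : E →L[ℂ] E := ∑ s : G, (τ.U s⁻¹).toContinuousLinearEquiv.toContinuousLinearMap ∘L
    L.starProjection ∘L (τ.U s).toContinuousLinearEquiv.toContinuousLinearMap
  have hD : ∀ x, D x = ∑ s, τ.U s⁻¹ (L.starProjection (τ.U s x)) := fun x => sum_apply' _ _ _
  obtain ⟨c, hc⟩ := hτ.eq_smul D <| by
    refine (integrated_intertwiner_iff τ τ D).mpr ⟨fun a x => ?_, fun t x => ?_⟩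
    · rw [hD, hD, map_sum]
      refine Finset.sum_congr rfl fun s _ => ?_
      rw [τ.covariant, starProjection_commutes τ.π L hL, τ.covariant,
        CrossedProduct.aut_inv_cancel]
    · rw [hD, hD, map_sum]
      refine Fintype.sum_equiv (Equiv.mulRight t) _ _ fun s => ?_
      rw [Equiv.coe_mulRight, ← unitary_mul_apply (τ.U t), ← map_mul, mul_inv_rev,
        mul_inv_cancel_left, map_mul, unitary_mul_apply]
  refine ⟨c.re, fun x => ?_⟩
  have h : inner ℂ x (D x) = ((∑ s, ‖L.starProjection (τ.U s x)‖ ^ 2 : ℝ) : ℂ) := by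
    rw [hD, inner_sum, Complex.ofReal_sum]
    refine Finset.sum_congr rfl fun s _ => ?_
    rw [← (τ.U s).inner_map_map, ← unitary_mul_apply (τ.U s) (τ.U s⁻¹), ← map_mul, mul_inv_cancel,
      map_one]
    change inner ℂ (τ.U s x) (L.starProjection (τ.U s x)) = _
    have hp : ∀ y, inner ℂ y (L.starProjection y) =
        inner ℂ (L.starProjection y) (L.starProjection y) := fun y => by
      rw [L.inner_starProjection_left_eq_right,
        Submodule.starProjection_eq_self_iff.mpr (L.starProjection_apply_mem y)]
    rw [hp, inner_self_eq_norm_sq_to_K]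
    norm_cast
  rw [hc, inner_smul_right, inner_self_eq_norm_sq_to_K] at h
  have h' := congrArg Complex.re h
  norm_cast at h'
  rw [← h']
  exact Complex.re_mul_ofReal c (‖x‖ ^ 2)

/-- The restriction to `A` of an irreducible covariant representation has a minimal closed invariant
subspace. The weight `∑ s, ‖P U(s) x‖²` of the projection `P` onto a nonzero invariant subspace,
where `x` is any unit vector, is at least `1`, and weights of orthogonal subspaces add up; so a
subspace whose weight is less than `1` above the infimum is minimal. -/
theorem exists_minimal_invariant (τ : CovariantRep σ E) (hτ : IsIrreducibleRep τ.integrated) :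
    ∃ L : Submodule ℂ E, IsClosed (L : Set E) ∧ (∀ a, ∀ x ∈ L, τ.π a x ∈ L) ∧ L ≠ ⊥ ∧
      ∀ L' ≤ L, IsClosed (L' : Set E) → (∀ a, ∀ x ∈ L', τ.π a x ∈ L') → L' = ⊥ ∨ L' = L := by
  have := hτ.nontrivial
  obtain ⟨x₀, hx₀⟩ := exists_norm_eq E (zero_le_one)
  let Inv : Submodule ℂ E → Prop := fun L =>
    IsClosed (L : Set E) ∧ (∀ a, ∀ x ∈ L, τ.π a x ∈ L) ∧ L ≠ ⊥
  let wt : Submodule ℂ E → ℝ → Prop := fun L r => ∃ _ : L.HasOrthogonalProjection,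
    ∀ x, ∑ s, ‖L.starProjection (τ.U s x)‖ ^ 2 = r * ‖x‖ ^ 2
  have hproj : ∀ L : Submodule ℂ E, IsClosed (L : Set E) → L.HasOrthogonalProjection :=
    fun L hL => by
      have : CompleteSpace L := hL.completeSpace_coe
      infer_instance
  have hwt : ∀ L, Inv L → ∃ r, wt L r := fun L hL => by
    have := hproj L hL.1
    obtain ⟨r, hr⟩ := τ.exists_weight hτ L hL.2.1
    exact ⟨r, this, hr⟩
  have hone : ∀ L r, Inv L → wt L r → 1 ≤ r := by
    rintro L r ⟨-, -, hne⟩ ⟨_, hr⟩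
    obtain ⟨y, hy, hy0⟩ := Submodule.exists_mem_ne_zero_of_ne_bot hne
    have h1 : ‖y‖ ^ 2 ≤ r * ‖y‖ ^ 2 := by
      rw [← hr y]
      refine le_trans (le_of_eq ?_) (Finset.single_le_sum
        (f := fun s => ‖L.starProjection (τ.U s y)‖ ^ 2) (fun s _ => sq_nonneg _)
        (Finset.mem_univ 1))
      rw [map_one]
      change _ = ‖L.starProjection y‖ ^ 2
      rw [Submodule.starProjection_eq_self_iff.mpr hy]
    have h2 : 0 < ‖y‖ ^ 2 := by positivity
    nlinarith
  let R : Set ℝ := {r | ∃ L, Inv L ∧ wt L r}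
  have hR : R.Nonempty := by
    have htop : Inv ⊤ := ⟨isClosed_univ, fun _ _ _ => Submodule.mem_top, top_ne_bot⟩
    obtain ⟨r, hr⟩ := hwt ⊤ htop
    exact ⟨r, ⊤, htop, hr⟩
  have hRb : BddBelow R := ⟨1, by rintro r ⟨L, hL, hr⟩; exact hone L r hL hr⟩
  obtain ⟨r, ⟨L, hL, hp, hr⟩, hlt⟩ := Real.lt_sInf_add_pos hR zero_lt_one
  refine ⟨L, hL.1, hL.2.1, hL.2.2, fun L' hle hcl' hinv' => ?_⟩
  by_contra! hcon
  have hL' : Inv L' := ⟨hcl', hinv', hcon.1⟩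
  have hp' := hproj L' hcl'
  -- the orthogonal complement of `L'` in `L`
  let M : Submodule ℂ E := L'ᗮ ⊓ L
  have hM : Inv M := by
    refine ⟨(Submodule.isClosed_orthogonal L').inter hL.1, fun a x hx => ?_, fun h0 => ?_⟩
    · exact ⟨orthogonal_invariant τ.π hinv' a hx.1, hL.2.1 a x hx.2⟩
    · have h1 := Submodule.sup_orthogonal_inf_of_hasOrthogonalProjection hle
      change L' ⊔ M = L at h1
      rw [h0, sup_bot_eq] at h1
      exact hcon.2 h1
  have hpM := hproj M hM.1
  have hadd : ∀ x, ‖L.starProjection x‖ ^ 2 =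
      ‖L'.starProjection x‖ ^ 2 + ‖M.starProjection x‖ ^ 2 := fun x => by
    have h1 : L'.starProjection (L.starProjection x) = L'.starProjection x := by
      refine (Submodule.eq_starProjection_of_mem_orthogonal (L'.starProjection_apply_mem _) ?_).symm
      have h2 : x - L'.starProjection (L.starProjection x) = (x - L.starProjection x) +
        (L.starProjection x - L'.starProjection (L.starProjection x)) := by abel
      rw [h2]
      exact add_mem (Submodule.orthogonal_le hle (L.sub_starProjection_mem_orthogonal x))
        (L'.sub_starProjection_mem_orthogonal _)
    have h3 : M.starProjection x = L.starProjection x - L'.starProjection x := by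
      refine Submodule.eq_starProjection_of_mem_orthogonal ⟨?_, ?_⟩ ?_
      · rw [← h1]
        exact L'.sub_starProjection_mem_orthogonal _
      · exact sub_mem (L.starProjection_apply_mem x) (hle (L'.starProjection_apply_mem x))
      · have h2 : x - (L.starProjection x - L'.starProjection x) =
          (x - L.starProjection x) + L'.starProjection x := by abel
        rw [h2]
        refine add_mem (Submodule.orthogonal_le inf_le_right
          (L.sub_starProjection_mem_orthogonal x)) (Submodule.orthogonal_le inf_le_left ?_)
        exact Submodule.le_orthogonal_orthogonal L' (L'.starProjection_apply_mem x)
    have h4 : inner ℂ (L'.starProjection x) (M.starProjection x) = 0 :=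
      (M.starProjection_apply_mem x).1 _ (L'.starProjection_apply_mem x)
    have h5 := norm_add_sq_eq_norm_sq_add_norm_sq_of_inner_eq_zero _ _ h4
    rw [h3, add_sub_cancel] at h5
    rw [h3, sq, sq, sq]
    exact h5
  obtain ⟨r', _, hr'⟩ := hwt L' hL'
  obtain ⟨q, _, hq⟩ := hwt M hM
  have hsum : r = r' + q := by
    have h1 := hr x₀
    rw [Finset.sum_congr rfl fun s _ => hadd (τ.U s x₀), Finset.sum_add_distrib, hr', hq, hx₀] at h1
    linarith
  have h1 := hone M q hM ⟨hpM, hq⟩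
  have h2 := csInf_le hRb ⟨L', hL', hp', hr'⟩
  linarith

end CovariantRep

/-! ### Restriction to an invariant subspace -/

section Subrep

variable {B : Type u} [NonUnitalCStarAlgebra B]
  {H : Type w} [NormedAddCommGroup H] [InnerProductSpace ℂ H] [CompleteSpace H]

/-- The restriction of a representation to a closed invariant subspace. -/
noncomputable def subrep (π : B →⋆ₙₐ[ℂ] (H →L[ℂ] H)) (L : Submodule ℂ H) [CompleteSpace L]
    (hL : ∀ b, ∀ x ∈ L, π b x ∈ L) : B →⋆ₙₐ[ℂ] (L →L[ℂ] L) where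
  toFun b := (π b ∘L L.subtypeL).codRestrict L fun x => hL b x x.2
  map_smul' c b := by
    ext x
    change π (c • b) x = c • π b x
    rw [map_smul]
    rfl
  map_zero' := by
    ext x
    change π 0 x = 0
    rw [map_zero]
    rfl
  map_add' a b := by
    ext x
    change π (a + b) x = π a x + π b x
    rw [map_add]
    rfl
  map_mul' a b := by
    ext x
    change π (a * b) x = π a (π b x)
    rw [map_mul]
    rfl
  map_star' b := by
    rw [ContinuousLinearMap.star_eq_adjoint, ContinuousLinearMap.eq_adjoint_iff]
    intro x y
    change inner ℂ (π (star b) x) (y : H) = inner ℂ (x : H) (π b y)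
    rw [map_star, ContinuousLinearMap.star_eq_adjoint, ContinuousLinearMap.adjoint_inner_left]

/-- The restriction to a minimal closed invariant subspace is irreducible. -/
theorem subrep_irreducible {π : B →⋆ₙₐ[ℂ] (H →L[ℂ] H)} (hn : IsNondegenerate π)
    (L : Submodule ℂ H) [CompleteSpace L] (hL : ∀ b, ∀ x ∈ L, π b x ∈ L) (hne : L ≠ ⊥)
    (hmin : ∀ L' ≤ L, IsClosed (L' : Set H) → (∀ b, ∀ x ∈ L', π b x ∈ L') → L' = ⊥ ∨ L' = L) :
    IsIrreducibleRep (subrep π L hL) where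
  nondeg := by
    rw [isNondegenerate_iff]
    intro x hx
    exact Subtype.ext ((isNondegenerate_iff π).mp hn x fun b => congrArg Subtype.val (hx b))
  nontrivial := (Submodule.nontrivial_iff_ne_bot).mpr hne
  eq_bot_or_top N hcl hN := by
    have hemb : Topology.IsClosedEmbedding (Subtype.val : L → H) :=
      (completeSpace_coe_iff_isComplete.mp ‹CompleteSpace L›).isClosed.isClosedEmbedding_subtypeVal
    rcases hmin (N.map L.subtype) (Submodule.map_subtype_le L N) (hemb.isClosedMap _ hcl) (by
      rintro b _ ⟨x, hx, rfl⟩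
      exact ⟨subrep π L hL b x, hN b x hx, rfl⟩) with h | h
    · left
      exact Submodule.map_injective_of_injective L.injective_subtype
        (h.trans (Submodule.map_bot _).symm)
    · right
      rw [Submodule.eq_top_iff']
      intro x
      have hx : (x : H) ∈ N.map L.subtype := by rw [h]; exact x.2
      obtain ⟨y, hy, hyx⟩ := hx
      rwa [← Subtype.ext hyx]

end Subrep

/-! ### Implementing unitaries and their multipliers -/

section Implementing

variable {G : Type v} [Group G] {A : Type u} [NonUnitalCStarAlgebra A] {σ : G →* (A ≃⋆ₐ[ℂ] A)}
  {H : Type w} [NormedAddCommGroup H] [InnerProductSpace ℂ H] [CompleteSpace H]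

theorem exists_implements (σ : G →* (A ≃⋆ₐ[ℂ] A)) (π : A →⋆ₙₐ[ℂ] (H →L[ℂ] H)) :
    ∃ V : stabGroup σ π → (H ≃ₗᵢ[ℂ] H), Implements σ π V := by
  choose V hV using fun s : stabGroup σ π => (mem_stabGroup_iff σ π s).mp s.2
  exact ⟨V, hV⟩

/-- The multiplier of a family of unitaries on a nonzero space is unique. -/
theorem HasMultiplier.unique {S : Type*} [Group S] {K : Type*} [NormedAddCommGroup K]
    [InnerProductSpace ℂ K] [Nontrivial K] {V : S → (K ≃ₗᵢ[ℂ] K)} {ω ω' : S → S → Circle}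
    (h : HasMultiplier V ω) (h' : HasMultiplier V ω') : ω = ω' := by
  obtain ⟨x, hx⟩ := exists_ne (0 : K)
  funext s t
  have h1 := (h s t x).symm.trans (h' s t x)
  have h2 : V (s * t) x ≠ 0 := by rwa [ne_eq, LinearIsometryEquiv.map_eq_zero_iff]
  exact Circle.coe_injective (smul_left_injective ℂ h2 h1)

theorem Implements.existsUnique_multiplier {π : A →⋆ₙₐ[ℂ] (H →L[ℂ] H)} (hπ : IsIrreducibleRep π)
    {V : stabGroup σ π → (H ≃ₗᵢ[ℂ] H)} (hV : Implements σ π V) : ∃! ω, HasMultiplier V ω := by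
  have := hπ.nontrivial
  have h : ∀ s t, ∃ c : Circle, ∀ x, V s (V t x) = (c : ℂ) • V (s * t) x := fun s t => by
    have h₁ : Intertwines π (compAut π (σ (s * t : stabGroup σ π))) (V (s * t)) := fun a x =>
      hV (s * t) a x
    have h₂ : Intertwines π (compAut π (σ (s * t : stabGroup σ π))) ((V t).trans (V s)) :=
      fun a x => by
        rw [LinearIsometryEquiv.trans_apply, hV, hV, ← CrossedProduct.aut_mul]
        rfl
    exact hπ.exists_eq_circle_smul h₁ h₂
  choose ω hω using h
  exact ⟨ω, hω, fun ω' h' => HasMultiplier.unique h' hω⟩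

end Implementing

/-! ### Every irreducible covariant representation is induced -/

/-- The invariant subspaces of the conjugate representation are those of `W`. -/
theorem IsIrreducibleProj.conj {S : Type*} [Group S] {N : Type*} [NormedAddCommGroup N]
    [InnerProductSpace ℂ N] {W : S → (N ≃ₗᵢ[ℂ] N)} (h : IsIrreducibleProj W) :
    IsIrreducibleProj fun s => ConjSpace.conj (W s) where
  nontrivial := h.nontrivial
  eq_bot_or_top L hcl hL := by
    let L' : Submodule ℂ N :=
      { carrier := {x | ConjSpace.of x ∈ L}
        add_mem' := fun hx hy => L.add_mem hx hy
        zero_mem' := L.zero_mem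
        smul_mem' := fun c x hx => by
          change ConjSpace.of (c • x) ∈ L
          rw [ConjSpace.of_smul]
          exact L.smul_mem _ hx }
    rcases h.eq_bot_or_top L' hcl (fun s x hx => hL s _ hx) with h0 | h0
    · left
      rw [Submodule.eq_bot_iff] at h0 ⊢
      exact h0
    · right
      rw [Submodule.eq_top_iff'] at h0 ⊢
      exact h0

namespace CovariantRep

variable {G : Type v} [Group G] [Fintype G] {A : Type u} [NonUnitalCStarAlgebra A]
  {σ : G →* (A ≃⋆ₐ[ℂ] A)}
  {H : Type w} [NormedAddCommGroup H] [InnerProductSpace ℂ H] [CompleteSpace H]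
  {E : Type w} [NormedAddCommGroup E] [InnerProductSpace ℂ E] [CompleteSpace E]

/-- If `N` is an irreducible projective representation of `G_π` on a space of intertwiners
`D k : H → E`, where `G_π` acts by `T ↦ U(s) T V(s)⁻¹`, then the irreducible covariant
representation on `E` is equivalent to `Φ(π, N̄)`, by Frobenius reciprocity for the operator
`h ⊗ k ↦ (D k) h`. -/
theorem exists_equiv_of_action (τ : CovariantRep σ E) (hτ : IsIrreducibleRep τ.integrated)
    {π : A →⋆ₙₐ[ℂ] (H →L[ℂ] H)} (hπ : IsIrreducibleRep π) {V : stabGroup σ π → (H ≃ₗᵢ[ℂ] H)}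
    (hV : Implements σ π V) {ω : stabGroup σ π → stabGroup σ π → Circle} (hω : HasMultiplier V ω)
    (N : Type w) [NormedAddCommGroup N] [InnerProductSpace ℂ N] [FiniteDimensional ℂ N]
    (D : N →ₗ[ℂ] (H →L[ℂ] E)) (hD : Function.Injective D)
    (hDπ : ∀ k a h, D k (π a h) = τ.π a (D k h)) (W : stabGroup σ π → (N ≃ₗᵢ[ℂ] N))
    (hW : ∀ s k h, D (W s k) (V s h) = τ.U s (D k h)) (hirr : IsIrreducibleProj W) :
    ∃ (K : FinHilbSpace.{w}) (x : GammaData σ H K),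
      UnitarilyEquivalent x.indRep τ.integrated := by
  have hN := hirr.nontrivial
  have hcc : ∀ s t, star (ω s t : ℂ) * (ω s t : ℂ) = 1 := fun s t => by
    rw [mul_comm, circle_mul_star]
  have hmult : ∀ s t k, W s (W t k) = star (ω s t : ℂ) • W (s * t) k := fun s t k => by
    have h1 : (ω s t : ℂ) • W s (W t k) = W (s * t) k := by
      apply hD
      ext h
      obtain ⟨h, rfl⟩ := (V (s * t)).surjective h
      rw [hW, map_smul]
      change (ω s t : ℂ) • (D (W s (W t k))) (V (s * t) h) = _
      rw [← map_smul, ← hω, hW, hW]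
      change _ = τ.U (s * t) _
      rw [map_mul, unitary_mul_apply]
    rw [← h1, smul_smul, hcc, one_smul]
  have hmult' : HasMultiplier (fun s => ConjSpace.conj (W s)) ω := fun s t k => by
    change ConjSpace.of (W s (W t (ConjSpace.of.symm k))) = _
    rw [hmult, ConjSpace.of_smul, star_star]
    rfl
  let x : GammaData σ H (ConjSpace N) := GammaData.mk π hπ V hV ω hω _ hmult' hirr.conj
  refine ⟨⟨ConjSpace N⟩, x, ?_⟩
  -- the double conjugate of `N` is `N`
  let D' : ConjSpace (ConjSpace N) →ₗ[ℂ] (H →L[ℂ] E) :=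
    { toFun := fun k => D (ConjSpace.of.symm (ConjSpace.of.symm k))
      map_add' := fun k l => by rw [map_add, map_add, map_add]
      map_smul' := fun c k => by
        rw [ConjSpace.symm_smul, ConjSpace.symm_smul, star_star, map_smul, RingHom.id_apply] }
  let b := stdOrthonormalBasis ℂ (ConjSpace (ConjSpace N))
  let J : H ⊗[ℂ] ConjSpace (ConjSpace N) →L[ℂ] E := ∑ i, D' (b i) ∘L tensorSlice H (b i)
  have hJ : ∀ h k, J (h ⊗ₜ k) = D' k h := fun h k => by
    conv_rhs => rw [← b.sum_repr' k, map_sum, sum_apply']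
    refine (sum_apply' _ _ _).trans (Finset.sum_congr rfl fun i _ => ?_)
    change D' (b i) (tensorSlice H (b i) (h ⊗ₜ k)) = _
    rw [tensorSlice_tmul, map_smul, map_smul]
    rfl
  refine x.indRep_unitarilyEquivalent τ hτ J (fun h0 => ?_) (fun a ξ => ?_) fun s ξ => ?_
  · obtain ⟨k, hk⟩ := exists_ne (0 : N)
    refine hk (hD ?_)
    rw [map_zero]
    ext h
    have h1 := hJ h (ConjSpace.of (ConjSpace.of k))
    rw [h0] at h1
    exact h1.symm
  · induction ξ using TensorProduct.induction_on with
    | zero => simp only [map_zero]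
    | add y z hy hz => simp only [map_add, hy, hz]
    | tmul h k =>
      rw [GammaData.ampl_tmul, hJ, hJ]
      exact hDπ _ a h
  · induction ξ using TensorProduct.induction_on with
    | zero => simp only [map_zero]
    | add y z hy hz => simp only [map_add, hy, hz]
    | tmul h k =>
      rw [GammaData.tensorU_tmul, hJ, hJ]
      exact hW s _ h

/-- If an irreducible representation `π` of `A` is contained in an irreducible covariant
representation, then the latter is equivalent to some `Φ(π, W)`. Here `W̄` is a minimal
`G_π`-invariant subspace of the space of intertwiners `T`, on which `G_π` acts by
`T ↦ U(s) T V(s)⁻¹`; by Schur's lemma `⟪T h₀, T' h₀⟫`, for any unit vector `h₀`, is an inner product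
that induces the operator norm. -/
theorem exists_equiv_of_intertwiner (τ : CovariantRep σ E) (hτ : IsIrreducibleRep τ.integrated)
    {π : A →⋆ₙₐ[ℂ] (H →L[ℂ] H)} (hπ : IsIrreducibleRep π) (T₀ : H →L[ℂ] E) (hne : T₀ ≠ 0)
    (hT₀ : ∀ a h, T₀ (π a h) = τ.π a (T₀ h)) :
    ∃ (K : FinHilbSpace.{w}) (x : GammaData σ H K),
      UnitarilyEquivalent x.indRep τ.integrated := by
  classical
  have := hπ.nontrivial
  obtain ⟨h₀, hh₀⟩ := exists_norm_eq H (zero_le_one)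
  obtain ⟨V, hV⟩ := exists_implements σ π
  obtain ⟨ω, hω, -⟩ := hV.existsUnique_multiplier hπ
  let g : stabGroup σ π → (H →L[ℂ] E) →ₗ[ℂ] (H →L[ℂ] E) := fun s =>
    { toFun := fun T => (τ.U s).toContinuousLinearEquiv.toContinuousLinearMap ∘L T ∘L
        (V s).symm.toContinuousLinearEquiv.toContinuousLinearMap
      map_add' := fun T T' => by
        rw [ContinuousLinearMap.add_comp, ContinuousLinearMap.comp_add]
      map_smul' := fun c T => by
        rw [ContinuousLinearMap.smul_comp, ContinuousLinearMap.comp_smul, RingHom.id_apply] }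
  have hg : ∀ s T h, g s T (V s h) = τ.U s (T h) := fun s T h => by
    change τ.U s (T ((V s).symm (V s h))) = _
    rw [LinearIsometryEquiv.symm_apply_apply]
  have hgnorm : ∀ s T, ‖g s T‖ = ‖T‖ := fun s T => by
    have h1 : ∀ T, ‖g s T‖ ≤ ‖T‖ := fun T => by
      refine ContinuousLinearMap.opNorm_le_bound _ (norm_nonneg _) fun h => ?_
      obtain ⟨h, rfl⟩ := (V s).surjective h
      rw [hg, LinearIsometryEquiv.norm_map, LinearIsometryEquiv.norm_map]
      exact T.le_opNorm h
    refine le_antisymm (h1 T) ?_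
    refine ContinuousLinearMap.opNorm_le_bound _ (norm_nonneg _) fun h => ?_
    rw [← (τ.U s).norm_map, ← hg, ← (V s).norm_map h]
    exact (g s T).le_opNorm _
  have hgg : ∀ s t T, g (s * t) T = (ω s t : ℂ) • g s (g t T) := fun s t T => by
    ext h
    obtain ⟨h, rfl⟩ := (V (s * t)).surjective h
    change _ = (ω s t : ℂ) • g s (g t T) (V (s * t) h)
    rw [hg, ← map_smul, ← hω, hg, hg]
    change τ.U (s * t) _ = _
    rw [map_mul, unitary_mul_apply]
  -- the nonzero finite-dimensional `G_π`-invariant spaces of intertwiners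
  let Good : Submodule ℂ (H →L[ℂ] E) → Prop := fun F => F ≠ ⊥ ∧
    (∀ T ∈ F, ∀ a h, T (π a h) = τ.π a (T h)) ∧ (∀ s, ∀ T ∈ F, g s T ∈ F) ∧ FiniteDimensional ℂ F
  -- the span of the orbit of `T₀`
  have hex : ∃ n, ∃ F, Good F ∧ Module.finrank ℂ F = n := by
    refine ⟨_, Submodule.span ℂ (Set.range fun s => g s T₀), ⟨fun h0 => ?_, fun T hT => ?_,
      fun s T hT => ?_, FiniteDimensional.span_of_finite ℂ (Set.finite_range _)⟩, rfl⟩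
    · have h1 : g 1 T₀ ∈ Submodule.span ℂ (Set.range fun s => g s T₀) :=
        Submodule.subset_span ⟨1, rfl⟩
      rw [h0, Submodule.mem_bot, ← norm_eq_zero, hgnorm, norm_eq_zero] at h1
      exact hne h1
    · induction hT using Submodule.span_induction with
      | mem T hT =>
        obtain ⟨s, rfl⟩ := hT
        intro a h
        obtain ⟨h, rfl⟩ := (V s).surjective h
        have h1 := hV s (σ (s : G)⁻¹ a) h
        rw [CrossedProduct.aut_cancel_inv] at h1
        beta_reduce
        rw [← h1, hg, hg, hT₀, τ.covariant, CrossedProduct.aut_cancel_inv]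
      | zero => exact fun a h => (map_zero (τ.π a)).symm
      | add T T' _ _ h h' =>
        intro a x
        rw [add_apply, add_apply, h, h', map_add]
      | smul c T _ h =>
        intro a x
        change c • T (π a x) = τ.π a (c • T x)
        rw [h, map_smul]
    · induction hT using Submodule.span_induction with
      | mem T hT =>
        obtain ⟨t, rfl⟩ := hT
        have h1 := hgg s t T₀
        rw [← inv_smul_eq_iff₀ (Circle.coe_ne_zero _)] at h1
        beta_reduce
        rw [← h1]
        exact Submodule.smul_mem _ _ (Submodule.subset_span ⟨s * t, rfl⟩)
      | zero =>
        rw [map_zero]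
        exact zero_mem _
      | add T T' _ _ h h' =>
        rw [map_add]
        exact add_mem h h'
      | smul c T _ h =>
        rw [map_smul]
        exact Submodule.smul_mem _ _ h
  obtain ⟨F, ⟨hF0, hFπ, hFg, hFfin⟩, hFn⟩ := Nat.find_spec hex
  have hmin : ∀ F' ≤ F, F' ≠ ⊥ → (∀ s, ∀ T ∈ F', g s T ∈ F') → F' = F := fun F' hle hne' hF' => by
    have hfin : FiniteDimensional ℂ F' := Submodule.finiteDimensional_of_le hle
    refine Submodule.eq_of_le_of_finrank_le hle ?_
    rw [hFn]
    exact Nat.find_min' hex ⟨F', ⟨hne', fun T hT => hFπ T (hle hT), hF', hfin⟩, rfl⟩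
  -- `‖T h₀‖` is the operator norm, so the inner product below induces the norm that `F` has
  have hnorm : ∀ T : F, ‖T‖ = ‖(T : H →L[ℂ] E) h₀‖ := fun T => by
    obtain ⟨c, hc⟩ := hπ.inner_intertwiners T.1 T.1 (hFπ T T.2) (hFπ T T.2)
    have h1 : ∀ x, ‖T.1 x‖ ^ 2 = c.re * ‖x‖ ^ 2 :=
      norm_sq_of_inner (T.1 : H →ₗ[ℂ] E) hc
    have h3 := h1 h₀
    rw [hh₀, one_pow, mul_one] at h3
    apply le_antisymm
    · refine ContinuousLinearMap.opNorm_le_bound _ (norm_nonneg _) fun x => ?_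
      refine le_of_sq_le_sq ?_ (by positivity)
      rw [mul_pow, h3]
      exact (h1 x).le
    · have h4 := T.1.le_opNorm h₀
      rwa [hh₀, mul_one] at h4
  let instN : NormedAddCommGroup F := F.normedAddCommGroup
  let instI : InnerProductSpace ℂ F :=
    { (inferInstance : NormedSpace ℂ F) with
      inner := fun S T => inner ℂ (S.1 h₀) (T.1 h₀)
      norm_sq_eq_re_inner := fun T => by
        rw [hnorm]
        exact norm_sq_eq_re_inner (𝕜 := ℂ) _
      conj_inner_symm := fun S T => inner_conj_symm (𝕜 := ℂ) _ _
      add_left := fun S T R => inner_add_left (𝕜 := ℂ) _ _ _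
      smul_left := fun S T c => inner_smul_left (𝕜 := ℂ) _ _ _ }
  let W₀ : stabGroup σ π → (F →ₗᵢ[ℂ] F) := fun s =>
    { toFun := fun T => ⟨g s T, hFg s T T.2⟩
      map_add' := fun S T => Subtype.ext (map_add (g s) _ _)
      map_smul' := fun c T => Subtype.ext (map_smul (g s) _ _)
      norm_map' := fun T => hgnorm s T }
  let W : stabGroup σ π → (F ≃ₗᵢ[ℂ] F) := fun s => (W₀ s).toLinearIsometryEquiv rfl
  refine τ.exists_equiv_of_action hτ hπ hV hω F F.subtype F.injective_subtype
    (fun T a h => hFπ T T.2 a h) W (fun s T h => hg s T h) ⟨?_, fun L _ hL => ?_⟩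
  · exact (Submodule.nontrivial_iff_ne_bot).mpr hF0
  · rw [or_iff_not_imp_left]
    intro hL0
    have h1 := hmin (L.map F.subtype) (Submodule.map_subtype_le F L)
      (fun h => hL0 (Submodule.map_injective_of_injective F.injective_subtype
        (h.trans (Submodule.map_bot _).symm))) (by
        rintro s _ ⟨T, hT, rfl⟩
        exact ⟨W s T, hL s T hT, rfl⟩)
    rw [Submodule.eq_top_iff']
    intro T
    have hT : (T : H →L[ℂ] E) ∈ L.map F.subtype := by rw [h1]; exact T.2
    obtain ⟨T', hT', hTT'⟩ := hT
    rwa [← Subtype.ext hTT']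

/-- Every irreducible representation of the crossed product is equivalent to some `Φ(π, W)`. -/
theorem exists_indRep_equiv (ρ : CrossedProduct σ →⋆ₙₐ[ℂ] (E →L[ℂ] E)) (hρ : IsIrreducibleRep ρ) :
    ∃ (L : HilbSpace.{w}) (K : FinHilbSpace.{w}) (x : GammaData σ L K),
      UnitarilyEquivalent x.indRep ρ := by
  obtain ⟨τ, rfl⟩ := exists_integrated_eq ρ hρ
  obtain ⟨L, hcl, hL, hne, hmin⟩ := τ.exists_minimal_invariant hρ
  have : CompleteSpace L := hcl.completeSpace_coe
  have hirr := subrep_irreducible τ.nondeg L hL hne hmin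
  obtain ⟨K, x, hx⟩ := τ.exists_equiv_of_intertwiner hρ hirr L.subtypeL (fun h => hne <| by
    rw [Submodule.eq_bot_iff]
    intro y hy
    exact congrArg (fun T : L →L[ℂ] E => T ⟨y, hy⟩) h) fun a h => rfl
  exact ⟨⟨L⟩, K, x, hx⟩

end CovariantRep

/-! ### The fibres of `Γ̃` over the dual of the algebra -/

namespace GammaData

variable {G : Type v} [Group G] {A : Type u} [NonUnitalCStarAlgebra A]
  {H : Type w} [NormedAddCommGroup H] [InnerProductSpace ℂ H] [CompleteSpace H]
  {K : Type w} [NormedAddCommGroup K] [InnerProductSpace ℂ K]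
  {H₁ : Type w} [NormedAddCommGroup H₁] [InnerProductSpace ℂ H₁] [CompleteSpace H₁]
  {K₁ : Type w} [NormedAddCommGroup K₁] [InnerProductSpace ℂ K₁] [FiniteDimensional ℂ K₁]
  {K₂ : Type w} [NormedAddCommGroup K₂] [InnerProductSpace ℂ K₂] [FiniteDimensional ℂ K₂]
  {σ : G →* (A ≃⋆ₐ[ℂ] A)}

/-- The unitary `c W`, for a scalar `c` of modulus one. -/
noncomputable def circleSmul (c : Circle) (W : K ≃ₗᵢ[ℂ] K) : K ≃ₗᵢ[ℂ] K where
  toFun x := (c : ℂ) • W x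
  invFun x := W.symm ((c : ℂ)⁻¹ • x)
  left_inv x := by
    change W.symm ((c : ℂ)⁻¹ • (c : ℂ) • W x) = x
    rw [inv_smul_smul₀ (Circle.coe_ne_zero c), LinearIsometryEquiv.symm_apply_apply]
  right_inv x := by
    change (c : ℂ) • W (W.symm ((c : ℂ)⁻¹ • x)) = x
    rw [LinearIsometryEquiv.apply_symm_apply, smul_inv_smul₀ (Circle.coe_ne_zero c)]
  map_add' x y := by rw [map_add, smul_add]
  map_smul' z x := by rw [map_smul, smul_comm, RingHom.id_apply]
  norm_map' x := by
    change ‖(c : ℂ) • W x‖ = ‖x‖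
    rw [norm_smul, Circle.norm_coe, one_mul, LinearIsometryEquiv.norm_map]

theorem circleSmul_apply (c : Circle) (W : K ≃ₗᵢ[ℂ] K) (x : K) :
    circleSmul c W x = (c : ℂ) • W x := rfl

variable {π : A →⋆ₙₐ[ℂ] (H →L[ℂ] H)} (hπ : IsIrreducibleRep π)
  {V : stabGroup σ π → (H ≃ₗᵢ[ℂ] H)} (hV : Implements σ π V)
  {ω : stabGroup σ π → stabGroup σ π → Circle} (hω : HasMultiplier V ω)

/-- Pairs formed with the same `π` and `V` are equivalent if and only if the projective
representations are: the unitary on the space of `π` is a scalar. -/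
theorem mk_equivalent_mk_iff
    {W₁ : stabGroup σ π → (K₁ ≃ₗᵢ[ℂ] K₁)} (h₁ : HasMultiplier W₁ ω) (i₁ : IsIrreducibleProj W₁)
    {W₂ : stabGroup σ π → (K₂ ≃ₗᵢ[ℂ] K₂)} (h₂ : HasMultiplier W₂ ω) (i₂ : IsIrreducibleProj W₂) :
    (GammaData.mk π hπ V hV ω hω W₁ h₁ i₁).Equivalent (GammaData.mk π hπ V hV ω hω W₂ h₂ i₂) ↔
      ∃ R : K₁ ≃ₗᵢ[ℂ] K₂, ∀ s η, R (W₁ s η) = W₂ s (R η) := by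
  constructor
  · rintro ⟨T, R, c, hT, hcV, hcW⟩
    refine ⟨R, fun s η => ?_⟩
    have := hπ.nontrivial
    obtain ⟨x, hx⟩ := exists_ne (0 : H)
    obtain ⟨z, hz⟩ := hπ.exists_eq_circle_smul (T := .refl ℂ H) (fun _ _ => rfl) hT
    have hc : (c s : ℂ) = 1 := by
      have h := hcV s s.2 s.2 x
      change T (V s x) = (c s : ℂ) • V s (T x) at h
      have hne : T (V s x) ≠ 0 := by
        rwa [ne_eq, LinearIsometryEquiv.map_eq_zero_iff, LinearIsometryEquiv.map_eq_zero_iff]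
      have h' : V s (T x) = T (V s x) := by
        rw [hz, hz, map_smul]
        rfl
      rw [h'] at h
      exact (smul_left_injective ℂ hne ((one_smul ℂ _).trans h)).symm
    have h := hcW s s.2 s.2 η
    rw [hc, one_smul] at h
    exact h
  · rintro ⟨R, hR⟩
    refine ⟨.refl ℂ H, R, fun _ => 1, fun _ _ => rfl, fun s h₁ h₂ ξ => ?_, fun s h₁ h₂ η => ?_⟩
    · rw [Circle.coe_one, one_smul]
      rfl
    · rw [Circle.coe_one, one_smul]
      exact hR _ η

/-- Every pair whose first component is equivalent to `π` is equivalent to a pair formed with `π`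
and a given choice of `V`. -/
theorem exists_equivalent_mk (y : GammaData σ H₁ K₁) (h : UnitarilyEquivalent π y.π) :
    ∃ (W : stabGroup σ π → (K₁ ≃ₗᵢ[ℂ] K₁)) (h : HasMultiplier W ω) (i : IsIrreducibleProj W),
      y.Equivalent (GammaData.mk π hπ V hV ω hω W h i) := by
  obtain ⟨T, hT⟩ := h
  have := hπ.nontrivial
  have hs : ∀ s : stabGroup σ π, (s : G) ∈ stabGroup σ y.π := fun s => mem_stabGroup_congr σ hT s.2
  let f : stabGroup σ π → stabGroup σ y.π := fun s => ⟨s, hs s⟩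
  have hf : Function.Surjective f := fun s => ⟨⟨s, mem_stabGroup_congr σ hT.symm s.2⟩, rfl⟩
  have hc : ∀ s, ∃ c : Circle, ∀ ξ, T (V s ξ) = (c : ℂ) • y.V (f s) (T ξ) := fun s => by
    have hi₁ : Intertwines π (compAut y.π (σ s)) (T.trans (y.V (f s))) := fun a ξ => by
      rw [LinearIsometryEquiv.trans_apply, hT, y.implements]
      rfl
    have hi₂ : Intertwines π (compAut y.π (σ s)) ((V s).trans T) := fun a ξ => by
      rw [LinearIsometryEquiv.trans_apply, hV, hT]
      rfl
    exact hπ.exists_eq_circle_smul hi₁ hi₂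
  choose c hc using hc
  -- the multipliers of `V` and of `V₂` differ by the coboundary of `c`
  have hmul : ∀ s t, (c s * c t * y.ω (f s) (f t) : ℂ) = ω s t * c (s * t) := fun s t => by
    obtain ⟨x, hx⟩ := exists_ne (0 : H)
    have h1 := congrArg T (hω s t x)
    rw [hc, hc, map_smul, map_smul, hc, y.multV, smul_smul, smul_smul, smul_smul] at h1
    have hne : y.V (f s * f t) (T x) ≠ 0 := by
      rwa [ne_eq, LinearIsometryEquiv.map_eq_zero_iff, LinearIsometryEquiv.map_eq_zero_iff]
    have h2 := smul_left_injective ℂ hne h1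
    rw [← h2, mul_assoc]
  refine ⟨fun s => circleSmul (c s) (y.W (f s)), fun s t ξ => ?_, ⟨y.irredW.nontrivial,
    fun L hcl hL => ?_⟩, ?_⟩
  · simp only [circleSmul_apply]
    rw [map_smul, y.multW, smul_smul, smul_smul, smul_smul, hmul]
    rfl
  · refine (y.irredW.comp hf).eq_bot_or_top L hcl fun s x hx => ?_
    have h1 := L.smul_mem (c s : ℂ)⁻¹ (hL s x hx)
    rwa [circleSmul_apply, inv_smul_smul₀ (Circle.coe_ne_zero _)] at h1
  · classical
    obtain ⟨c', hc'⟩ : ∃ c' : G → Circle, ∀ s h, c' s = c ⟨s, h⟩ :=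
      ⟨fun s => if h : s ∈ stabGroup σ π then c ⟨s, h⟩ else 1, fun s h => dif_pos h⟩
    refine Equivalent.symm ⟨T, .refl ℂ K₁, c', hT, fun s h₁ h₂ ξ => ?_, fun s h₁ h₂ η => ?_⟩
    · rw [hc' s h₁]
      exact hc ⟨s, h₁⟩ ξ
    · rw [hc' s h₁]
      rfl

end GammaData

/-! ### Orbits and the dual of the crossed product -/

section Orbits

variable {G : Type v} [Group G] [Fintype G] {A : Type u} [NonUnitalCStarAlgebra A]

/-- The map `(π, W) ↦ [Φ(π, W)]` on the set of `G`-orbits in `Γ̃`. -/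
noncomputable def orbitPhi (σ : G →* (A ≃⋆ₐ[ℂ] A)) :
    MulAction.orbitRel.Quotient Gᵐᵒᵖ (GammaTilde.{u, v, max u v} σ) →
      DualSpace.{max u v, max u v} (CrossedProduct σ) :=
  Quotient.lift
    (Quotient.lift (fun x : GammaSet.{u, v, max u v} σ => x.data.Phi x.data.indRep_irreducible)
      fun _ _ h => Quotient.sound (GammaData.Equivalent.indRep_unitarilyEquivalent h))
    (by
      rintro _ q ⟨s, rfl⟩
      induction q using Quotient.inductionOn with
      | h x => exact Quotient.sound (x.data.act_indRep_unitarilyEquivalent s.unop))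

theorem orbitPhi_injective (σ : G →* (A ≃⋆ₐ[ℂ] A)) : Function.Injective (orbitPhi σ) := by
  intro p q h
  induction p using Quotient.inductionOn with
  | h p =>
    induction q using Quotient.inductionOn with
    | h q =>
      induction p using Quotient.inductionOn with
      | h x =>
        induction q using Quotient.inductionOn with
        | h y =>
          obtain ⟨s, hs⟩ := GammaData.exists_act_equivalent (x := x.data) (y := y.data)
            (Quotient.exact h)
          have h1 : MulOpposite.op s • x.data.toTilde = y.data.toTilde :=
            Quotient.sound (s := GammaSet.setoid σ) hs
          exact (Quotient.sound (s := MulAction.orbitRel _ _) ⟨MulOpposite.op s, h1⟩).symm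

theorem orbitPhi_surjective (σ : G →* (A ≃⋆ₐ[ℂ] A)) : Function.Surjective (orbitPhi σ) := by
  intro q
  induction q using Quotient.inductionOn with
  | h ρ =>
    obtain ⟨H, K, x, hx⟩ := CovariantRep.exists_indRep_equiv ρ.π ρ.irred
    exact ⟨Quotient.mk _ x.toTilde, Quotient.sound hx⟩

end Orbits

theorem theorem1 {A : Type u} [NonUnitalCStarAlgebra A] {G : Type v} [Group G] [Fintype G]
    (σ : G →* (A ≃⋆ₐ[ℂ] A)) :
    -- every irreducible `π` has implementing unitaries `V` on `G_π`, and each choice of them is a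
    -- projective representation with a unique multiplier `ω`
    (∀ (H : HilbSpace.{max u v}) (π : A →⋆ₙₐ[ℂ] (H →L[ℂ] H)), IsIrreducibleRep π →
      (∃ V : stabGroup σ π → (H ≃ₗᵢ[ℂ] H), Implements σ π V) ∧
      ∀ V : stabGroup σ π → (H ≃ₗᵢ[ℂ] H), Implements σ π V → ∃! ω, HasMultiplier V ω) ∧
    -- for fixed `π`, `V`, `ω`, the elements of `Γ̃` over the class of `π` are exactly the unitary
    -- equivalence classes of irreducible `ω`-representations `W` of `G_π`
    (∀ (H : HilbSpace.{max u v}) (π : A →⋆ₙₐ[ℂ] (H →L[ℂ] H)) (hπ : IsIrreducibleRep π)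
      (V : stabGroup σ π → (H ≃ₗᵢ[ℂ] H)) (hV : Implements σ π V)
      (ω : stabGroup σ π → stabGroup σ π → Circle) (hω : HasMultiplier V ω),
      (∀ (K₁ K₂ : FinHilbSpace.{max u v})
        (W₁ : stabGroup σ π → (K₁ ≃ₗᵢ[ℂ] K₁)) (h₁ : HasMultiplier W₁ ω) (i₁ : IsIrreducibleProj W₁)
        (W₂ : stabGroup σ π → (K₂ ≃ₗᵢ[ℂ] K₂)) (h₂ : HasMultiplier W₂ ω)
        (i₂ : IsIrreducibleProj W₂),
        (GammaData.mk π hπ V hV ω hω W₁ h₁ i₁).toTilde =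
            (GammaData.mk π hπ V hV ω hω W₂ h₂ i₂).toTilde ↔
          ∃ R : K₁ ≃ₗᵢ[ℂ] K₂, ∀ s η, R (W₁ s η) = W₂ s (R η)) ∧
      (∀ (H' : HilbSpace.{max u v}) (K' : FinHilbSpace.{max u v}) (y : GammaData σ H' K'),
        UnitarilyEquivalent π y.π →
          ∃ (K : FinHilbSpace.{max u v}) (W : stabGroup σ π → (K ≃ₗᵢ[ℂ] K))
            (h : HasMultiplier W ω) (i : IsIrreducibleProj W),
            y.toTilde = (GammaData.mk π hπ V hV ω hω W h i).toTilde)) ∧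
    -- the induced representations are irreducible, and `Φ` induces a bijection from the orbits of
    -- `G` in `Γ̃` onto the dual space of the crossed product
    ∃ hirr : ∀ (H : HilbSpace.{max u v}) (K : FinHilbSpace.{max u v}) (x : GammaData σ H K),
        IsIrreducibleRep x.indRep,
      ∃ Ψ : MulAction.orbitRel.Quotient Gᵐᵒᵖ (GammaTilde.{u, v, max u v} σ) ≃
          DualSpace.{max u v, max u v} (CrossedProduct σ),
        ∀ (H : HilbSpace.{max u v}) (K : FinHilbSpace.{max u v}) (x : GammaData σ H K),
          Ψ (Quotient.mk (MulAction.orbitRel Gᵐᵒᵖ (GammaTilde.{u, v, max u v} σ)) x.toTilde) =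
            x.Phi (hirr H K x) := by
  refine ⟨fun H π hπ => ⟨exists_implements σ π, fun V hV => hV.existsUnique_multiplier hπ⟩,
    fun H π hπ V hV ω hω => ⟨fun K₁ K₂ W₁ h₁ i₁ W₂ h₂ i₂ => ?_, fun H' K' y hy => ?_⟩,
    fun H K x => x.indRep_irreducible,
    Equiv.ofBijective (orbitPhi σ) ⟨orbitPhi_injective σ, orbitPhi_surjective σ⟩,
    fun H K x => rfl⟩
  · exact Quotient.eq.trans (GammaData.mk_equivalent_mk_iff hπ hV hω h₁ i₁ h₂ i₂)
  · obtain ⟨W, h, i, hW⟩ := GammaData.exists_equivalent_mk hπ hV hω y hy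
    exact ⟨K', W, h, i, Quotient.sound hW⟩
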